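/- Let $p\ge 2$, $\ell\ge 1$ and $N_0=p\ell-\ell-1$. **Mobiles.** A mobile is a plane tree with black, white and labeled vertices. Labeled vertices carry positive integer labels; edges are regular (joining a white and a labeled vertex) or flagged (joining a white and a black vertex, with a nonnegative integer label on each side). Clockwise around a black vertex, the flag labels are non-increasing at the crossing of each flagged edge and non-decreasing between consecutive flagged edges, and $j-i$ buds are placed between two consecutive flagged edges with consecutive labels $i\le j$. Clockwise around a white vertex, the labels are non-decreasing at the crossing of each flagged edge, constant between a flag and the next flag or labeled vertex, and decrease by $1$ between a labeled vertex and the next flag or labeled vertex. The degree of a black vertex includes its buds. We consider mobiles all of whose black vertices have degree $p$ (weight $1$) and all of whose white vertices have degree $pm$ for some $1\le m\le \ell$ (weight $\hat g_m$ for degree $pm$), where $\hat g_1,\dots,\hat g_\ell$ are independent indeterminates; these mobiles encode $p$-constellations with white degrees at most $p\ell$. Let $R_i\in\mathbb Q[[\hat g_1,\dots,\hat g_\ell]]$ ($i\ge 1$) be the generating function of such mobiles with a marked corner at a labeled vertex with label $i$, plus a conventional term $1$ (the single vertex). Let $W_{i,j}$ ($i\ge j\ge 0$), resp. $B_{i,j}$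 ($0\le i\le j$), be the generating function of white, resp. black, half-mobiles: the part on the side of the white, resp. black, endpoint after cutting a flagged edge, whose flag on the left when going towards that endpoint is $i$ and whose other flag is $j$. **Spectral curve.** There is a power series $R\in\mathbb Q[[\hat g_1,\dots,\hat g_\ell]]$ with $R_i\to R$ coefficientwise as $i\to\infty$ such that, with $$Y(z)=\frac Rz+z^{p-1},\qquad \pi_k(n)=[z^k]Y(z)^n,\qquad X(z)=z+\sum_{j=1}^{\ell}z^{-pj+1}\sum_{m=j}^{\ell}\hat g_m\,\pi_{-pj+1}(pm-1),$$ one has $\lim_i W_{i,i-k}=[z^{-k}]X(z)$ and $\lim_i B_{i,i+k}=[z^k]Y(z)$ for all $k\ge 0$, and $R\,\bigl(1-\sum_{m=1}^{\ell}\hat g_m\pi_1(pm-1)\bigr)=1$. Let $K$ be any algebraically closed field containing $\mathbb Q[[\hat g_1,\dots,\hat g_\ell]]$ and $\Omega\in K$ a primitive $p$-th root of unity. A double point is a pair $(w,\bar w)$ of distinct elements of $K^\times$ with $X(w)=X(\bar w)$ and $Y(w)=Y(\bar w)$. Then: 1. The double points are classified in $N_0$ orbits of $p$ pairs: there are $w_a,\bar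 w_a\in K^\times$ ($1\le a\le N_0$) such that, up to the order of its two elements, every double point is one of the pairs $(w_a\Omega^s,\bar w_a\Omega^s)$, $1\le a\le N_0$, $0\le s\le p-1$, all of which are double points, and this for a unique $(a,s)$ and a unique order. Fix any such choice of representatives $(w_a,\bar w_a)$, including any choice of their order, and set $X_a=w_a/\bar w_a$, $\xi_a=X_a+\dots+X_a^{p-1}$, $\chi_a=X_a^{-1}+\dots+X_a^{-p+1}$. Then: 2. The $2pN_0$ elements $w_a\Omega^s,\bar w_a\Omega^s$ are pairwise distinct, and $R=\bar w_a^{\,p}\,\xi_a=w_a^{\,p}\,\chi_a$ for all $a$. 3. The characteristic equation $$x^{N_0}=\sum_{j=1}^{\ell}R^{-j}(1+\dots+x^{p-2})^j\Bigl(\sum_{n=1}^{pj-1}x^{N_0+j-n}\Bigr)\sum_{m=j}^{\ell}\hat g_m\,\pi_{-pj+1}(pm-1)$$ is a polynomial equation of degree $2N_0$ with $2N_0$ distinct roots, namely the $X_a$ and the $1/X_a$. 4. For $i\ge 0$ define the $pN_0\times pN_0$ determinants, with rows $(a,s)$ and columns $(b,t)$, $1\le a,b\le N_0$, $0\le s,t\le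 p-1$, $$\bar h_i=\det\Bigl(\delta_{a,b}\delta_{s,t}-\frac{\prod_{(c,u)\ne(b,t)}(\bar w_a\Omega^s-w_c\Omega^u)}{\prod_{(c,u)\ne(a,s)}(w_a\Omega^s-w_c\Omega^u)}X_a^{i+N_0p}\Bigr),$$ $$\bar h_i'=\det\Bigl(\delta_{a,b}\delta_{s,t}-\frac{\prod_{(c,u)\ne(b,t)}(w_a\Omega^s-\bar w_c\Omega^u)}{\prod_{(c,u)\ne(a,s)}(\bar w_a\Omega^s-\bar w_c\Omega^u)}X_a^{i+1}\Bigr)$$ and the $N_0\times N_0$ determinants $$u_i=\det_{a,b}\Bigl(\delta_{a,b}-\frac{\prod_{c\ne b}(\bar w_a^p-w_c^p)}{\prod_{c\ne a}(w_a^p-w_c^p)}X_a^{i+p(N_0-1)}\Bigr),\qquad v_i=\det_{a,b}\Bigl(\delta_{a,b}-\frac{\prod_{c\ne b}(w_a^p-\bar w_c^p)}{\prod_{c\ne a}(\bar w_a^p-\bar w_c^p)}X_a^{i}\Bigr).$$ Then for all $i\ge 0$: $\ \bar h_i=\bar h_i'\ne 0$, $\ \bar h_i=\prod_{s=1}^{p}u_{i+s}$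 and $\bar h_i'=\prod_{s=1}^{p}v_{i+s}$. 5. For all $i\ge 1$: $u_i\neq 0$, $v_i\ne 0$ and $$R_i=R\,\frac{\bar h_{i-1}\bar h_{i+1}}{\bar h_i^2}=R\,\frac{u_i\,u_{i+p+1}}{u_{i+1}\,u_{i+p}}=R\,\frac{v_i\,v_{i+p+1}}{v_{i+1}\,v_{i+p}}.$$ 6. For all $i\ge 0$, $u_i$ and $v_i$ are expressed through the $X_a$ only: $$u_i=\det_{a,b}\Bigl(\delta_{a,b}-\frac{\prod_{c\ne b}(\xi_a-\chi_c)}{\prod_{c\ne a}(\chi_a-\chi_c)}X_a^i\Bigr)=\det_{a,b}\Bigl(\delta_{a,b}-\frac{\sigma_a}{\xi_a-\chi_b}X_a^i\Bigr)=\sum_{S\subset\{1,\dots,N_0\}}\prod_{a\in S}(-\tau_aX_a^i)\prod_{a<b\in S}\frac{(\xi_a-\xi_b)(\chi_a-\chi_b)}{(\xi_a-\chi_b)(\chi_a-\xi_b)}$$ with $\sigma_a=\prod_c(\xi_a-\chi_c)/\prod_{c\ne a}(\chi_a-\chi_c)$ and $\tau_a=\prod_{c\ne a}(\xi_a-\chi_c)/\prod_{c\ne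 a}(\chi_a-\chi_c)$; and $v_i$ is given by the same three expressions with $\xi$ and $\chi$ exchanged and $X_a^i$ replaced by $X_a^{i+p(N_0-1)}$. -/

import Mathlib

open scoped LaurentPolynomial

namespace PConstellation

/-! ### Mobiles -/

mutual
  /-- `Mobile i`: mobiles with a marked corner at a labeled vertex with label `i` (a positive
  integer), together with the single vertex labeled `i`. The marked vertex carries an ordered
  (possibly empty) list of white vertices, each joined to it by a regular edge. Clockwise around
  such a white vertex the labels start at `i` (the marked vertex), decrease by `1`, and then run
  from `i - 1` back to `i`. -/
  inductive Mobile : ℕ → Type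
    /-- The vertex with label `i + 1`, with no white vertex (left) around it. -/
    | vertex (i : ℕ) : Mobile (i + 1)
    /-- Attach a white vertex in front of the list of white neighbors of the marked vertex. -/
    | attach {i : ℕ} : WhiteEnv i (i + 1) → Mobile (i + 1) → Mobile (i + 1)

  /-- `WhiteEnv i j`: a sequence of consecutive neighbors of a white vertex, read clockwise, with
  the whole subtrees they carry, along which the current label evolves from `i` to `j`. The label
  decreases by `1` after a labeled vertex and is constant between a flag and the next flag or
  labeled vertex; it is non-decreasing at the crossing of a flagged edge.

  A white half-mobile whose cut flagged edge has flags `i` (on the left, going towards the white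
  vertex) and `j`, with `j ≤ i`, is exactly a `WhiteEnv i j`: the environment of its root. -/
  inductive WhiteEnv : ℕ → ℕ → Type
    | nil (i : ℕ) : WhiteEnv i i
    /-- The next neighbor is a labeled vertex with label `i + 1`. -/
    | labeled {i j : ℕ} : Mobile (i + 1) → WhiteEnv i j → WhiteEnv (i + 1) j
    /-- The next neighbor is a black vertex, across a flagged edge with labels `i ≤ m`. -/
    | flagged {i m j : ℕ} : i ≤ m → BlackEnv i m → WhiteEnv m j → WhiteEnv i j

  /-- `BlackEnv i j`: a sequence of consecutive buds and flagged edges around a black vertex, read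
  clockwise, with the whole subtrees they carry, along which the current label evolves from `i` to
  `j`. The label is non-increasing at the crossing of a flagged edge, and between two flagged edges
  it increases by `1` at each bud.

  A black half-mobile whose cut flagged edge has flags `i` (on the left, going towards the black
  vertex) and `j`, with `i ≤ j`, is exactly a `BlackEnv i j`: the environment of its root. -/
  inductive BlackEnv : ℕ → ℕ → Type
    | nil (i : ℕ) : BlackEnv i i
    /-- The next half-edge is a bud. -/
    | bud {i j : ℕ} : BlackEnv (i + 1) j → BlackEnv i j
    /-- The next neighbor is a white vertex, across a flagged edge with labels `i ≥ m`. -/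
    | flagged {i m j : ℕ} : m ≤ i → WhiteEnv i m → BlackEnv m j → BlackEnv i j
end

/-- Number of neighbors in the sequence. The degree of the white vertex is this number plus `1`,
to account for the edge that leads to the vertex. -/
def WhiteEnv.length : {i j : ℕ} → WhiteEnv i j → ℕ
  | _, _, .nil _ => 0
  | _, _, .labeled _ e => e.length + 1
  | _, _, .flagged _ _ e => e.length + 1

/-- Number of buds and neighbors in the sequence. The degree of the black vertex (buds included) is
this number plus `1`, to account for the edge that leads to the vertex. -/
def BlackEnv.length : {i j : ℕ} → BlackEnv i j → ℕ
  | _, _, .nil _ => 0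
  | _, _, .bud e => e.length + 1
  | _, _, .flagged _ _ e => e.length + 1

mutual
  /-- Degrees of all white vertices of a mobile. -/
  def Mobile.whiteDegrees : {i : ℕ} → Mobile i → Multiset ℕ
    | _, .vertex _ => 0
    | _, .attach e t => (e.length + 1) ::ₘ (e.whiteDegrees + t.whiteDegrees)
  /-- Degrees of all white vertices strictly below the vertex whose environment is described. -/
  def WhiteEnv.whiteDegrees : {i j : ℕ} → WhiteEnv i j → Multiset ℕ
    | _, _, .nil _ => 0
    | _, _, .labeled t e => t.whiteDegrees + e.whiteDegrees
    | _, _, .flagged _ b e => b.whiteDegrees + e.whiteDegrees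
  /-- Degrees of all white vertices strictly below the vertex whose environment is described. -/
  def BlackEnv.whiteDegrees : {i j : ℕ} → BlackEnv i j → Multiset ℕ
    | _, _, .nil _ => 0
    | _, _, .bud e => e.whiteDegrees
    | _, _, .flagged _ w e => (w.length + 1) ::ₘ (w.whiteDegrees + e.whiteDegrees)
end

mutual
  /-- Degrees of all black vertices of a mobile. -/
  def Mobile.blackDegrees : {i : ℕ} → Mobile i → Multiset ℕ
    | _, .vertex _ => 0
    | _, .attach e t => e.blackDegrees + t.blackDegrees
  /-- Degrees of all black vertices strictly below the vertex whose environment is described. -/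
  def WhiteEnv.blackDegrees : {i j : ℕ} → WhiteEnv i j → Multiset ℕ
    | _, _, .nil _ => 0
    | _, _, .labeled t e => t.blackDegrees + e.blackDegrees
    | _, _, .flagged _ b e => (b.length + 1) ::ₘ (b.blackDegrees + e.blackDegrees)
  /-- Degrees of all black vertices strictly below the vertex whose environment is described. -/
  def BlackEnv.blackDegrees : {i j : ℕ} → BlackEnv i j → Multiset ℕ
    | _, _, .nil _ => 0
    | _, _, .bud e => e.blackDegrees
    | _, _, .flagged _ w e => w.blackDegrees + e.blackDegrees
end

noncomputable section

/-! ### Generating functions of mobiles for `p`-constellations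

The weights `ĝ_1, …, ĝ_ℓ` are independent indeterminates; `ĝ_(m+1)` is the variable with index
`m : Fin ℓ`, and it weighs the white vertices of degree `p * (m + 1)`. Black vertices have degree
`p` and weight `1`. -/

/-- Formal power series in the weights `ĝ_1, …, ĝ_ℓ`. -/
abbrev Series (ℓ : ℕ) : Type := MvPowerSeries (Fin ℓ) ℚ

/-- All black vertices have degree `p`, and the white vertices are, for each `m : Fin ℓ`,
exactly `n m` vertices of degree `p * (m + 1)`. -/
def HasContent (p ℓ : ℕ) (n : Fin ℓ →₀ ℕ) (white black : Multiset ℕ) : Prop :=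
  (∀ d ∈ black, d = p) ∧ white = ∑ m : Fin ℓ, n m • ({p * (m.val + 1)} : Multiset ℕ)

/-- `R_i` (for `i ≥ 1`): generating function of mobiles with a marked corner at a vertex labeled
`i`, including the conventional term `1`. -/
def mobileSeries (p ℓ i : ℕ) : Series ℓ := fun n =>
  (Nat.card {t : Mobile i // HasContent p ℓ n t.whiteDegrees t.blackDegrees} : ℚ)

/-- `W_{i,j}` (for `j ≤ i`): generating function of white half-mobiles. -/
def whiteSeries (p ℓ i j : ℕ) : Series ℓ := fun n =>
  (Nat.card {e : WhiteEnv i j //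
    HasContent p ℓ n ((e.length + 1) ::ₘ e.whiteDegrees) e.blackDegrees} : ℚ)

/-- `B_{i,j}` (for `i ≤ j`): generating function of black half-mobiles. -/
def blackSeries (p ℓ i j : ℕ) : Series ℓ := fun n =>
  (Nat.card {e : BlackEnv i j //
    HasContent p ℓ n e.whiteDegrees ((e.length + 1) ::ₘ e.blackDegrees)} : ℚ)

/-- Convergence of formal power series: each coefficient is eventually constant. -/
def ConvergesTo {ℓ : ℕ} (f : ℕ → Series ℓ) (F : Series ℓ) : Prop :=
  ∀ n, ∀ᶠ i in Filter.atTop, MvPowerSeries.coeff n (f i) = MvPowerSeries.coeff n F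

/-! ### Spectral curve -/

section Curve

variable {S : Type*} [CommRing S]

/-- `Y(z) = R / z + z ^ (p - 1)`. -/
def curveY (p : ℕ) (R : S) : S[T;T⁻¹] :=
  LaurentPolynomial.C R * LaurentPolynomial.T (-1) + LaurentPolynomial.T ((p : ℤ) - 1)

/-- `π_k(n; R) = [z ^ k] Y(z) ^ n`: generating function of `p`-paths of length `n` from height `0`
to height `k`. -/
def pathSeries (p : ℕ) (R : S) (n : ℕ) (k : ℤ) : S := (curveY p R ^ n).coeff k

/-- `∑_{m=j}^{ℓ} ĝ_m π_{-pj+1}(pm - 1; R)`. -/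
def alphaCoeff (p : ℕ) {ℓ : ℕ} (g : Fin ℓ → S) (R : S) (j : ℕ) : S :=
  ∑ m : Fin ℓ with j ≤ m.val + 1, g m * pathSeries p R (p * (m.val + 1) - 1) (1 - (p : ℤ) * j)

/-- `X(z) = z + ∑_{j=1}^{ℓ} z ^ (-pj + 1) ∑_{m=j}^{ℓ} ĝ_m π_{-pj+1}(pm - 1; R)`. -/
def curveX (p : ℕ) {ℓ : ℕ} (g : Fin ℓ → S) (R : S) : S[T;T⁻¹] :=
  LaurentPolynomial.T 1 + ∑ j ∈ Finset.Icc 1 ℓ,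
    LaurentPolynomial.C (alphaCoeff p g R j) * LaurentPolynomial.T (1 - (p : ℤ) * j)

end Curve

/-- `N_0 = pℓ - ℓ - 1`. -/
def orbitCount (p ℓ : ℕ) : ℕ := p * ℓ - ℓ - 1

/-- The characteristic polynomial: the left side minus the right side of the characteristic
equation
`x^{N_0} = ∑_{j=1}^{ℓ} R^{-j} (1 + ⋯ + x^{p-2})^j (∑_{n=1}^{pj-1} x^{N_0+j-n})
  ∑_{m=j}^{ℓ} ĝ_m π_{-pj+1}(pm - 1; R)`. -/
def charPoly {K : Type*} [Field K] (p : ℕ) {ℓ : ℕ} (g : Fin ℓ → K) (R : K) : Polynomial K :=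
  Polynomial.X ^ orbitCount p ℓ - ∑ j ∈ Finset.Icc 1 ℓ,
    Polynomial.C (R⁻¹ ^ j * alphaCoeff p g R j)
      * (∑ k ∈ Finset.range (p - 1), Polynomial.X ^ k) ^ j
      * ∑ n ∈ Finset.Icc 1 (p * j - 1), Polynomial.X ^ (orbitCount p ℓ + j - n)

/-- The double points of the spectral curve, as ordered pairs `(w, w̄)` of distinct nonzero elements
of a field `K` that contains the power series through `φ`. -/
def doublePoints {K : Type*} [Field K] (p : ℕ) {ℓ : ℕ} (φ : Series ℓ →+* K) (R : Series ℓ) :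
    Set (Kˣ × Kˣ) :=
  {z | z.1 ≠ z.2 ∧
    LaurentPolynomial.eval₂ φ z.1 (curveX p MvPowerSeries.X R)
      = LaurentPolynomial.eval₂ φ z.2 (curveX p MvPowerSeries.X R) ∧
    LaurentPolynomial.eval₂ φ z.1 (curveY p R) = LaurentPolynomial.eval₂ φ z.2 (curveY p R)}

/-- The pair `(w_a Ω^s, w̄_a Ω^s)`, in this order or, if the last index is `true`, swapped. -/
def orbitPoint {K : Type*} [Field K] {p N : ℕ} (Ω : Kˣ) (w wb : Fin N → Kˣ) :
    Fin N × Fin p × Bool → Kˣ × Kˣ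
  | (a, s, false) => (w a * Ω ^ s.val, wb a * Ω ^ s.val)
  | (a, s, true) => (wb a * Ω ^ s.val, w a * Ω ^ s.val)

/-- The double points are classified in `p`-uples `(w_a Ω^s, w̄_a Ω^s)`, `0 ≤ s < p`: each double
point is, up to the order of its two elements, one of these pairs, for exactly one `(a, s)` and one
order. -/
def IsClassification {K : Type*} [Field K] (p : ℕ) {ℓ : ℕ} (φ : Series ℓ →+* K) (R : Series ℓ)
    (Ω : Kˣ) (w wb : Fin (orbitCount p ℓ) → Kˣ) : Prop :=
  Set.BijOn (orbitPoint (p := p) Ω w wb) Set.univ (doublePoints p φ R)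

/-! ### Determinants -/

section Determinants

variable {K : Type*} [Field K]

/-- `ξ(x) = x + ⋯ + x^{p-1}`; then `χ(x) = x⁻¹ + ⋯ + x^{-(p-1)}` is `ξ(x⁻¹)`. -/
def xi (p : ℕ) (x : K) : K := ∑ k ∈ Finset.Icc 1 (p - 1), x ^ k

/-- `χ(x) = x⁻¹ + ⋯ + x^{-(p-1)}`. -/
def chi (p : ℕ) (x : K) : K := ∑ k ∈ Finset.Icc 1 (p - 1), x⁻¹ ^ k

/-- `det_{a,b} (δ_{a,b} - f_a ∏_{c ≠ b} (x_a - y_c) / ∏_{c ≠ a} (y_a - y_c))`. -/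
def ratioDet {ι : Type*} [Fintype ι] [DecidableEq ι] (x y f : ι → K) : K :=
  Matrix.det (Matrix.of fun a b : ι => (if a = b then 1 else 0) -
    (∏ c ∈ Finset.univ.erase b, (x a - y c)) / (∏ c ∈ Finset.univ.erase a, (y a - y c)) * f a)

/-- `det_{a,b} (δ_{a,b} - σ_a f_a / (x_a - y_b))` with
`σ_a = ∏_c (x_a - y_c) / ∏_{c ≠ a} (y_a - y_c)`. -/
def cauchyDet {ι : Type*} [Fintype ι] [DecidableEq ι] (x y f : ι → K) : K :=
  Matrix.det (Matrix.of fun a b : ι => (if a = b then 1 else 0) -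
    (∏ c, (x a - y c)) / (∏ c ∈ Finset.univ.erase a, (y a - y c)) / (x a - y b) * f a)

/-- `∑_{S} ∏_{a ∈ S} (-τ_a f_a) ∏_{a < b in S}
  (x_a - x_b) (y_a - y_b) / ((x_a - y_b) (y_a - x_b))` with
`τ_a = ∏_{c ≠ a} (x_a - y_c) / ∏_{c ≠ a} (y_a - y_c)`, over all subsets `S` of the indices. -/
def subsetSum {N : ℕ} (x y f : Fin N → K) : K :=
  ∑ S : Finset (Fin N),
    (∏ a ∈ S, -((∏ c ∈ Finset.univ.erase a, (x a - y c))
      / (∏ c ∈ Finset.univ.erase a, (y a - y c)) * f a)) *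
    ∏ a ∈ S, ∏ b ∈ S with a < b,
      ((x a - x b) * (y a - y b)) / ((x a - y b) * (y a - x b))

variable {p N : ℕ} (Ω : Kˣ) (w wb : Fin N → Kˣ)

/-- `X_a = w_a / w̄_a`. -/
def root (a : Fin N) : K := (w a : K) / (wb a : K)

/-- The `pN × pN` determinant `h̄_i`, first expression. -/
def hBar (p : ℕ) (i : ℕ) : K :=
  ratioDet (fun as : Fin N × Fin p => (wb as.1 : K) * (Ω : K) ^ as.2.val)
    (fun as => (w as.1 : K) * (Ω : K) ^ as.2.val) (fun as => root w wb as.1 ^ (i + N * p))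

/-- The `pN × pN` determinant `h̄_i`, second expression. -/
def hBar' (p : ℕ) (i : ℕ) : K :=
  ratioDet (fun as : Fin N × Fin p => (w as.1 : K) * (Ω : K) ^ as.2.val)
    (fun as => (wb as.1 : K) * (Ω : K) ^ as.2.val) (fun as => root w wb as.1 ^ (i + 1))

/-- The `N × N` determinant `u_i`. -/
def uDet (p : ℕ) (i : ℕ) : K :=
  ratioDet (fun a => (wb a : K) ^ p) (fun a => (w a : K) ^ p)
    (fun a => root w wb a ^ (i + p * (N - 1)))

/-- The `N × N` determinant `v_i`. -/
def vDet (p : ℕ) (i : ℕ) : K :=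
  ratioDet (fun a => (w a : K) ^ p) (fun a => (wb a : K) ^ p) (fun a => root w wb a ^ i)

end Determinants

end

end PConstellation

-- Recursion. Modulo p, the change of label along an environment is determined by its length. For a
-- black half-mobile of degree p this leaves only p - 1 buds. Turning around a white vertex is
-- therefore a path with steps -1 (a labeled vertex, weight R_i) and p - 1 (a black vertex, weight
-- 1). Extended by 0 to i ≤ 0, the R_i satisfy R_i (1 - ∑ g_m Z_{i-1,i}(pm - 1)) = 1, where Z is
-- `pathWeight`. Each use of this equation gains a factor g_m, which gives both the limit R and the
-- uniqueness of the solution. With constant weight R, paths are counted by powers of Y.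
--
-- Double points. Put x = w / w̄. Then Y(w) = Y(w̄) means R = w̄^p ξ(x), and given this, X(w) =
-- X(w̄) means that x is a root of the characteristic polynomial, which is palindromic
-- (`mem_doublePoints_iff`). The order of power series is extended to a valuation of K
-- (`exists_extendsOrder`). Let β_j be the coefficients of the characteristic equation. Rescaled by
-- an N_0-th root of β_ℓ, the polynomial reduces to T^{N_0} - 1 over a residue field of
-- characteristic zero. So N_0 simple roots lie in the maximal ideal, the others are their inverses,
-- and ξ takes distinct values at all of them (`IsSmall.xi_injOn`).
--
-- Determinants. By Lagrange interpolation each determinant, times det(y_a^{e_k}), equals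
-- det(y_a^{e_k} - f_a x_a^{e_k}) (`ratioDet_mul_det`). Sorting the exponents modulo p factors the
-- pN_0-determinants into the u's or the v's (`ratioDet_orbits`). Expanding by rows gives the sums
-- over subsets (`ratioDet_eq_subsetSum`). These sums for u_i and v_i have the same pair
-- interactions, and their one-index weights agree by a product identity over the fibres of Y
-- (`prod_xi_sub_exchange`), so u_i = v_i.
--
-- Solution. Up to a nonzero factor, v_i is the determinant of w̄_a^{i+pk} - w_a^{i+pk} (`pairDet`),
-- which only changes sign when the two elements of a pair are exchanged. All |X_a| may thus be
-- assumed less than 1, and then v_i is a unit for i ≥ 1. Consider the ring of Laurent polynomials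
-- that agree at w_a and w̄_a for every a; it contains X and Y. Since `pairDet` does not vanish, no
-- nonzero element of this ring has only the exponents j + pk with k < N_0, and there is a monic E_i
-- with exponents i + 1 + pk, k ≤ N_0. Comparing supports gives Y E_i = r_i E_{i-1} + E_{i+p-1} for
-- i ≥ 1, with r_i = R v_i v_{i+p+1} / (v_{i+1} v_{i+p}). Powers of Y then act on the E_i through
-- weighted paths. As X - ∑ g_m Y^{pm-1} has positive exponents only, a second comparison of
-- supports shows that r_i satisfies the recursion of R_i (`IsWave.mul_one_sub_vertexSum`). The two
-- solutions agree up to every power of the weights, and their difference is algebraic over the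
-- power series, hence zero.

open scoped LaurentPolynomial

namespace PConstellation

/-! ### Counting objects with a multi-index statistic -/

noncomputable section

section Counting

variable {σ T U : Type*}

/-- Generating function of the objects of a type according to a statistic. -/
def gf (s : T → (σ →₀ ℕ)) : MvPowerSeries σ ℚ := fun n => (Nat.card {t // s t = n} : ℚ)

theorem coeff_gf (s : T → (σ →₀ ℕ)) (n : σ →₀ ℕ) :
    MvPowerSeries.coeff n (gf s) = (Nat.card {t // s t = n} : ℚ) := rfl

theorem gf_equiv {s : T → (σ →₀ ℕ)} {s' : U → (σ →₀ ℕ)} (f : T → U) (hf : Function.Bijective f)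
    (h : ∀ t, s' (f t) = s t) : gf s' = gf s := by
  ext n
  rw [coeff_gf, coeff_gf]
  congr 1
  refine (Nat.card_congr ?_).symm
  exact (Equiv.ofBijective f hf).subtypeEquiv fun t => by simp [h]

theorem gf_sum (s : T → (σ →₀ ℕ)) (s' : U → (σ →₀ ℕ)) (hs : ∀ n, Finite {t // s t = n})
    (hs' : ∀ n, Finite {t // s' t = n}) : gf (Sum.elim s s') = gf s + gf s' := by
  ext n
  rw [map_add, coeff_gf, coeff_gf, coeff_gf, ← Nat.cast_add]
  have := hs n
  have := hs' n
  rw [← Nat.card_sum, Nat.card_congr (Equiv.subtypeSum (p := fun t => Sum.elim s s' t = n))]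
  rfl

theorem gf_sigma {κ : Type*} [Fintype κ] {T : κ → Type*} (s : ∀ k, T k → (σ →₀ ℕ))
    (hs : ∀ k n, Finite {t // s k t = n}) :
    gf (fun t : Σ k, T k => s t.1 t.2) = ∑ k, gf (s k) := by
  ext n
  rw [map_sum, coeff_gf]
  simp only [coeff_gf]
  rw [← Nat.cast_sum]
  congr 1
  have := fun k => hs k n
  rw [← Nat.card_sigma]
  refine Nat.card_congr ?_
  exact { toFun := fun t => ⟨t.1.1, t.1.2, t.2⟩
          invFun := fun t => ⟨⟨t.1, t.2.1⟩, t.2.2⟩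
          left_inv := fun _ => rfl
          right_inv := fun _ => rfl }

theorem gf_prod (s : T → (σ →₀ ℕ)) (s' : U → (σ →₀ ℕ)) (hs : ∀ n, Finite {t // s t = n})
    (hs' : ∀ n, Finite {t // s' t = n}) :
    gf (fun t : T × U => s t.1 + s' t.2) = gf s * gf s' := by
  classical
  ext n
  rw [MvPowerSeries.coeff_mul, coeff_gf]
  simp only [coeff_gf, ← Nat.cast_mul]
  rw [← Nat.cast_sum, ← Finset.sum_coe_sort]
  congr 1
  simp only [← Nat.card_prod]
  rw [← Nat.card_sigma]
  refine Nat.card_congr ?_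
  exact { toFun := fun t => ⟨⟨(s t.1.1, s' t.1.2), by simpa using t.2⟩, ⟨t.1.1, rfl⟩, ⟨t.1.2, rfl⟩⟩
          invFun := fun t => ⟨(t.2.1.1, t.2.2.1), by
            have := t.1.2
            rw [Finset.HasAntidiagonal.mem_antidiagonal] at this
            simpa only [t.2.1.2, t.2.2.2] using this⟩
          left_inv := fun _ => rfl
          right_inv := by
            rintro ⟨⟨⟨a, b⟩, h⟩, ⟨t, ht⟩, ⟨u, hu⟩⟩
            dsimp only at ht hu
            subst ht hu
            rfl }

theorem gf_unit (m : σ →₀ ℕ) : gf (fun _ : Unit => m) = MvPowerSeries.monomial m (1 : ℚ) := by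
  classical
  ext n
  rw [coeff_gf, MvPowerSeries.coeff_monomial]
  split_ifs with h
  · subst h; simp
  · have : IsEmpty {t : Unit // m = n} := ⟨fun t => h t.2.symm⟩
    simp

theorem gf_empty [IsEmpty T] (s : T → (σ →₀ ℕ)) : gf s = 0 := by
  ext n
  simp [coeff_gf]

theorem gf_shift (s : T → (σ →₀ ℕ)) (m : σ →₀ ℕ) (hs : ∀ n, Finite {t // s t = n}) :
    gf (fun t => m + s t) = MvPowerSeries.monomial m (1 : ℚ) * gf s := by
  rw [← gf_unit, ← gf_prod _ _ (fun n => inferInstance) hs]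
  exact gf_equiv (fun t : Unit × T => t.2)
    ⟨fun a b h => Prod.ext rfl h, fun t => ⟨((), t), rfl⟩⟩ fun _ => rfl

end Counting

/-! ### Contents of mobiles -/

/-- The degrees allowed for `p`-constellations. -/
def Admissible (p ℓ : ℕ) (white black : Multiset ℕ) : Prop :=
  (∀ d ∈ black, d = p) ∧ ∀ d ∈ white, ∃ m : Fin ℓ, d = p * (m.val + 1)

/-- Numbers of white vertices of each allowed degree. -/
def content (p ℓ : ℕ) (white : Multiset ℕ) : Fin ℓ →₀ ℕ :=
  Finsupp.equivFunOnFinite.symm fun m => white.count (p * (m.val + 1))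

theorem content_zero (p ℓ : ℕ) : content p ℓ 0 = 0 := by
  ext m; simp [content]

theorem content_add (p ℓ : ℕ) (a b : Multiset ℕ) :
    content p ℓ (a + b) = content p ℓ a + content p ℓ b := by
  ext m; simp [content]

theorem content_cons {p ℓ : ℕ} (hp : 0 < p) (k : Fin ℓ) (a : Multiset ℕ) :
    content p ℓ ((p * (k.val + 1)) ::ₘ a) = Finsupp.single k 1 + content p ℓ a := by
  ext m
  simp only [content, Finsupp.equivFunOnFinite_symm_apply_apply, Multiset.count_cons,
    Finsupp.coe_add, Pi.add_apply, Finsupp.single_apply]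
  have : p * (m.val + 1) = p * (k.val + 1) ↔ k = m := by
    rw [Nat.mul_right_inj hp.ne', Fin.ext_iff]; omega
  simp only [this]; ring

theorem admissible_zero (p ℓ : ℕ) : Admissible p ℓ 0 0 := by simp [Admissible]

theorem admissible_add {p ℓ : ℕ} {w w' b b' : Multiset ℕ} :
    Admissible p ℓ (w + w') (b + b') ↔ Admissible p ℓ w b ∧ Admissible p ℓ w' b' := by
  simp only [Admissible, Multiset.mem_add, or_imp, forall_and]
  tauto

theorem admissible_cons_white {p ℓ d : ℕ} {w b : Multiset ℕ} :
    Admissible p ℓ (d ::ₘ w) b ↔ (∃ m : Fin ℓ, d = p * (m.val + 1)) ∧ Admissible p ℓ w b := by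
  simp only [Admissible, Multiset.mem_cons, forall_eq_or_imp]
  tauto

theorem admissible_cons_black {p ℓ d : ℕ} {w b : Multiset ℕ} :
    Admissible p ℓ w (d ::ₘ b) ↔ d = p ∧ Admissible p ℓ w b := by
  simp only [Admissible, Multiset.mem_cons, forall_eq_or_imp]
  tauto

/-- Separates a condition that does not depend on `n` from a statistic, so that the counts become
coefficients of `gf`. Positivity of `p` makes the degrees p(m + 1) distinct, and multiplicities can
be read off by `count`. -/
theorem hasContent_iff {p ℓ : ℕ} (hp : 0 < p) (n : Fin ℓ →₀ ℕ) (w b : Multiset ℕ) :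
    HasContent p ℓ n w b ↔ Admissible p ℓ w b ∧ content p ℓ w = n := by
  have key : ∀ m k : Fin ℓ, p * (m.val + 1) = p * (k.val + 1) ↔ m = k := fun m k => by
    rw [Nat.mul_right_inj hp.ne', Fin.ext_iff]; omega
  have count_sum : ∀ d, (∑ m : Fin ℓ, n m • ({p * (m.val + 1)} : Multiset ℕ)).count d
      = ∑ m : Fin ℓ, n m * if d = p * (m.val + 1) then 1 else 0 := fun d => by
    rw [Multiset.count_sum']
    simp [Multiset.count_singleton]
  constructor
  · rintro ⟨hb, rfl⟩
    refine ⟨⟨hb, fun d hd => ?_⟩, ?_⟩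
    · rw [Multiset.mem_sum] at hd
      obtain ⟨m, -, hm⟩ := hd
      exact ⟨m, by simpa using Multiset.mem_of_mem_nsmul hm⟩
    · ext k
      simp only [content, Finsupp.equivFunOnFinite_symm_apply_apply]
      rw [count_sum]
      simp [key]
  · rintro ⟨⟨hb, hw⟩, rfl⟩
    refine ⟨hb, ?_⟩
    ext d
    rw [count_sum]
    by_cases h : ∃ m : Fin ℓ, d = p * (m.val + 1)
    · obtain ⟨m, rfl⟩ := h
      simp [key, content]
    · rw [Multiset.count_eq_zero_of_notMem fun hd => h (hw d hd)]
      symm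
      refine Finset.sum_eq_zero fun m _ => ?_
      rw [if_neg fun hd => h ⟨m, hd⟩, mul_zero]

/-! ### Labels modulo `p` -/

-- Every item shifts the label by the same amount modulo p. Around a white vertex this is -1:
-- directly after a labeled vertex, and because a black vertex of degree p has p - 1 further items,
-- each worth +1. Around a black vertex it is +1: directly at a bud, and because a white vertex has
-- degree divisible by p.
mutual
  theorem WhiteEnv.modEq {p ℓ : ℕ} : ∀ {i j : ℕ} (e : WhiteEnv i j),
      Admissible p ℓ e.whiteDegrees e.blackDegrees → (p : ℤ) ∣ j - i + e.length
    | _, _, .nil _, _ => by simp [WhiteEnv.length]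
    | _, _, .labeled (i := i) (j := j) t e, h => by
      rw [WhiteEnv.whiteDegrees, WhiteEnv.blackDegrees, admissible_add] at h
      have := WhiteEnv.modEq e h.2
      rw [WhiteEnv.length]
      push_cast
      convert this using 1
      ring
    | _, _, .flagged (i := i) (m := m) (j := j) hm b e, h => by
      rw [WhiteEnv.whiteDegrees, WhiteEnv.blackDegrees, ← Multiset.cons_add,
        admissible_add, admissible_cons_black] at h
      have h1 := WhiteEnv.modEq e h.2
      have h2 := BlackEnv.modEq b h.1.2
      have h3 : (b.length : ℤ) + 1 = p := by exact_mod_cast h.1.1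
      rw [WhiteEnv.length]
      push_cast
      have : (j - i + (e.length + 1) : ℤ) = (j - m + e.length) + (m - i - b.length) + p := by
        rw [← h3]; ring
      rw [this]
      exact dvd_add (dvd_add h1 h2) dvd_rfl
  theorem BlackEnv.modEq {p ℓ : ℕ} : ∀ {i j : ℕ} (e : BlackEnv i j),
      Admissible p ℓ e.whiteDegrees e.blackDegrees → (p : ℤ) ∣ j - i - e.length
    | _, _, .nil _, _ => by simp [BlackEnv.length]
    | _, _, .bud (i := i) (j := j) e, h => by
      rw [BlackEnv.whiteDegrees, BlackEnv.blackDegrees] at h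
      have := BlackEnv.modEq e h
      rw [BlackEnv.length]
      push_cast at this ⊢
      convert this using 1
      ring
    | _, _, .flagged (i := i) (m := m) (j := j) hm w e, h => by
      rw [BlackEnv.whiteDegrees, BlackEnv.blackDegrees, ← Multiset.cons_add,
        admissible_add, admissible_cons_white] at h
      have h1 := BlackEnv.modEq e h.2
      have h2 := WhiteEnv.modEq w h.1.2
      obtain ⟨k, hk⟩ := h.1.1
      have h3 : (w.length : ℤ) + 1 = p * (k.val + 1) := by exact_mod_cast hk
      rw [BlackEnv.length]
      push_cast
      have : (j - i - (e.length + 1) : ℤ)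
          = (j - m - e.length) + (m - i + w.length) - p * (k.val + 1) := by
        rw [← h3]; ring
      rw [this]
      exact dvd_sub (dvd_add h1 h2) (dvd_mul_right _ _)
end

theorem BlackEnv.le_add_length : ∀ {i j : ℕ} (e : BlackEnv i j), j ≤ i + e.length
  | _, _, .nil _ => by simp [BlackEnv.length]
  | _, _, .bud e => by
    have := e.le_add_length
    rw [BlackEnv.length]; omega
  | _, _, .flagged _ _ e => by
    have := e.le_add_length
    rw [BlackEnv.length]; omega

/-- Only a bud raises the label, and by 1, so climbing L in L items leaves no room for a flagged
edge. -/
theorem BlackEnv.exists_buds (L i j : ℕ) (h : j = i + L) : ∃ b : BlackEnv i j, b.length = L ∧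
    b.whiteDegrees = 0 ∧ b.blackDegrees = 0 ∧ ∀ e : BlackEnv i j, e.length = L → e = b := by
  induction L generalizing i j with
  | zero =>
    obtain rfl : j = i := h
    refine ⟨.nil _, rfl, by simp [BlackEnv.whiteDegrees], by simp [BlackEnv.blackDegrees], ?_⟩
    intro e he
    cases e with
    | nil => rfl
    | bud e => simp [BlackEnv.length] at he
    | flagged _ _ e => simp [BlackEnv.length] at he
  | succ L ih =>
    obtain ⟨b, h1, h2, h3, h4⟩ := ih (i + 1) j (by omega)
    refine ⟨.bud b, by simp [BlackEnv.length, h1], by simp [BlackEnv.whiteDegrees, h2],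
      by simp [BlackEnv.blackDegrees, h3], ?_⟩
    intro e he
    cases e with
    | nil => simp [BlackEnv.length] at he
    | bud e =>
      rw [h4 e (by simpa [BlackEnv.length] using he)]
    | flagged _ _ e =>
      have := e.le_add_length
      rw [BlackEnv.length] at he
      omega

/-- The black environment made of `p - 1` buds. -/
def buds (p i : ℕ) : BlackEnv i (i + (p - 1)) :=
  (BlackEnv.exists_buds (p - 1) i (i + (p - 1)) rfl).choose

section Buds

variable {p : ℕ} (i : ℕ)

theorem buds_length : (buds p i).length = p - 1 :=
  (BlackEnv.exists_buds (p - 1) i (i + (p - 1)) rfl).choose_spec.1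

theorem buds_whiteDegrees : (buds p i).whiteDegrees = 0 :=
  (BlackEnv.exists_buds (p - 1) i (i + (p - 1)) rfl).choose_spec.2.1

theorem buds_blackDegrees : (buds p i).blackDegrees = 0 :=
  (BlackEnv.exists_buds (p - 1) i (i + (p - 1)) rfl).choose_spec.2.2.1

theorem eq_buds {i : ℕ} (e : BlackEnv i (i + (p - 1))) (he : e.length = p - 1) : e = buds p i :=
  (BlackEnv.exists_buds (p - 1) i (i + (p - 1)) rfl).choose_spec.2.2.2 e he

end Buds

/-- By the congruence j - i + 1 is a positive multiple of p, and by the length it is at most p.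
Together with `eq_buds`, this makes black vertices rigid. -/
theorem BlackEnv.eq_add_of_admissible {p ℓ : ℕ} {i j : ℕ} (hp : 0 < p) (hij : i ≤ j)
    (e : BlackEnv i j) (he : e.length + 1 = p)
    (h : Admissible p ℓ e.whiteDegrees e.blackDegrees) : j = i + (p - 1) := by
  have h1 := e.modEq h
  have h2 := e.le_add_length
  have h3 : (p : ℤ) ∣ j - i + 1 := by
    have : (j - i + 1 : ℤ) = (j - i - e.length) + p := by rw [← he]; push_cast; ring
    rw [this]; exact dvd_add h1 dvd_rfl
  have := Int.le_of_dvd (by omega) h3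
  omega


/-! ### Recursive equations for the generating functions -/

/-- Mobiles whose vertices have the allowed degrees. -/
abbrev VMobile (p ℓ i : ℕ) : Type :=
  {t : Mobile i // Admissible p ℓ t.whiteDegrees t.blackDegrees}

/-- White environments of given length below which vertices have the allowed degrees. -/
abbrev VWhite (p ℓ L i j : ℕ) : Type :=
  {e : WhiteEnv i j // e.length = L ∧ Admissible p ℓ e.whiteDegrees e.blackDegrees}

instance (p ℓ : ℕ) : IsEmpty (VMobile p ℓ 0) := ⟨fun t => nomatch t.1⟩

section Recursion

variable {p ℓ : ℕ}

/-- Constructor of mobiles from their parts. -/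
def mobileCons (i : ℕ) :
    Unit ⊕ (Σ k : Fin ℓ, VWhite p ℓ (p * (k.val + 1) - 1) i (i + 1)) × VMobile p ℓ (i + 1) →
      {t : Mobile (i + 1) // 0 < p → Admissible p ℓ t.whiteDegrees t.blackDegrees}
  | .inl _ => ⟨.vertex i, fun _ => by
      simp [Mobile.whiteDegrees, Mobile.blackDegrees, admissible_zero]⟩
  | .inr (⟨k, e⟩, t) => ⟨.attach e.1 t.1, fun hp => by
      rw [Mobile.whiteDegrees, Mobile.blackDegrees, ← Multiset.cons_add, admissible_add,
        admissible_cons_white, e.2.1, Nat.sub_add_cancel (Nat.mul_pos hp (Nat.succ_pos _))]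
      exact ⟨⟨⟨k, rfl⟩, e.2.2⟩, t.2⟩⟩

/-- The mobiles with allowed degrees are obtained from the single vertex by attachments. -/
def mobileBuild (hp : 0 < p) (i : ℕ) (x : Unit ⊕
    (Σ k : Fin ℓ, VWhite p ℓ (p * (k.val + 1) - 1) i (i + 1)) × VMobile p ℓ (i + 1)) :
    VMobile p ℓ (i + 1) := ⟨(mobileCons i x).1, (mobileCons i x).2 hp⟩

theorem mobileBuild_bijective (hp : 0 < p) (i : ℕ) :
    Function.Bijective (mobileBuild (ℓ := ℓ) hp i) := by
  constructor
  · rintro (⟨⟩ | ⟨⟨k, e⟩, t⟩) (⟨⟩ | ⟨⟨k', e'⟩, t'⟩) h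
    · rfl
    · simp [mobileBuild, mobileCons] at h
    · simp [mobileBuild, mobileCons] at h
    · simp only [mobileBuild, mobileCons, Subtype.mk.injEq, Mobile.attach.injEq] at h
      obtain ⟨h1, h2⟩ := h
      obtain ⟨e, he, he'⟩ := e
      obtain ⟨f, hf, hf'⟩ := e'
      dsimp only at h1
      subst h1
      -- The index is not stored in the mobile; it is recovered from the degree of the white vertex.
      have hk : k = k' := by
        have : p * (k.val + 1) = p * (k'.val + 1) := by
          have h1 := Nat.mul_pos hp (Nat.succ_pos k.val)
          have h2 := Nat.mul_pos hp (Nat.succ_pos k'.val)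
          simp only [Nat.succ_eq_add_one] at h1 h2
          omega
        rw [Nat.mul_right_inj hp.ne'] at this
        exact Fin.ext (by omega)
      subst hk
      rw [Subtype.ext h2]
  · rintro ⟨t, ht⟩
    cases t with
    | vertex => exact ⟨.inl (), rfl⟩
    | attach e t =>
      have h := ht
      rw [Mobile.whiteDegrees, Mobile.blackDegrees, ← Multiset.cons_add, admissible_add,
        admissible_cons_white] at h
      obtain ⟨⟨⟨k, hk⟩, h1⟩, h2⟩ := h
      exact ⟨.inr (⟨k, ⟨e, by omega, h1⟩⟩, ⟨t, h2⟩), rfl⟩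

/-- The white environments are obtained by adding a labeled vertex or a black vertex. -/
def whiteBuild (hp : 0 < p) (L i j : ℕ) :
    VMobile p ℓ i × VWhite p ℓ L (i - 1) j ⊕ VWhite p ℓ L (i + (p - 1)) j →
      VWhite p ℓ (L + 1) i j
  | .inl (⟨t, ht⟩, e) => match i, t, ht, e with
    | _ + 1, t, ht, e => ⟨.labeled t e.1, by rw [WhiteEnv.length, e.2.1], by
      rw [WhiteEnv.whiteDegrees, WhiteEnv.blackDegrees, admissible_add]
      exact ⟨ht, e.2.2⟩⟩
  | .inr e => ⟨.flagged (Nat.le_add_right _ _) (buds p i) e.1, by rw [WhiteEnv.length, e.2.1], by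
      rw [WhiteEnv.whiteDegrees, WhiteEnv.blackDegrees, buds_length, buds_whiteDegrees,
        buds_blackDegrees, zero_add, zero_add, Nat.sub_add_cancel hp, admissible_cons_black]
      exact ⟨rfl, e.2.2⟩⟩

/-- A black neighbor carries exactly `buds p i`, hence the label i + (p - 1) after it. The truncated
`i - 1` is harmless at i = 0, where no mobile exists and the first summand is empty. -/
theorem whiteBuild_bijective (hp : 0 < p) (L i j : ℕ) :
    Function.Bijective (whiteBuild (ℓ := ℓ) hp L i j) := by
  constructor
  · rintro (⟨⟨t, ht⟩, e⟩ | e) (⟨⟨t', ht'⟩, e'⟩ | e') h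
    · cases i with
      | zero => nomatch t
      | succ i =>
        simp only [whiteBuild, Subtype.mk.injEq, WhiteEnv.labeled.injEq] at h
        obtain ⟨rfl, h⟩ := h
        rw [Subtype.ext h]
    · cases i with
      | zero => nomatch t
      | succ i => simp [whiteBuild] at h
    · cases i with
      | zero => nomatch t'
      | succ i => simp [whiteBuild] at h
    · simp only [whiteBuild, Subtype.mk.injEq, WhiteEnv.flagged.injEq, heq_eq_eq,
        true_and] at h
      rw [Subtype.ext h]
  · rintro ⟨e, he, h⟩
    cases e with
    | nil => simp [WhiteEnv.length] at he
    | labeled t e =>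
      rw [WhiteEnv.whiteDegrees, WhiteEnv.blackDegrees, admissible_add] at h
      rw [WhiteEnv.length] at he
      exact ⟨.inl (⟨t, h.1⟩, ⟨e, by omega, h.2⟩), rfl⟩
    | flagged hm b e =>
      rw [WhiteEnv.whiteDegrees, WhiteEnv.blackDegrees, ← Multiset.cons_add, admissible_add,
        admissible_cons_black] at h
      rw [WhiteEnv.length] at he
      obtain rfl := b.eq_add_of_admissible hp hm h.1.1 h.1.2
      obtain rfl := eq_buds b (by omega)
      exact ⟨.inr ⟨e, by omega, h.2⟩, rfl⟩

/-- Content of a mobile. -/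
def mobileContent {i : ℕ} (t : VMobile p ℓ i) : Fin ℓ →₀ ℕ := content p ℓ t.1.whiteDegrees

/-- Content of what lies below a white vertex. -/
def whiteContent {L i j : ℕ} (t : VWhite p ℓ L i j) : Fin ℓ →₀ ℕ := content p ℓ t.1.whiteDegrees

/-- Content of a mobile in terms of its parts. -/
def mobilePartsContent (i : ℕ) : Unit ⊕
    (Σ k : Fin ℓ, VWhite p ℓ (p * (k.val + 1) - 1) i (i + 1)) × VMobile p ℓ (i + 1) →
      (Fin ℓ →₀ ℕ) :=
  Sum.elim (fun _ => 0)
    fun x => (Finsupp.single x.1.1 1 + whiteContent x.1.2) + mobileContent x.2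

theorem mobileContent_build (hp : 0 < p) (i : ℕ) (x) :
    mobileContent (mobileBuild (ℓ := ℓ) hp i x) = mobilePartsContent i x := by
  rcases x with ⟨⟩ | ⟨⟨k, e⟩, t⟩
  · simp [mobileContent, mobileBuild, mobileCons, Mobile.whiteDegrees, content_zero,
      mobilePartsContent]
  · simp only [mobileContent, mobileBuild, mobileCons, Mobile.whiteDegrees, mobilePartsContent,
      whiteContent, e.2.1, Nat.sub_add_cancel (Nat.mul_pos hp (Nat.succ_pos k.val)),
      content_cons hp, content_add, Sum.elim_inr, add_assoc]

/-- Content of a white environment in terms of its parts. -/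
def whitePartsContent (L i j : ℕ) :
    VMobile p ℓ i × VWhite p ℓ L (i - 1) j ⊕ VWhite p ℓ L (i + (p - 1)) j → (Fin ℓ →₀ ℕ) :=
  Sum.elim (fun x => mobileContent x.1 + whiteContent x.2) whiteContent

theorem whiteContent_build (hp : 0 < p) (L i j : ℕ) (x) :
    whiteContent (whiteBuild (ℓ := ℓ) hp L i j x) = whitePartsContent L i j x := by
  rcases x with ⟨⟨t, ht⟩, e⟩ | e
  · cases i with
    | zero => nomatch t
    | succ i =>
      simp [whiteContent, whiteBuild, WhiteEnv.whiteDegrees, whitePartsContent, mobileContent,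
        content_add]
  · simp [whiteContent, whiteBuild, WhiteEnv.whiteDegrees, whitePartsContent, buds_whiteDegrees]

theorem finite_of_surjective_content {T U σ : Type*} {s : T → (σ →₀ ℕ)} {s' : U → (σ →₀ ℕ)}
    (f : T → U) (hf : Function.Surjective f) (h : ∀ t, s' (f t) = s t) (N : ℕ)
    (hs : {t | (s t).degree ≤ N}.Finite) : {u | (s' u).degree ≤ N}.Finite := by
  refine (hs.image f).subset fun u hu => ?_
  obtain ⟨t, rfl⟩ := hf u
  exact ⟨t, by simpa [h] using hu, rfl⟩

/-- The length is fixed, so an induction on it needs finiteness for mobiles only at the same content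
bound `N`. -/
theorem finite_white (hp : 0 < p) (N : ℕ)
    (hM : ∀ i, {t : VMobile p ℓ i | (mobileContent t).degree ≤ N}.Finite) (L i j : ℕ) :
    {e : VWhite p ℓ L i j | (whiteContent e).degree ≤ N}.Finite := by
  induction L generalizing i with
  | zero =>
    refine Set.Subsingleton.finite ?_
    rintro ⟨e, he, -⟩ - ⟨e', he', -⟩ -
    cases e with
    | nil =>
      cases e' with
      | nil => rfl
      | labeled => simp [WhiteEnv.length] at he'
      | flagged => simp [WhiteEnv.length] at he'
    | labeled => simp [WhiteEnv.length] at he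
    | flagged => simp [WhiteEnv.length] at he
  | succ L ih =>
    refine finite_of_surjective_content _ (whiteBuild_bijective hp L i j).2
      (whiteContent_build hp L i j) N ?_
    refine (((hM i).prod (ih (i - 1))).image Sum.inl |>.union
      ((ih (i + (p - 1))).image Sum.inr)).subset ?_
    rintro (⟨t, e⟩ | e) h
    · left
      simp only [whitePartsContent, Set.mem_ofPred_eq, Sum.elim_inl, map_add] at h
      exact ⟨(t, e), ⟨show (mobileContent t).degree ≤ N by omega,
        show (whiteContent e).degree ≤ N by omega⟩, rfl⟩
    · exact .inr ⟨e, h, rfl⟩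

/-- An attached white vertex contributes 1 to the degree of the content, so the two remaining parts
obey the bound N - 1. Finiteness cannot be skipped: `Nat.card` of an infinite type is 0, which would
break the sum and product rules for `gf`. -/
theorem finite_mobile (hp : 0 < p) (N i : ℕ) :
    {t : VMobile p ℓ i | (mobileContent t).degree ≤ N}.Finite := by
  induction N generalizing i with
  | zero =>
    cases i with
    | zero => exact Set.toFinite _
    | succ i =>
      refine finite_of_surjective_content _ (mobileBuild_bijective hp i).2
        (mobileContent_build hp i) 0 ?_
      refine (Set.finite_singleton (Sum.inl ())).subset ?_
      rintro (⟨⟩ | ⟨⟨k, e⟩, t⟩) h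
      · rfl
      · simp [mobilePartsContent] at h
  | succ N ih =>
    cases i with
    | zero => exact Set.toFinite _
    | succ i =>
      refine finite_of_surjective_content _ (mobileBuild_bijective hp i).2
        (mobileContent_build hp i) (N + 1) ?_
      have h1 : ∀ k : Fin ℓ, _ := fun k => finite_white hp N ih (p * (k.val + 1) - 1) i (i + 1)
      have h2 : {x : Σ k : Fin ℓ, VWhite p ℓ (p * (k.val + 1) - 1) i (i + 1) |
          (whiteContent x.2).degree ≤ N}.Finite := by
        refine (Set.finite_iUnion fun k => (h1 k).image (Sigma.mk k)).subset ?_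
        rintro ⟨k, e⟩ h
        exact Set.mem_iUnion.2 ⟨k, e, h, rfl⟩
      refine ((h2.prod (ih (i + 1))).image Sum.inr |>.union
        (Set.finite_singleton (Sum.inl ()))).subset ?_
      rintro (⟨⟩ | ⟨⟨k, e⟩, t⟩) h
      · exact .inr rfl
      · left
        simp only [mobilePartsContent, Set.mem_ofPred_eq, Sum.elim_inr, map_add,
          Finsupp.degree_single] at h
        exact ⟨(⟨k, e⟩, t), ⟨show (whiteContent e).degree ≤ N by omega,
          show (mobileContent t).degree ≤ N by omega⟩, rfl⟩

theorem finite_fiber {T σ : Type*} {s : T → (σ →₀ ℕ)} (h : ∀ N, {t | (s t).degree ≤ N}.Finite)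
    (n : σ →₀ ℕ) : Finite {t // s t = n} :=
  ((h n.degree).subset fun t (ht : s t = n) => by simp [ht]).to_subtype

theorem finite_mobile_fiber (hp : 0 < p) (i : ℕ) (n) :
    Finite {t : VMobile p ℓ i // mobileContent t = n} :=
  finite_fiber (fun N => finite_mobile hp N i) n

theorem finite_white_fiber (hp : 0 < p) (L i j : ℕ) (n) :
    Finite {t : VWhite p ℓ L i j // whiteContent t = n} :=
  finite_fiber (fun N => finite_white hp N (finite_mobile hp N) L i j) n

theorem finite_shift_fiber {T σ : Type*} {s : T → (σ →₀ ℕ)} (h : ∀ n, Finite {t // s t = n})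
    (m n : σ →₀ ℕ) : Finite {t // m + s t = n} := by
  have := h (n - m)
  exact Finite.of_injective (β := {t // s t = n - m})
    (fun t => ⟨t.1, eq_tsub_of_add_eq (by rw [add_comm]; exact t.2)⟩)
    fun a b hab => Subtype.ext (by simpa using hab)

theorem gf_mobile_zero : gf (mobileContent (p := p) (ℓ := ℓ) (i := 0)) = 0 := gf_empty _

theorem gf_mobile_succ (hp : 0 < p) (i : ℕ) :
    gf (mobileContent (p := p) (ℓ := ℓ) (i := i + 1))
      = 1 + (∑ k : Fin ℓ, MvPowerSeries.X k *
          gf (whiteContent (p := p) (ℓ := ℓ) (L := p * (k.val + 1) - 1) (i := i) (j := i + 1)))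
        * gf (mobileContent (p := p) (ℓ := ℓ) (i := i + 1)) := by
  have hk : ∀ (k : Fin ℓ) n, Finite {t : VWhite p ℓ (p * (k.val + 1) - 1) i (i + 1) //
      Finsupp.single k 1 + whiteContent t = n} := fun k =>
    finite_shift_fiber (finite_white_fiber hp _ _ _) _
  have hsig : ∀ n, Finite {x : Σ k : Fin ℓ, VWhite p ℓ (p * (k.val + 1) - 1) i (i + 1) //
      Finsupp.single x.1 1 + whiteContent x.2 = n} := fun n => by
    refine Finite.of_injective (β := Σ k : Fin ℓ, {t : VWhite p ℓ (p * (k.val + 1) - 1) i (i + 1) //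
      Finsupp.single k 1 + whiteContent t = n}) (fun x => ⟨x.1.1, x.1.2, x.2⟩) ?_
    rintro ⟨⟨k, e⟩, h⟩ ⟨⟨k', e'⟩, h'⟩ hx
    simp only [Sigma.mk.injEq] at hx
    obtain ⟨rfl, hx⟩ := hx
    simpa using hx
  conv_lhs => rw [gf_equiv _ (mobileBuild_bijective hp i) (mobileContent_build hp i)]
  unfold mobilePartsContent
  have hfin : ∀ n, Finite {x : (Σ k : Fin ℓ, VWhite p ℓ (p * (k.val + 1) - 1) i (i + 1)) ×
      VMobile p ℓ (i + 1) //
        (Finsupp.single x.1.1 1 + whiteContent x.1.2) + mobileContent x.2 = n} := by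
    intro n
    have h := finite_mobile (ℓ := ℓ) hp n.degree (i + 1)
    have h2 : {x : Σ k : Fin ℓ, VWhite p ℓ (p * (k.val + 1) - 1) i (i + 1) |
          (whiteContent x.2).degree ≤ n.degree}.Finite := by
      refine (Set.finite_iUnion fun k => (finite_white hp n.degree (finite_mobile hp _)
        (p * (k.val + 1) - 1) i (i + 1)).image (Sigma.mk k)).subset ?_
      rintro ⟨k, e⟩ h
      exact Set.mem_iUnion.2 ⟨k, e, h, rfl⟩
    refine ((h2.prod h).subset ?_).to_subtype
    rintro ⟨x, t⟩ hx
    have hx : _ + _ = n := hx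
    rw [← hx]
    simp only [map_add, Set.mem_prod, Set.mem_ofPred_eq]
    exact ⟨by omega, by omega⟩
  rw [gf_sum _ _ (fun n => inferInstance) hfin,
    gf_prod (fun x : Σ k : Fin ℓ, VWhite p ℓ (p * (k.val + 1) - 1) i (i + 1) =>
      Finsupp.single x.1 1 + whiteContent x.2) _ hsig (finite_mobile_fiber hp _),
    gf_sigma (fun (k : Fin ℓ) (e : VWhite p ℓ (p * (k.val + 1) - 1) i (i + 1)) =>
      Finsupp.single k 1 + whiteContent e) hk, gf_unit]
  congr 2
  refine Finset.sum_congr rfl fun k _ => ?_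
  rw [gf_shift _ _ (finite_white_fiber hp _ _ _)]
  rfl

theorem gf_white_zero (i j : ℕ) :
    gf (whiteContent (p := p) (ℓ := ℓ) (L := 0) (i := i) (j := j)) = if i = j then 1 else 0 := by
  split_ifs with h
  · subst h
    have : Function.Bijective (fun _ : Unit => (⟨.nil i, by simp [WhiteEnv.length], by
        simp [WhiteEnv.whiteDegrees, WhiteEnv.blackDegrees, admissible_zero]⟩ :
          VWhite p ℓ 0 i i)) := by
      refine ⟨fun _ _ _ => rfl, ?_⟩
      rintro ⟨e, he, -⟩
      cases e with
      | nil => exact ⟨(), rfl⟩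
      | labeled => simp [WhiteEnv.length] at he
      | flagged => simp [WhiteEnv.length] at he
    rw [gf_equiv _ this (s := fun _ => 0), gf_unit]
    · rfl
    · intro t
      simp [whiteContent, WhiteEnv.whiteDegrees, content_zero]
  · have : IsEmpty (VWhite p ℓ 0 i j) := by
      constructor
      rintro ⟨e, he, -⟩
      cases e with
      | nil => exact h rfl
      | labeled => simp [WhiteEnv.length] at he
      | flagged => simp [WhiteEnv.length] at he
    exact gf_empty _

theorem gf_white_succ (hp : 0 < p) (L i j : ℕ) :
    gf (whiteContent (p := p) (ℓ := ℓ) (L := L + 1) (i := i) (j := j))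
      = gf (mobileContent (p := p) (ℓ := ℓ) (i := i))
          * gf (whiteContent (p := p) (ℓ := ℓ) (L := L) (i := i - 1) (j := j))
        + gf (whiteContent (p := p) (ℓ := ℓ) (L := L) (i := i + (p - 1)) (j := j)) := by
  rw [gf_equiv _ (whiteBuild_bijective hp L i j) (whiteContent_build hp L i j)]
  unfold whitePartsContent
  rw [gf_sum _ _ _ (finite_white_fiber hp _ _ _),
    gf_prod _ _ (finite_mobile_fiber hp _) (finite_white_fiber hp _ _ _)]
  intro n
  refine (((finite_mobile hp n.degree i).prod
    (finite_white hp n.degree (finite_mobile hp _) L (i - 1) j)).subset ?_).to_subtype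
  rintro ⟨x, t⟩ hx
  have hx : _ + _ = n := hx
  rw [← hx]
  simp only [map_add, Set.mem_prod, Set.mem_ofPred_eq]
  exact ⟨by omega, by omega⟩

theorem mobileSeries_eq_gf (hp : 0 < p) (i : ℕ) :
    mobileSeries p ℓ i = gf (mobileContent (p := p) (ℓ := ℓ) (i := i)) := by
  ext n
  change (Nat.card _ : ℚ) = Nat.card _
  congr 1
  refine Nat.card_congr ?_
  refine (Equiv.subtypeEquivRight fun t => hasContent_iff hp n _ _).trans ?_
  exact (Equiv.subtypeSubtypeEquivSubtypeInter _ _).symm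

theorem whiteSeries_eq (hp : 0 < p) (i j : ℕ) :
    whiteSeries p ℓ i j = ∑ k : Fin ℓ, MvPowerSeries.X k *
      gf (whiteContent (p := p) (ℓ := ℓ) (L := p * (k.val + 1) - 1) (i := i) (j := j)) := by
  have h : ∀ k : Fin ℓ, (MvPowerSeries.X k : MvPowerSeries (Fin ℓ) ℚ) *
      gf (whiteContent (p := p) (ℓ := ℓ) (L := p * (k.val + 1) - 1) (i := i) (j := j))
      = gf (fun e : VWhite p ℓ (p * (k.val + 1) - 1) i j =>
          Finsupp.single k 1 + whiteContent e) := fun k => by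
    rw [gf_shift _ _ (finite_white_fiber hp _ _ _)]; rfl
  simp only [h]
  rw [← gf_sigma (fun (k : Fin ℓ) (e : VWhite p ℓ (p * (k.val + 1) - 1) i j) =>
    Finsupp.single k 1 + whiteContent e) fun k =>
      finite_shift_fiber (finite_white_fiber hp _ _ _) _]
  have key : ∀ k : Fin ℓ, p * (k.val + 1) - 1 + 1 = p * (k.val + 1) := fun k =>
    Nat.sub_add_cancel (Nat.mul_pos hp (Nat.succ_pos _))
  ext n
  change (Nat.card _ : ℚ) = Nat.card _
  congr 1
  symm
  refine Nat.card_congr (Equiv.ofBijective (fun x => ⟨x.1.2.1, ?_⟩) ⟨?_, ?_⟩)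
  · have hx := x.2
    rw [hasContent_iff hp, x.1.2.2.1, key, admissible_cons_white, content_cons hp]
    exact ⟨⟨⟨_, rfl⟩, x.1.2.2.2⟩, hx⟩
  · rintro ⟨⟨k, e, he, he'⟩, h⟩ ⟨⟨k', e', hk, hk'⟩, h'⟩ hx
    simp only [Subtype.mk.injEq] at hx
    subst hx
    have : k = k' := by
      have h1 := key k
      have h2 := key k'
      have : p * (k.val + 1) = p * (k'.val + 1) := by omega
      rw [Nat.mul_right_inj hp.ne'] at this
      exact Fin.ext (by omega)
    subst this
    rfl
  · rintro ⟨e, he⟩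
    have h := he
    rw [hasContent_iff hp, admissible_cons_white] at h
    obtain ⟨⟨⟨k, hk⟩, h1⟩, h2⟩ := h
    rw [hk, content_cons hp] at h2
    exact ⟨⟨⟨k, e, by omega, h1⟩, h2⟩, rfl⟩

/-- The environment `buds p i` is the only candidate, and it contains no white vertex. -/
theorem blackSeries_eq (hp : 0 < p) (i k : ℕ) :
    blackSeries p ℓ i (i + k) = if k = p - 1 then 1 else 0 := by
  classical
  ext n
  change (Nat.card _ : ℚ) = _
  split_ifs with hk
  · subst hk
    rw [MvPowerSeries.coeff_one]
    split_ifs with hn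
    · subst hn
      rw [Nat.cast_eq_one, Nat.card_eq_one_iff_unique]
      refine ⟨⟨fun a b => Subtype.ext ?_⟩, ⟨⟨buds p i, ?_⟩⟩⟩
      · have ha := ((hasContent_iff hp _ _ _).1 a.2).1
        have hb := ((hasContent_iff hp _ _ _).1 b.2).1
        rw [admissible_cons_black] at ha hb
        rw [eq_buds a.1 (by omega), eq_buds b.1 (by omega)]
      · rw [hasContent_iff hp, buds_length, buds_whiteDegrees, buds_blackDegrees,
          Nat.sub_add_cancel hp, admissible_cons_black]
        exact ⟨⟨rfl, admissible_zero _ _⟩, content_zero _ _⟩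
    · rw [Nat.cast_eq_zero, Nat.card_eq_zero]
      left
      constructor
      rintro ⟨e, he⟩
      rw [hasContent_iff hp, admissible_cons_black] at he
      obtain rfl := eq_buds e (by omega)
      exact hn (by rw [← he.2, buds_whiteDegrees, content_zero])
  · rw [map_zero, Nat.cast_eq_zero, Nat.card_eq_zero]
    left
    constructor
    rintro ⟨e, he⟩
    rw [hasContent_iff hp, admissible_cons_black] at he
    have := e.eq_add_of_admissible hp (Nat.le_add_right _ _) he.1.1 he.1.2
    omega

end Recursion


/-! ### Weighted paths -/

section Paths

variable {S : Type*} [CommRing S]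

/-- Generating function of paths of length `L` from height `i` to height `j` whose steps are
`-1`, with weight `r i` when it starts from height `i`, and `p - 1`, with weight `1`. -/
def pathWeight (p : ℕ) (r : ℤ → S) : ℕ → ℤ → ℤ → S
  | 0, i, j => if i = j then 1 else 0
  | L + 1, i, j => r i * pathWeight p r L (i - 1) j + pathWeight p r L (i + ((p : ℤ) - 1)) j

/-- Weighted sum of paths of lengths `p m - 1`. -/
def vertexSum (p : ℕ) {ℓ : ℕ} (g : Fin ℓ → S) (r : ℤ → S) (i j : ℤ) : S :=
  ∑ k : Fin ℓ, g k * pathWeight p r (p * (k.val + 1) - 1) i j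

theorem map_pathWeight {S' : Type*} [CommRing S'] (f : S →+* S') (p : ℕ) (r : ℤ → S) (L : ℕ)
    (i j : ℤ) : f (pathWeight p r L i j) = pathWeight p (fun i => f (r i)) L i j := by
  induction L generalizing i with
  | zero => simp only [pathWeight]; split_ifs <;> simp
  | succ L ih => simp [pathWeight, ih]

theorem map_vertexSum {S' : Type*} [CommRing S'] (f : S →+* S') (p : ℕ) {ℓ : ℕ} (g : Fin ℓ → S)
    (r : ℤ → S) (i j : ℤ) :
    f (vertexSum p g r i j) = vertexSum p (fun k => f (g k)) (fun i => f (r i)) i j := by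
  simp [vertexSum, map_sum, map_pathWeight]

theorem pathWeight_shift (p : ℕ) (r : ℤ → S) (s : ℤ) (L : ℕ) (i j : ℤ) :
    pathWeight p (fun t => r (t + s)) L i j = pathWeight p r L (i + s) (j + s) := by
  induction L generalizing i with
  | zero => simp [pathWeight]
  | succ L ih =>
    simp only [pathWeight, ih]
    rw [show i - 1 + s = i + s - 1 by ring,
      show i + ((p : ℤ) - 1) + s = i + s + ((p : ℤ) - 1) by ring]

/-- A path of length L descends by at most L, so it only sees the weights at heights at least i - L.
-/
theorem pathWeight_sub_mem {p : ℕ} (hp : 1 ≤ p) (J : Ideal S) (r r' : ℤ → S) (L : ℕ) (i j : ℤ)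
    (h : ∀ t, i - L ≤ t → r t - r' t ∈ J) :
    pathWeight p r L i j - pathWeight p r' L i j ∈ J := by
  induction L generalizing i with
  | zero => simp [pathWeight]
  | succ L ih =>
    simp only [pathWeight]
    have h1 := ih (i - 1) fun t ht => h t (by push_cast; linarith)
    have h2 := ih (i + ((p : ℤ) - 1)) fun t ht => h t (by
      have : (1 : ℤ) ≤ p := by exact_mod_cast hp
      push_cast; linarith)
    have h3 := h i (by push_cast; linarith)
    have : ∀ a a' b b' c c' : S, a * b + c - (a' * b' + c')
        = (a - a') * b + a' * (b - b') + (c - c') := fun _ _ _ _ _ _ => by ring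
    rw [this]
    exact J.add_mem (J.add_mem (J.mul_mem_right _ h3) (J.mul_mem_left _ h1)) h2

/-- The second ideal `J'` records the gain due to the factors `g k`; in the application it raises
the minimal degree by one. -/
theorem vertexSum_sub_mem {p ℓ : ℕ} (hp : 1 ≤ p) (J : Ideal S) (g : Fin ℓ → S) (r r' : ℤ → S)
    (i j : ℤ) (h : ∀ t, i - (p * ℓ : ℕ) ≤ t → r t - r' t ∈ J) (J' : Ideal S)
    (hJ : ∀ k, ∀ f ∈ J, g k * f ∈ J') :
    vertexSum p g r i j - vertexSum p g r' i j ∈ J' := by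
  rw [vertexSum, vertexSum, ← Finset.sum_sub_distrib]
  refine J'.sum_mem fun k _ => ?_
  rw [← mul_sub]
  refine hJ k _ (pathWeight_sub_mem hp J r r' _ i j fun t ht => h t ?_)
  have : p * (k.val + 1) ≤ p * ℓ := Nat.mul_le_mul_left p k.2
  omega

/-- Both steps are -1 modulo p, and neither descends by more than 1. -/
theorem pathWeight_eq_zero {p : ℕ} (hp : 1 ≤ p) (r : ℤ → S) (L : ℕ) (i j : ℤ)
    (h : ¬ ((p : ℤ) ∣ j - i + L ∧ i - L ≤ j)) : pathWeight p r L i j = 0 := by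
  induction L generalizing i with
  | zero =>
    rw [pathWeight, if_neg]
    rintro rfl
    simp at h
  | succ L ih =>
    rw [pathWeight, ih, ih, mul_zero, add_zero]
    · rintro ⟨h1, h2⟩
      refine h ⟨?_, ?_⟩
      · have : (j - i + (L + 1 : ℕ) : ℤ) = (j - (i + ((p : ℤ) - 1)) + L) + p := by
          push_cast; ring
        rw [this]; exact dvd_add h1 dvd_rfl
      · push_cast; omega
    · rintro ⟨h1, h2⟩
      refine h ⟨?_, ?_⟩
      · have : (j - i + (L + 1 : ℕ) : ℤ) = (j - (i - 1) + L) := by push_cast; ring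
        rwa [this]
      · push_cast; omega

theorem pathWeight_bottom {p : ℕ} (hp : 1 ≤ p) (R : S) (L : ℕ) (i : ℤ) :
    pathWeight p (fun _ => R) L i (i - L) = R ^ L := by
  induction L generalizing i with
  | zero => simp [pathWeight]
  | succ L ih =>
    rw [pathWeight, pathWeight_eq_zero hp _ L (i + _) _ fun h => by
      have := h.2; push_cast at this; omega, add_zero]
    have : i - (L + 1 : ℕ) = i - 1 - L := by push_cast; ring
    rw [this, ih, pow_succ']

theorem coeff_C_mul_T_mul (a : S) (n m : ℤ) (f : S[T;T⁻¹]) :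
    (LaurentPolynomial.C a * LaurentPolynomial.T n * f).coeff m = a * f.coeff (m - n) := by
  rw [← LaurentPolynomial.single_eq_C_mul_T]
  exact AddMonoidAlgebra.coeff_single_mul_eq_mul_coeff _ fun m' _ => by
    constructor <;> intro h <;> omega

theorem coeff_T_mul (n m : ℤ) (f : S[T;T⁻¹]) :
    (LaurentPolynomial.T n * f).coeff m = f.coeff (m - n) := by
  have := coeff_C_mul_T_mul 1 n m f
  rwa [map_one, one_mul, one_mul] at this

theorem coeff_C_mul_T (a : S) (n m : ℤ) :
    (LaurentPolynomial.C a * LaurentPolynomial.T n).coeff m = if m = n then a else 0 := by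
  have := coeff_C_mul_T_mul a n m 1
  rw [mul_one] at this
  rw [this, ← LaurentPolynomial.T_zero, LaurentPolynomial.T_apply]
  split_ifs <;> first | omega | simp

theorem coeff_curveY_mul (p : ℕ) (R : S) (f : S[T;T⁻¹]) (m : ℤ) :
    (curveY p R * f).coeff m = R * f.coeff (m + 1) + f.coeff (m - ((p : ℤ) - 1)) := by
  rw [curveY, add_mul, AddMonoidAlgebra.coeff_add, Finsupp.add_apply, coeff_C_mul_T_mul,
    coeff_T_mul, sub_neg_eq_add]

theorem pathSeries_eq (p : ℕ) (R : S) (n : ℕ) (i j : ℤ) :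
    pathSeries p R n (j - i) = pathWeight p (fun _ => R) n i j := by
  induction n generalizing i with
  | zero =>
    rw [pathSeries, pow_zero, ← LaurentPolynomial.T_zero, LaurentPolynomial.T_apply, pathWeight]
    split_ifs <;> first | omega | rfl
  | succ n ih =>
    rw [pathSeries, pow_succ', coeff_curveY_mul, pathWeight, ← ih, ← ih, pathSeries, pathSeries]
    rw [show j - i + 1 = j - (i - 1) by ring,
      show j - i - ((p : ℤ) - 1) = j - (i + ((p : ℤ) - 1)) by ring]

theorem pathSeries_eq_zero {p : ℕ} (hp : 1 ≤ p) (R : S) (n : ℕ) (k : ℤ)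
    (h : ¬ ((p : ℤ) ∣ k + n ∧ -(n : ℤ) ≤ k)) : pathSeries p R n k = 0 := by
  rw [← sub_zero k, pathSeries_eq, pathWeight_eq_zero hp]
  rwa [sub_zero, zero_sub]

theorem pathSeries_bottom {p : ℕ} (hp : 1 ≤ p) (R : S) (n : ℕ) :
    pathSeries p R n (-(n : ℤ)) = R ^ n := by
  rw [show -(n : ℤ) = (0 - n) - 0 by ring, pathSeries_eq, pathWeight_bottom hp]

theorem map_pathSeries {S' : Type*} [CommRing S'] (f : S →+* S') (p : ℕ) (R : S) (n : ℕ) (k : ℤ) :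
    f (pathSeries p R n k) = pathSeries p (f R) n k := by
  rw [← sub_zero k, pathSeries_eq, pathSeries_eq, map_pathWeight]

theorem map_alphaCoeff {S' : Type*} [CommRing S'] (f : S →+* S') (p : ℕ) {ℓ : ℕ} (g : Fin ℓ → S)
    (R : S) (j : ℕ) : f (alphaCoeff p g R j) = alphaCoeff p (fun k => f (g k)) (f R) j := by
  simp [alphaCoeff, map_sum, map_pathSeries]

theorem coeff_curveY {p : ℕ} (R : S) (k : ℕ) :
    (curveY p R).coeff (k : ℤ) = if (k : ℤ) = p - 1 then 1 else 0 := by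
  have := coeff_curveY_mul p R 1 k
  rw [mul_one] at this
  rw [this, ← LaurentPolynomial.T_zero, LaurentPolynomial.T_apply, LaurentPolynomial.T_apply,
    if_neg (by omega), mul_zero, zero_add]
  split_ifs <;> first | omega | rfl

theorem coeff_curveX (p : ℕ) {ℓ : ℕ} (g : Fin ℓ → S) (R : S) (n : ℤ) :
    (curveX p g R).coeff n = (if n = 1 then 1 else 0)
      + ∑ j ∈ Finset.Icc 1 ℓ, if n = 1 - (p : ℤ) * j then alphaCoeff p g R j else 0 := by
  rw [curveX, AddMonoidAlgebra.coeff_add, Finsupp.add_apply, AddMonoidAlgebra.coeff_sum,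
    Finsupp.finsetSum_apply, LaurentPolynomial.T_apply]
  simp only [coeff_C_mul_T, eq_comm]

/-- The part of `X` with non-positive exponents is that of `∑ ĝ_m Y ^ (pm - 1)`. -/
theorem coeff_curveX_of_nonpos {p : ℕ} (hp : 1 ≤ p) {ℓ : ℕ} (g : Fin ℓ → S) (R : S) {n : ℤ}
    (hn : n ≤ 0) : (curveX p g R).coeff n
      = ∑ k : Fin ℓ, g k * pathSeries p R (p * (k.val + 1) - 1) n := by
  have hlen : ∀ k : Fin ℓ, ((p * (k.val + 1) - 1 : ℕ) : ℤ) = p * (k.val + 1) - 1 := fun k => by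
    have : 1 ≤ p * (k.val + 1) := Nat.mul_pos hp (Nat.succ_pos _)
    push_cast [this]; ring
  rw [coeff_curveX, if_neg (by omega), zero_add]
  -- At any other n ≤ 0 both sides vanish: either the congruence modulo p fails, or n is deeper than
  -- every available path.
  by_cases h : ∃ j : ℕ, n = 1 - (p : ℤ) * j ∧ j ∈ Finset.Icc 1 ℓ
  · obtain ⟨j, hj, hmem⟩ := h
    rw [Finset.sum_eq_single_of_mem j hmem, if_pos hj, alphaCoeff, Finset.sum_filter]
    · refine Finset.sum_congr rfl fun k _ => ?_
      split_ifs with hk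
      · rw [hj]
      · rw [pathSeries_eq_zero hp, mul_zero]
        rintro ⟨-, h2⟩
        rw [hlen, hj] at h2
        have : (p : ℤ) * j ≤ p * (k.val + 1) := by linarith
        have := le_of_mul_le_mul_left this (by exact_mod_cast hp)
        omega
    · intro j' _ hne
      rw [if_neg]
      intro h'
      have : (p : ℤ) * j = p * j' := by linarith
      have := mul_left_cancel₀ (by exact_mod_cast (show p ≠ 0 by omega)) this
      exact hne (by exact_mod_cast this.symm)
  · push Not at h
    rw [Finset.sum_eq_zero fun j hj => if_neg fun h' => h j h' hj]
    symm
    refine Finset.sum_eq_zero fun k _ => ?_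
    rw [pathSeries_eq_zero hp, mul_zero]
    rintro ⟨h1, h2⟩
    rw [hlen] at h1 h2
    obtain ⟨c, hc⟩ := h1
    have hc' : n = 1 - p * (k.val + 1 - c) := by linarith
    have hpos : (0 : ℤ) < p := by exact_mod_cast hp
    have h3 : 0 < (k.val : ℤ) + 1 - c := by
      by_contra h3
      have : (p : ℤ) * (k.val + 1 - c) ≤ 0 := mul_nonpos_of_nonneg_of_nonpos hpos.le (by omega)
      omega
    have h4 : 0 ≤ c := by
      by_contra h4
      have : (p : ℤ) * c ≤ p * (-1) := mul_le_mul_of_nonneg_left (by omega) hpos.le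
      omega
    refine h ((k.val : ℤ) + 1 - c).toNat ?_ ?_
    · rw [Int.toNat_of_nonneg h3.le, hc']
    · rw [Finset.mem_Icc]
      have := k.2
      omega

end Paths

/-! ### Limits for large labels -/

section Limits

variable {ℓ : ℕ}

/-- Power series without terms of degree less than `d`. -/
def lowIdeal (ℓ d : ℕ) : Ideal (Series ℓ) where
  carrier := {f | ∀ n : Fin ℓ →₀ ℕ, n.degree < d → MvPowerSeries.coeff n f = 0}
  add_mem' hf hg n hn := by rw [map_add, hf n hn, hg n hn, add_zero]
  zero_mem' n _ := map_zero _
  smul_mem' c f hf n hn := by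
    classical
    rw [smul_eq_mul, MvPowerSeries.coeff_mul]
    refine Finset.sum_eq_zero fun x hx => ?_
    rw [Finset.HasAntidiagonal.mem_antidiagonal] at hx
    rw [hf x.2 (lt_of_le_of_lt _ hn), mul_zero]
    rw [← hx, map_add]
    exact Nat.le_add_left _ _

theorem X_mul_mem_lowIdeal {d : ℕ} (k : Fin ℓ) {f : Series ℓ} (hf : f ∈ lowIdeal ℓ d) :
    MvPowerSeries.X k * f ∈ lowIdeal ℓ (d + 1) := by
  classical
  intro n hn
  rw [MvPowerSeries.coeff_mul]
  refine Finset.sum_eq_zero fun x hx => ?_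
  rw [Finset.HasAntidiagonal.mem_antidiagonal] at hx
  rw [MvPowerSeries.coeff_X]
  split_ifs with h
  · rw [hf x.2, mul_zero]
    rw [← hx, map_add, h, Finsupp.degree_single] at hn
    omega
  · exact zero_mul _

theorem lowIdeal_anti {d d' : ℕ} (h : d ≤ d') : lowIdeal ℓ d' ≤ lowIdeal ℓ d :=
  fun _ hf n hn => hf n (hn.trans_le h)

theorem eq_of_forall_sub_mem_lowIdeal {f f' : Series ℓ} (h : ∀ d, f - f' ∈ lowIdeal ℓ d) :
    f = f' := by
  ext n
  have := h (n.degree + 1) n (Nat.lt_succ_self _)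
  rwa [map_sub, sub_eq_zero] at this

/-- The series `R_i`, extended by `0` to non-positive labels. -/
def labelSeries (p ℓ : ℕ) (i : ℤ) : Series ℓ := mobileSeries p ℓ i.toNat

variable {p : ℕ}

theorem labelSeries_of_nonpos (hp : 0 < p) {i : ℤ} (hi : i ≤ 0) : labelSeries p ℓ i = 0 := by
  rw [labelSeries, Int.toNat_of_nonpos hi, mobileSeries_eq_gf hp, gf_mobile_zero]

theorem gf_white_eq_pathWeight (hp : 0 < p) (L i j : ℕ) :
    gf (whiteContent (p := p) (ℓ := ℓ) (L := L) (i := i) (j := j))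
      = pathWeight p (labelSeries p ℓ) L i j := by
  induction L generalizing i with
  | zero =>
    rw [gf_white_zero, pathWeight]
    simp only [Nat.cast_inj]
  | succ L ih =>
    rw [gf_white_succ hp, ih, ih, pathWeight, ← mobileSeries_eq_gf hp]
    have h2 : ((i + (p - 1) : ℕ) : ℤ) = i + ((p : ℤ) - 1) := by push_cast [hp]; rfl
    rw [h2]
    congr 1
    cases i with
    | zero =>
      have : mobileSeries p ℓ 0 = 0 := by rw [mobileSeries_eq_gf hp, gf_mobile_zero]
      rw [this, labelSeries_of_nonpos hp (by simp), zero_mul, zero_mul]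
    | succ i =>
      have : labelSeries p ℓ ((i + 1 : ℕ) : ℤ) = mobileSeries p ℓ (i + 1) := rfl
      rw [this]
      simp

theorem labelSeries_mul (hp : 0 < p) {i : ℤ} (hi : 1 ≤ i) : labelSeries p ℓ i *
    (1 - vertexSum p MvPowerSeries.X (labelSeries p ℓ) (i - 1) i) = 1 := by
  obtain ⟨n, rfl⟩ : ∃ n : ℕ, i = n + 1 := ⟨(i - 1).toNat, by omega⟩
  have h := gf_mobile_succ (ℓ := ℓ) hp n
  simp only [gf_white_eq_pathWeight hp] at h
  rw [← mobileSeries_eq_gf hp] at h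
  have h1 : mobileSeries p ℓ (n + 1) = labelSeries p ℓ (n + 1) := by
    rfl
  rw [h1] at h
  rw [vertexSum, add_sub_cancel_right]
  push_cast at h
  linear_combination h

theorem whiteSeries_eq_vertexSum (hp : 0 < p) (i j : ℕ) : whiteSeries p ℓ i j
    = vertexSum p MvPowerSeries.X (labelSeries p ℓ) i j := by
  rw [whiteSeries_eq hp, vertexSum]
  simp only [gf_white_eq_pathWeight hp]

/-- One more degree of agreement costs pℓ + 1 units of label: the paths start at i - 1 and descend
by at most pℓ, while the factors g_m supply the extra degree. -/
theorem labelSeries_sub_mem (hp : 0 < p) (d : ℕ) {i i' : ℤ} (hi : (d * (p * ℓ + 1) : ℕ) ≤ i)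
    (hi' : (d * (p * ℓ + 1) : ℕ) ≤ i') : labelSeries p ℓ i - labelSeries p ℓ i' ∈ lowIdeal ℓ d := by
  induction d generalizing i i' with
  | zero => intro n hn; omega
  | succ d ih =>
    have hd : ((d + 1) * (p * ℓ + 1) : ℕ) = d * (p * ℓ + 1) + (p * ℓ + 1) := by ring
    rw [hd] at hi hi'
    have hone : (1 : ℤ) ≤ (d * (p * ℓ + 1) + (p * ℓ + 1) : ℕ) := by
      exact_mod_cast Nat.succ_le_of_lt (by positivity)
    have hm := labelSeries_mul (ℓ := ℓ) hp (hone.trans hi)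
    have hm' := labelSeries_mul (ℓ := ℓ) hp (hone.trans hi')
    have key : vertexSum p MvPowerSeries.X (labelSeries p ℓ) (i - 1) i
        - vertexSum p MvPowerSeries.X (labelSeries p ℓ) (i' - 1) i' ∈ lowIdeal ℓ (d + 1) := by
      -- Translating the paths rather than the labels puts the two sums at the same heights, with
      -- two families of weights to compare.
      have : vertexSum p MvPowerSeries.X (labelSeries p ℓ) (i' - 1) i'
          = vertexSum p MvPowerSeries.X (fun t => labelSeries p ℓ (t + (i' - i))) (i - 1) i := by
        simp only [vertexSum, pathWeight_shift]
        rw [show i - 1 + (i' - i) = i' - 1 by ring, show i + (i' - i) = i' by ring]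
      rw [this]
      refine vertexSum_sub_mem hp (lowIdeal ℓ d) _ _ _ _ _ (fun t ht => ih ?_ ?_) _
        fun k f hf => X_mul_mem_lowIdeal k hf <;> push_cast at * <;> linarith
    have : labelSeries p ℓ i - labelSeries p ℓ i' = labelSeries p ℓ i * labelSeries p ℓ i' *
        (vertexSum p MvPowerSeries.X (labelSeries p ℓ) (i - 1) i
        - vertexSum p MvPowerSeries.X (labelSeries p ℓ) (i' - 1) i') := by
      linear_combination labelSeries p ℓ i' * hm - labelSeries p ℓ i * hm'
    rw [this]
    exact Ideal.mul_mem_left _ _ key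

/-- The limit of the series `R_i`. -/
def limitSeries (p ℓ : ℕ) : Series ℓ := fun n =>
  MvPowerSeries.coeff n (labelSeries p ℓ ((n.degree + 1) * (p * ℓ + 1) : ℕ))

theorem labelSeries_sub_limitSeries_mem (hp : 0 < p) (d : ℕ) {i : ℤ}
    (hi : (d * (p * ℓ + 1) : ℕ) ≤ i) :
    labelSeries p ℓ i - limitSeries p ℓ ∈ lowIdeal ℓ d := by
  intro n hn
  have := labelSeries_sub_mem (ℓ := ℓ) hp (n.degree + 1) (i := i)
    (i' := ((n.degree + 1) * (p * ℓ + 1) : ℕ))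
    (le_trans (by exact_mod_cast Nat.mul_le_mul_right _ hn) hi) le_rfl n (Nat.lt_succ_self _)
  rwa [map_sub] at this ⊢

theorem vertexSum_sub_limit_mem (hp : 0 < p) (d : ℕ) {i : ℤ} (j : ℤ)
    (hi : (d * (p * ℓ + 1) : ℕ) + (p * ℓ : ℕ) ≤ i) :
    vertexSum p MvPowerSeries.X (labelSeries p ℓ) i j
      - vertexSum p MvPowerSeries.X (fun _ => limitSeries p ℓ) i j ∈ lowIdeal ℓ (d + 1) :=
  vertexSum_sub_mem hp (lowIdeal ℓ d) _ _ _ _ _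
    (fun t ht => labelSeries_sub_limitSeries_mem hp d (by push_cast at *; linarith)) _
    fun k f hf => X_mul_mem_lowIdeal k hf

theorem vertexSum_const {S : Type*} [CommRing S] (p : ℕ) (g : Fin ℓ → S) (R : S) (i j : ℤ) :
    vertexSum p g (fun _ => R) i j
      = ∑ k : Fin ℓ, g k * pathSeries p R (p * (k.val + 1) - 1) (j - i) := by
  simp only [vertexSum, pathSeries_eq]

theorem limitSeries_mul (hp : 0 < p) : limitSeries p ℓ * (1 - ∑ m : Fin ℓ,
    MvPowerSeries.X m * pathSeries p (limitSeries p ℓ) (p * (m.val + 1) - 1) 1) = 1 := by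
  refine eq_of_forall_sub_mem_lowIdeal fun d => ?_
  set i : ℤ := ((d * (p * ℓ + 1) + (p * ℓ + 1) : ℕ) : ℤ) with hi
  have hone : (1 : ℤ) ≤ i := by
    rw [hi]; exact_mod_cast Nat.succ_le_of_lt (by positivity)
  have h1 := labelSeries_mul (ℓ := ℓ) hp hone
  have h2 := labelSeries_sub_limitSeries_mem (ℓ := ℓ) hp d (i := i)
    (by rw [hi]; push_cast; nlinarith)
  have h3 := lowIdeal_anti (Nat.le_succ d) (vertexSum_sub_limit_mem (ℓ := ℓ) hp d (i := i - 1) i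
    (by rw [hi]; push_cast; nlinarith))
  rw [vertexSum_const, show i - (i - 1) = 1 by ring] at h3
  have := (lowIdeal ℓ d).sub_mem ((lowIdeal ℓ d).mul_mem_left (labelSeries p ℓ i) h3)
    ((lowIdeal ℓ d).mul_mem_right (1 - ∑ m : Fin ℓ, MvPowerSeries.X m *
      pathSeries p (limitSeries p ℓ) (p * (m.val + 1) - 1) 1) h2)
  convert this using 1
  linear_combination h1

theorem convergesTo_of_sub_mem {f : ℕ → Series ℓ} {F : Series ℓ} (I : ℕ → ℕ)
    (h : ∀ d i, I d ≤ i → f i - F ∈ lowIdeal ℓ d) : ConvergesTo f F := by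
  intro n
  filter_upwards [Filter.eventually_ge_atTop (I (n.degree + 1))] with i hi
  have := h _ i hi n (Nat.lt_succ_self _)
  rwa [map_sub, sub_eq_zero] at this

theorem convergesTo_mobileSeries (hp : 0 < p) :
    ConvergesTo (fun i => mobileSeries p ℓ i) (limitSeries p ℓ) := by
  refine convergesTo_of_sub_mem (fun d => d * (p * ℓ + 1)) fun d i hi => ?_
  have := labelSeries_sub_limitSeries_mem (ℓ := ℓ) hp d (i := i) (by exact_mod_cast hi)
  simpa [labelSeries] using this

theorem convergesTo_whiteSeries (hp : 0 < p) (k : ℕ) :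
    ConvergesTo (fun i => whiteSeries p ℓ i (i - k))
      ((curveX p MvPowerSeries.X (limitSeries p ℓ)).coeff (-(k : ℤ))) := by
  refine convergesTo_of_sub_mem (fun d => d * (p * ℓ + 1) + p * ℓ + k) fun d i hi => ?_
  have := lowIdeal_anti (Nat.le_succ d) (vertexSum_sub_limit_mem (ℓ := ℓ) hp d (i := i)
    ((i - k : ℕ) : ℤ) (by push_cast at *; exact_mod_cast (by linarith)))
  rw [whiteSeries_eq_vertexSum hp, coeff_curveX_of_nonpos hp _ _ (by simp)]
  rw [vertexSum_const, Nat.cast_sub (le_trans (Nat.le_add_left k _) hi), show (i : ℤ) - k - i = -k by ring] at this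
  rw [Nat.cast_sub (le_trans (Nat.le_add_left k _) hi)]
  exact this

theorem convergesTo_blackSeries (hp : 0 < p) (R : Series ℓ) (k : ℕ) :
    ConvergesTo (fun i => blackSeries p ℓ i (i + k)) ((curveY p R).coeff (k : ℤ)) := by
  refine convergesTo_of_sub_mem (fun _ => 0) fun d i _ => ?_
  rw [blackSeries_eq hp, coeff_curveY]
  have : (k = p - 1) ↔ ((k : ℤ) = p - 1) := by omega
  simp only [this, sub_self, Ideal.zero_mem]

end Limits


/-! ### Determinants -/

section RatioDet

variable {K : Type*} [Field K] {ι : Type*} [Fintype ι] [DecidableEq ι]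

/-- Lagrange interpolation at the nodes y is exact on z^k as long as k is smaller than the number of
nodes. -/
theorem sum_lagrange_mul_pow {y : ι → K} (hy : Function.Injective y) (x : K) {k : ℕ}
    (hk : k < Fintype.card ι) :
    ∑ b, (∏ c ∈ Finset.univ.erase b, (x - y c)) / (∏ c ∈ Finset.univ.erase b, (y b - y c))
      * y b ^ k = x ^ k := by
  have h := Lagrange.eq_interpolate_of_eval_eq (s := (Finset.univ : Finset ι)) (v := y)
    (f := (Polynomial.X : Polynomial K) ^ k) (fun b => y b ^ k) hy.injOn
    (by rw [Polynomial.degree_X_pow, Finset.card_univ]; exact_mod_cast hk)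
    (fun i _ => by simp)
  have h := congrArg (Polynomial.eval x) h
  rw [Polynomial.eval_pow, Polynomial.eval_X, Lagrange.interpolate_apply,
    Polynomial.eval_finsetSum] at h
  rw [h]
  refine Finset.sum_congr rfl fun b _ => ?_
  rw [Polynomial.eval_mul, Polynomial.eval_C, mul_comm, Lagrange.basis, Polynomial.eval_prod,
    ← Finset.prod_div_distrib]
  congr 1
  refine Finset.prod_congr rfl fun c _ => ?_
  simp [Lagrange.basisDivisor, div_eq_inv_mul]

/-- Conjugation by the diagonal matrix of the ∏_{c ≠ a} (y_a - y_c) turns the quotients into the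
values at x_a of the Lagrange basis polynomials of the nodes y. Multiplying by a matrix of powers of
the y_b then evaluates these powers at x_a. -/
theorem ratioDet_mul_det {x y f : ι → K} (hy : Function.Injective y) (e : ι → ℕ)
    (he : ∀ k, e k < Fintype.card ι) :
    ratioDet x y f * Matrix.det (Matrix.of fun a k => y a ^ e k)
      = Matrix.det (Matrix.of fun a k => y a ^ e k - f a * x a ^ e k) := by
  set D : ι → K := fun a => ∏ c ∈ Finset.univ.erase a, (y a - y c) with hD
  have hD0 : ∀ a, D a ≠ 0 := fun a => Finset.prod_ne_zero_iff.2 fun c hc =>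
    sub_ne_zero.2 fun h => (Finset.mem_erase.1 hc).1 (hy h).symm
  have hprod : (∏ a, (D a)⁻¹) ≠ 0 := Finset.prod_ne_zero_iff.2 fun a _ => inv_ne_zero (hD0 a)
  refine mul_left_cancel₀ hprod ?_
  rw [mul_left_comm, ← Matrix.det_mul_column, ← Matrix.det_mul_column, ratioDet, ← Matrix.det_mul]
  congr 1
  ext a k
  simp only [Matrix.mul_apply, Matrix.of_apply, sub_mul, Finset.sum_sub_distrib, ite_mul, one_mul,
    zero_mul, Finset.sum_ite_eq, Finset.mem_univ, if_true, mul_sub]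
  congr 1
  rw [← sum_lagrange_mul_pow hy (x a) (he k), Finset.mul_sum, Finset.mul_sum]
  refine Finset.sum_congr rfl fun b _ => ?_
  simp only [hD]
  ring

theorem ratioDet_eq_cauchyDet {x y f : ι → K} (h : ∀ a b, x a ≠ y b) :
    ratioDet x y f = cauchyDet x y f := by
  rw [ratioDet, cauchyDet]
  congr 2
  ext a b
  rw [← Finset.mul_prod_erase Finset.univ (fun c => x a - y c) (Finset.mem_univ b)]
  have := sub_ne_zero.2 (h a b)
  congr 2
  field_simp

/-- Each difference is r/x - r/y = -(r/x)(x - y)/y. The leftover factor y_b / y_a in entry (a, b) is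
a diagonal conjugation, and only (y_a / x_a)^{n-1} survives, with n the size. This is what replaces
w_a^p and w̄_a^p by χ_a and ξ_a. -/
theorem ratioDet_div {r : K} {x y f : ι → K} (hr : r ≠ 0) (hx : ∀ a, x a ≠ 0)
    (hy : ∀ a, y a ≠ 0) :
    ratioDet (fun a => r / x a) (fun a => r / y a) f
      = ratioDet x y (fun a => f a * (y a / x a) ^ (Fintype.card ι - 1)) := by
  have hprod : (∏ a, y a) ≠ 0 := Finset.prod_ne_zero_iff.2 fun a _ => hy a
  refine mul_left_cancel₀ hprod ?_
  rw [ratioDet, ratioDet, ← Matrix.det_mul_column, ← Matrix.det_mul_row]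
  congr 1
  ext a b
  simp only [Matrix.of_apply]
  have key : ∀ (z : K), z ≠ 0 → ∀ b, ∏ c ∈ Finset.univ.erase b, (r / z - r / y c)
      = (-r / z) ^ (Fintype.card ι - 1) * (∏ c ∈ Finset.univ.erase b, (z - y c))
        * y b / ∏ a, y a := by
    intro z hz b
    rw [← Finset.mul_prod_erase Finset.univ y (Finset.mem_univ b)]
    have h1 : ∀ c, r / z - r / y c = -r / z * (z - y c) / y c := fun c => by
      have := hy c
      field_simp
      ring
    have h2 : (Finset.univ.erase b).card = Fintype.card ι - 1 := by
      rw [Finset.card_erase_of_mem (Finset.mem_univ _), Finset.card_univ]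
    simp only [h1, Finset.prod_div_distrib, Finset.prod_mul_distrib, Finset.prod_const, h2]
    have h3 : (∏ c ∈ Finset.univ.erase b, y c) ≠ 0 := Finset.prod_ne_zero_iff.2 fun a _ => hy a
    have h4 := hy b
    rw [div_pow]
    field_simp
  rw [key _ (hx a), key _ (hy a), mul_sub, mul_sub]
  congr 1
  · split_ifs with h
    · rw [h]
    · ring
  · have h1 := hx a
    have h2 := hy a
    have h3 : (-r / x a) ^ (Fintype.card ι - 1)
        = (-r / y a) ^ (Fintype.card ι - 1) * (y a / x a) ^ (Fintype.card ι - 1) := by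
      rw [← mul_pow]
      congr 1
      field_simp
    have h4 : (-r / y a) ^ (Fintype.card ι - 1) ≠ 0 :=
      pow_ne_zero _ (div_ne_zero (neg_ne_zero.2 hr) h2)
    rw [h3]
    by_cases h5 : ∏ c ∈ Finset.univ.erase a, (y a - y c) = 0
    · simp [h5]
    · generalize (-r / y a) ^ (Fintype.card ι - 1) = A at *
      field_simp

end RatioDet

-- Expansion of the determinants over subsets of the indices

section SubsetSum

variable {K : Type*} [Field K] {N : ℕ}

theorem ratioDet_mul_det_vandermonde {x y f : Fin N → K} (hy : Function.Injective y) :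
    ratioDet x y f * (Matrix.vandermonde y).det
      = Matrix.det (Matrix.of fun a (k : Fin N) => y a ^ k.val - f a * x a ^ k.val) :=
  ratioDet_mul_det hy Fin.val fun k => by rw [Fintype.card_fin]; exact k.2

/-- Each row is a sum of two rows of powers, so multilinearity yields Vandermonde determinants whose
nodes are x_a on S and y_a off S. -/
theorem det_sub_eq_sum (x y f : Fin N → K) :
    Matrix.det (Matrix.of fun a (k : Fin N) => y a ^ k.val - f a * x a ^ k.val)
      = ∑ S : Finset (Fin N), (∏ a ∈ S, -f a) * (Matrix.vandermonde (S.piecewise x y)).det := by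
  have h : (fun a (k : Fin N) => y a ^ k.val - f a * x a ^ k.val)
      = (fun a (k : Fin N) => -f a * x a ^ k.val) + fun a (k : Fin N) => y a ^ k.val := by
    ext a k
    simp only [Pi.add_apply]
    ring
  change Matrix.detRowAlternating (fun a (k : Fin N) => y a ^ k.val - f a * x a ^ k.val) = _
  rw [h, AlternatingMap.map_add_univ]
  refine Finset.sum_congr rfl fun S _ => ?_
  have h2 : S.piecewise (fun a (k : Fin N) => -f a * x a ^ k.val) (fun a k => y a ^ k.val)
      = fun a => (if a ∈ S then -f a else 1) • (Matrix.vandermonde (S.piecewise x y)) a := by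
    ext a k
    by_cases ha : a ∈ S <;> simp [ha, Finset.piecewise]
  rw [h2]
  erw [AlternatingMap.map_smul_univ]
  rw [smul_eq_mul]
  congr 1
  simp

/-- The quotient of the mixed Vandermonde determinant by that of y is computed one unordered pair
{a, b} at a time, according to whether none, one or both of a, b lie in S. -/
theorem ratioDet_eq_subsetSum {x y f : Fin N → K} (hy : Function.Injective y)
    (hxy : ∀ a b, x a ≠ y b) : ratioDet x y f = subsetSum x y f := by
  have hV : (Matrix.vandermonde y).det ≠ 0 := Matrix.det_vandermonde_ne_zero_iff.2 hy
  refine mul_right_cancel₀ hV ?_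
  rw [ratioDet_mul_det_vandermonde hy, det_sub_eq_sum, subsetSum, Finset.sum_mul]
  refine Finset.sum_congr rfl fun S _ => ?_
  have h1 : ∏ a ∈ S, -((∏ c ∈ Finset.univ.erase a, (x a - y c))
      / (∏ c ∈ Finset.univ.erase a, (y a - y c)) * f a)
      = (∏ a ∈ S, -f a) * ∏ a ∈ S, ∏ c ∈ Finset.univ.erase a, (x a - y c) / (y a - y c) := by
    rw [← Finset.prod_mul_distrib]
    refine Finset.prod_congr rfl fun a _ => ?_
    rw [Finset.prod_div_distrib]
    ring
  rw [h1, mul_assoc, mul_assoc]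
  congr 1
  -- The ordered pairs off the diagonal are regrouped into pairs a < c, to match the indexing of the
  -- Vandermonde products.
  have h2 : ∏ a ∈ S, ∏ c ∈ Finset.univ.erase a, (x a - y c) / (y a - y c)
      = ∏ a, ∏ c ∈ Finset.Ioi a, (if a ∈ S then (x a - y c) / (y a - y c) else 1) *
        (if c ∈ S then (x c - y a) / (y c - y a) else 1) := by
    have := Finset.prod_prod_Ioi_mul_eq_prod_prod_off_diag
      (fun c a => if a ∈ S then (x a - y c) / (y a - y c) else (1 : K))
    rw [this]
    rw [← Finset.prod_subset (Finset.subset_univ S)]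
    · refine Finset.prod_congr rfl fun a ha => ?_
      rw [Finset.compl_singleton]
      simp [ha]
    · intro a _ ha
      simp [ha]
  have h3 : ∏ a ∈ S, ∏ b ∈ S with a < b,
        ((x a - x b) * (y a - y b)) / ((x a - y b) * (y a - x b))
      = ∏ a, ∏ b ∈ Finset.Ioi a, if a ∈ S ∧ b ∈ S then
        ((x a - x b) * (y a - y b)) / ((x a - y b) * (y a - x b)) else 1 := by
    rw [← Finset.prod_subset (Finset.subset_univ S)]
    · refine Finset.prod_congr rfl fun a ha => ?_
      rw [← Finset.prod_filter]
      refine Finset.prod_congr ?_ fun _ _ => rfl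
      ext b
      simp [ha, and_comm]
    · intro a _ ha
      simp [ha]
  rw [h2, h3, Matrix.det_vandermonde, Matrix.det_vandermonde, ← Finset.prod_mul_distrib,
    ← Finset.prod_mul_distrib]
  refine Finset.prod_congr rfl fun a _ => ?_
  rw [← Finset.prod_mul_distrib, ← Finset.prod_mul_distrib]
  refine Finset.prod_congr rfl fun b hb => ?_
  have hab : a ≠ b := (Finset.mem_Ioi.1 hb).ne
  have e1 : y a - y b ≠ 0 := sub_ne_zero.2 fun h => hab (hy h)
  have e2 : y b - y a ≠ 0 := sub_ne_zero.2 fun h => hab (hy h).symm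
  have e3 := sub_ne_zero.2 (hxy a b)
  have e4 := sub_ne_zero.2 (hxy b a)
  have e5 : y a - x b ≠ 0 := sub_ne_zero.2 (hxy b a).symm
  by_cases ha : a ∈ S <;> by_cases hb : b ∈ S <;> simp only [ha, hb, Finset.piecewise, if_true,
    if_false, and_self, and_true, and_false, one_mul, mul_one]
  · field_simp
    ring
  · field_simp
    ring
  · field_simp

/-- Exchanging the two families of points in the subset sum. -/
theorem subsetSum_swap {x y f f' : Fin N → K}
    (h : ∀ a, (∏ c ∈ Finset.univ.erase a, (x a - y c)) / (∏ c ∈ Finset.univ.erase a, (y a - y c))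
        * f a = (∏ c ∈ Finset.univ.erase a, (y a - x c))
          / (∏ c ∈ Finset.univ.erase a, (x a - x c)) * f' a) :
    subsetSum x y f = subsetSum y x f' := by
  rw [subsetSum, subsetSum]
  refine Finset.sum_congr rfl fun S _ => ?_
  simp only [h]
  congr 1
  refine Finset.prod_congr rfl fun a _ => Finset.prod_congr rfl fun b _ => ?_
  rw [mul_comm (x a - x b), mul_comm (x a - y b)]

end SubsetSum

-- Factorization over the orbits of the p-th roots of unity

section Fourier

variable {K : Type*} [Field K] {N p : ℕ}

/-- The matrix is a product: a Fourier matrix in each orbit a, times a matrix that is block diagonal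
in the residue r of the exponent. -/
theorem det_fourier (z : K) (m : Fin p → Matrix (Fin N) (Fin N) K) :
    Matrix.det (Matrix.of fun (as qr : Fin N × Fin p) =>
        z ^ (as.2.val * qr.2.val) * m qr.2 as.1 qr.1)
      = Matrix.det (Matrix.of fun (as br : Fin N × Fin p) =>
          if as.1 = br.1 then z ^ (as.2.val * br.2.val) else 0) * ∏ r, (m r).det := by
  rw [← Matrix.det_blockDiagonal, ← Matrix.det_mul]
  congr 1
  ext ⟨a, s⟩ ⟨q, r⟩
  simp [Matrix.mul_apply, Matrix.blockDiagonal_apply, Fintype.sum_prod_type, ite_mul]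

/-- With exponents written r + pq, (u z^s)^{r+pq} = z^{sr} u^r (u^p)^q depends on s through z^{sr}
alone. Both determinants in `ratioDet_mul_det` therefore share the same Fourier factor, which
cancels. The family f has to be constant on orbits. -/
theorem ratioDet_orbits (hp : 0 < p) {z : K} (hz : z ^ p = 1) {x y f : Fin N → K}
    (hy : ∀ a, y a ≠ 0)
    (hinj : Function.Injective fun as : Fin N × Fin p => y as.1 * z ^ as.2.val) :
    (Function.Injective fun a => y a ^ p) ∧
    ratioDet (fun as : Fin N × Fin p => x as.1 * z ^ as.2.val) (fun as => y as.1 * z ^ as.2.val)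
      (fun as => f as.1) = ∏ r : Fin p, ratioDet (fun a => x a ^ p) (fun a => y a ^ p)
        (fun a => f a * (x a / y a) ^ r.val) := by
  have hpow : ∀ (u : K) (s r q : ℕ), (u * z ^ s) ^ (r + p * q) = z ^ (s * r) * (u ^ r * (u ^ p) ^ q)
      := fun u s r q => by
    rw [mul_pow, ← pow_mul, mul_add, pow_add z, show s * (p * q) = p * (s * q) by ring,
      pow_mul z p, hz, one_pow, pow_add, pow_mul]
    ring
  set e : Fin N × Fin p → ℕ := fun qr => qr.2.val + p * qr.1.val with he
  have helt : ∀ k, e k < Fintype.card (Fin N × Fin p) := fun k => by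
    have := (finProdFinEquiv k).2
    rw [Fintype.card_prod, Fintype.card_fin, Fintype.card_fin]
    exact this
  have hmul := ratioDet_mul_det (x := fun as : Fin N × Fin p => x as.1 * z ^ as.2.val)
    (f := fun as => f as.1) hinj e helt
  set C := Matrix.det (Matrix.of fun (as br : Fin N × Fin p) =>
          if as.1 = br.1 then z ^ (as.2.val * br.2.val) else 0) with hC
  have hV : Matrix.det (Matrix.of fun (as k : Fin N × Fin p) => (y as.1 * z ^ as.2.val) ^ e k)
      = C * ∏ r : Fin p, ((∏ a, y a ^ r.val) * (Matrix.vandermonde fun a => y a ^ p).det) := by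
    simp only [← Matrix.det_mul_column]
    rw [hC, ← det_fourier]
    congr 1
    ext ⟨a, s⟩ ⟨q, r⟩
    simp only [Matrix.of_apply, he, hpow, Matrix.vandermonde_apply]
  have hW : Matrix.det (Matrix.of fun (as k : Fin N × Fin p) =>
        (y as.1 * z ^ as.2.val) ^ e k - f as.1 * (x as.1 * z ^ as.2.val) ^ e k)
      = C * ∏ r : Fin p, ((∏ a, y a ^ r.val) * Matrix.det (Matrix.of fun a (q : Fin N) =>
          (y a ^ p) ^ q.val - f a * (x a / y a) ^ r.val * (x a ^ p) ^ q.val)) := by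
    simp only [← Matrix.det_mul_column]
    rw [hC, ← det_fourier]
    congr 1
    ext ⟨a, s⟩ ⟨q, r⟩
    simp only [Matrix.of_apply, he, hpow]
    have h1 : (x a) ^ r.val = y a ^ r.val * (x a / y a) ^ r.val := by
      rw [← mul_pow, mul_div_cancel₀ _ (hy a)]
    rw [h1]
    ring
  -- The exponents r + pq enumerate 0, ..., Np - 1, so this is a Vandermonde determinant at distinct
  -- nodes. Its nonvanishing also gives the Fourier factor nonzero and the p-th powers distinct.
  have hV0 : Matrix.det (Matrix.of fun (as k : Fin N × Fin p) => (y as.1 * z ^ as.2.val) ^ e k)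
      ≠ 0 := by
    let E := (finProdFinEquiv : Fin N × Fin p ≃ Fin (N * p))
    have : (Matrix.of fun (as k : Fin N × Fin p) => (y as.1 * z ^ as.2.val) ^ e k)
        = (Matrix.vandermonde fun t => (y (E.symm t).1 * z ^ (E.symm t).2.val)).submatrix E E := by
      ext as k
      simp only [Matrix.of_apply, Matrix.submatrix_apply, Matrix.vandermonde_apply,
        Equiv.symm_apply_apply]
      rfl
    rw [this, Matrix.det_submatrix_equiv_self, Matrix.det_vandermonde_ne_zero_iff]
    exact hinj.comp E.symm.injective
  have hC0 : C ≠ 0 := fun h => hV0 (by rw [hV, h, zero_mul])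
  have hy0 : ∀ r : Fin p, (∏ a, y a ^ r.val) ≠ 0 := fun r =>
    Finset.prod_ne_zero_iff.2 fun a _ => pow_ne_zero _ (hy a)
  have hvan : (Matrix.vandermonde fun a => y a ^ p).det ≠ 0 := fun h => hV0 (by
    rw [hV, Finset.prod_eq_zero (Finset.mem_univ ⟨0, hp⟩), mul_zero]
    rw [h, mul_zero])
  have hinj' := Matrix.det_vandermonde_ne_zero_iff.1 hvan
  refine ⟨hinj', ?_⟩
  refine mul_right_cancel₀ hV0 ?_
  rw [hmul, hW, hV, mul_left_comm, ← Finset.prod_mul_distrib]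
  congr 1
  refine Finset.prod_congr rfl fun r _ => ?_
  rw [mul_left_comm, ratioDet_mul_det_vandermonde hinj']

end Fourier


/-! ### A valuation that extends the order of power series -/

section Valuation

variable {K : Type*} [Field K] {ℓ : ℕ}

/-- The valuation of the ring is the order on power series. -/
structure ExtendsOrder (φ : Series ℓ →+* K) (O : ValuationSubring K) : Prop where
  le_one : ∀ f, O.valuation (φ f) ≤ 1
  X_eq : ∀ k k', O.valuation (φ (MvPowerSeries.X k)) = O.valuation (φ (MvPowerSeries.X k'))
  X_lt : ∀ k, O.valuation (φ (MvPowerSeries.X k)) < 1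
  lower : ∀ f, f ≠ 0 → ∃ d : ℕ, ∀ k, O.valuation (φ (MvPowerSeries.X k)) ^ d ≤ O.valuation (φ f)

theorem order_ne_top {f : Series ℓ} (hf : f ≠ 0) : f.order ≠ ⊤ := fun h =>
  hf (MvPowerSeries.order_eq_top_iff.1 h)

theorem order_X (k : Fin ℓ) : (MvPowerSeries.X k : Series ℓ).order = 1 := by
  classical
  rw [MvPowerSeries.X, MvPowerSeries.order_monomial]
  simp

theorem order_pow (f : Series ℓ) (d : ℕ) : (f ^ d).order = d * f.order := by
  induction d with
  | zero =>
    rw [pow_zero, ← MvPowerSeries.monomial_zero_one]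
    classical
    rw [MvPowerSeries.order_monomial]
    simp
  | succ d ih =>
    rw [pow_succ, MvPowerSeries.order_mul, ih]
    push_cast
    rw [add_mul, one_mul]

/-- Quotients of power series whose order is nonnegative. -/
def orderSubring (φ : Series ℓ →+* K) : Subring K where
  carrier := {y | ∃ f h : Series ℓ, h ≠ 0 ∧ h.order ≤ f.order ∧ φ h * y = φ f}
  mul_mem' := by
    rintro y y' ⟨f, h, h0, hle, he⟩ ⟨f', h', h0', hle', he'⟩
    refine ⟨f * f', h * h', mul_ne_zero h0 h0', ?_, ?_⟩
    · rw [MvPowerSeries.order_mul, MvPowerSeries.order_mul]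
      exact add_le_add hle hle'
    · rw [map_mul, map_mul, ← he, ← he']
      ring
  one_mem' := ⟨1, 1, one_ne_zero, le_rfl, by simp⟩
  add_mem' := by
    rintro y y' ⟨f, h, h0, hle, he⟩ ⟨f', h', h0', hle', he'⟩
    refine ⟨h' * f + h * f', h * h', mul_ne_zero h0 h0', ?_, ?_⟩
    · refine le_trans (le_min ?_ ?_) MvPowerSeries.min_order_le_add
      · rw [MvPowerSeries.order_mul, MvPowerSeries.order_mul, add_comm]
        exact add_le_add le_rfl hle
      · rw [MvPowerSeries.order_mul, MvPowerSeries.order_mul]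
        exact add_le_add le_rfl hle'
    · rw [map_add, map_mul, map_mul, map_mul, ← he, ← he']
      ring
  zero_mem' := ⟨0, 1, one_ne_zero, by simp, by simp⟩
  neg_mem' := by
    rintro y ⟨f, h, h0, hle, he⟩
    exact ⟨-f, h, h0, by rwa [MvPowerSeries.order_neg], by rw [map_neg, ← he]; ring⟩

/-- Quotients of power series whose order is positive. -/
def orderIdeal (φ : Series ℓ →+* K) : Ideal (orderSubring φ) where
  carrier := {y | ∃ f h : Series ℓ, h ≠ 0 ∧ h.order < f.order ∧ φ h * y = φ f}
  add_mem' := by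
    rintro y y' ⟨f, h, h0, hle, he⟩ ⟨f', h', h0', hle', he'⟩
    refine ⟨h' * f + h * f', h * h', mul_ne_zero h0 h0', ?_, ?_⟩
    · refine lt_of_lt_of_le (lt_min ?_ ?_) MvPowerSeries.min_order_le_add
      · rw [MvPowerSeries.order_mul, MvPowerSeries.order_mul, add_comm]
        exact (ENat.add_lt_add_iff_left (order_ne_top h0')).2 hle
      · rw [MvPowerSeries.order_mul, MvPowerSeries.order_mul]
        exact (ENat.add_lt_add_iff_left (order_ne_top h0)).2 hle'
    · rw [map_add, map_mul, map_mul, map_mul, ← he, ← he']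
      push_cast
      ring
  zero_mem' := ⟨0, 1, one_ne_zero, by
    rw [MvPowerSeries.order_zero]; exact (order_ne_top one_ne_zero).lt_top, by simp⟩
  smul_mem' := by
    rintro y y' ⟨f', h', h0', hle', he'⟩
    obtain ⟨f, h, h0, hle, he⟩ := y.2
    refine ⟨f * f', h * h', mul_ne_zero h0 h0', ?_, ?_⟩
    · rw [MvPowerSeries.order_mul, MvPowerSeries.order_mul]
      exact lt_of_lt_of_le ((ENat.add_lt_add_iff_left (order_ne_top h0)).2 hle')
        (add_le_add hle le_rfl)
    · rw [map_mul, map_mul, ← he, ← he', smul_eq_mul]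
      push_cast
      ring

/-- The quotients of positive order form a proper ideal of the ring of quotients of nonnegative
order, because φ is injective. Some valuation ring of K contains this ring and has the ideal among
its nonunits. Comparing two series then amounts to placing their quotient. -/
theorem exists_extendsOrder (φ : Series ℓ →+* K) (hφ : Function.Injective φ) :
    ∃ O : ValuationSubring K, ExtendsOrder φ O := by
  have hI : orderIdeal φ ≠ ⊤ := by
    rw [Ideal.ne_top_iff_one]
    rintro ⟨f, h, h0, hlt, he⟩
    have : h = f := hφ (by simpa using he)
    rw [this] at hlt
    exact lt_irrefl _ hlt
  obtain ⟨O, hO, hO'⟩ := Ideal.image_subset_nonunits_valuationSubring _ hI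
  have hle : ∀ (f h : Series ℓ), h ≠ 0 → h.order ≤ f.order →
      O.valuation (φ f) ≤ O.valuation (φ h) := by
    intro f h h0 hle
    have h1 : φ h ≠ 0 := fun h => h0 (hφ (by rw [h, map_zero]))
    have : φ f / φ h ∈ O := hO ⟨f, h, h0, hle, by field_simp⟩
    rw [← O.valuation_le_one_iff, map_div₀] at this
    rwa [div_le_one₀ ((O.valuation).pos_iff.2 h1)] at this
  have hlt : ∀ (f h : Series ℓ), h ≠ 0 → h.order < f.order →
      O.valuation (φ f) < O.valuation (φ h) := by
    intro f h h0 hlt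
    have h1 : φ h ≠ 0 := fun h => h0 (hφ (by rw [h, map_zero]))
    have : φ f / φ h ∈ O.nonunits :=
      hO' ⟨⟨φ f / φ h, ⟨f, h, h0, hlt.le, by field_simp⟩⟩, ⟨f, h, h0, hlt, by field_simp⟩, rfl⟩
    rw [ValuationSubring.mem_nonunits_iff, map_div₀] at this
    rwa [div_lt_one₀ ((O.valuation).pos_iff.2 h1)] at this
  have h1 : (1 : Series ℓ).order = 0 := by
    have := order_pow (1 : Series ℓ) 0
    simpa using this
  have hX : ∀ k : Fin ℓ, (MvPowerSeries.X k : Series ℓ) ≠ 0 := fun k h => by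
    have := order_X k
    rw [h, MvPowerSeries.order_zero] at this
    exact ENat.top_ne_one this
  refine ⟨O, ⟨fun f => ?_, fun k k' => ?_, fun k => ?_, fun f hf => ?_⟩⟩
  · have := hle f 1 one_ne_zero (by rw [h1]; exact zero_le)
    simpa using this
  · exact le_antisymm (hle _ _ (hX _) (by rw [order_X, order_X]))
      (hle _ _ (hX _) (by rw [order_X, order_X]))
  · have := hlt (MvPowerSeries.X k) 1 one_ne_zero (by rw [h1, order_X]; exact zero_lt_one)
    simpa using this
  · obtain ⟨d, hd⟩ := ENat.ne_top_iff_exists.1 (order_ne_top hf)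
    refine ⟨d, fun k => ?_⟩
    rw [← map_pow, ← map_pow]
    refine hle _ _ hf ?_
    rw [order_pow, order_X, mul_one, hd]

end Valuation

-- Vandermonde determinants up to units of a local ring

section UnitDet

variable {O : Type*} [CommRing O] [IsLocalRing O] {N : ℕ}

/-- Evaluating polynomials `T ^ k + ⋯` at points of the maximal ideal gives the Vandermonde
determinant, up to a unit. -/
theorem exists_unit_det_eval (P : Fin N → Polynomial O) (x : Fin N → O)
    (hx : ∀ a, IsLocalRing.residue O (x a) = 0)
    (hP : ∀ k : Fin N, (Polynomial.X : Polynomial O) ^ (k.val + 1) ∣ P k - Polynomial.X ^ k.val) :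
    ∃ u : O, IsUnit u ∧ Matrix.det (Matrix.of fun a k => (P k).eval (x a))
      = u * (Matrix.vandermonde x).det := by
  set M : Polynomial O := ∏ a, (Polynomial.X - Polynomial.C (x a)) with hM
  have hMm : M.Monic := Polynomial.monic_prod_X_sub_C _ _
  have hMd : M.natDegree = N := by
    rw [hM, Polynomial.natDegree_finsetProd_X_sub_C_eq_card, Finset.card_univ, Fintype.card_fin]
  -- Values at the x_a depend only on remainders modulo M, so the matrix of values is the
  -- Vandermonde matrix times this coefficient matrix.
  set c : Matrix (Fin N) (Fin N) O := Matrix.of fun j k => (P k %ₘ M).coeff j.val with hc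
  have hmul : (Matrix.of fun a k => (P k).eval (x a)) = Matrix.vandermonde x * c := by
    ext a k
    rw [Matrix.mul_apply, Matrix.of_apply]
    have hroot : M.IsRoot (x a) := by
      rw [hM, Polynomial.IsRoot.def, Polynomial.eval_prod]
      exact Finset.prod_eq_zero (Finset.mem_univ a) (by simp)
    have h1 : (P k).eval (x a) = (P k %ₘ M).eval (x a) := by
      conv_lhs => rw [← Polynomial.modByMonic_add_div (P k) M]
      simp [hroot.eq_zero]
    have h2 : (P k %ₘ M).natDegree < N ∨ N = 0 := by
      rcases Nat.eq_zero_or_pos N with h | h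
      · exact .inr h
      · left
        rw [← hMd]
        exact Polynomial.natDegree_modByMonic_lt _ hMm (fun h1 => by
          rw [h1, Polynomial.natDegree_one] at hMd; omega)
    rcases h2 with h2 | h2
    · rw [h1, Polynomial.eval_eq_sum_range' h2, Finset.sum_range]
      exact Finset.sum_congr rfl fun j _ => mul_comm _ _
    · subst h2; exact a.elim0
  refine ⟨c.det, ?_, by rw [hmul, Matrix.det_mul, mul_comm]⟩
  rw [← isUnit_map_iff (IsLocalRing.residue O), RingHom.map_det]
  -- Over the residue field, remainders modulo M become truncations at T^N, and the shape T^k + ⋯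
  -- makes c unipotent lower triangular.
  have hmapM : M.map (IsLocalRing.residue O) = Polynomial.X ^ N := by
    rw [hM, Polynomial.map_prod]
    simp [hx]
  have hcoeff : ∀ j k : Fin N, j ≤ k → (IsLocalRing.residue O) (c j k) = if j = k then 1 else 0 := by
    intro j k hjk
    rw [hc, Matrix.of_apply, ← Polynomial.coeff_map, Polynomial.map_modByMonic _ hMm, hmapM]
    have hmod := congrArg (fun q => Polynomial.coeff q j.val)
      (Polynomial.modByMonic_add_div ((P k).map (IsLocalRing.residue O)) (Polynomial.X ^ N))
    simp only [Polynomial.coeff_add, Polynomial.coeff_X_pow_mul', not_le.2 j.2, if_false,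
      add_zero] at hmod
    rw [hmod]
    obtain ⟨q, hq⟩ := hP k
    rw [sub_eq_iff_eq_add] at hq
    rw [hq, Polynomial.map_add, Polynomial.map_mul, Polynomial.map_pow, Polynomial.map_X,
      Polynomial.map_pow, Polynomial.map_X, Polynomial.coeff_add, Polynomial.coeff_X_pow_mul',
      if_neg (by have : j.val ≤ k.val := hjk; omega), zero_add, Polynomial.coeff_X_pow]
    simp only [Fin.ext_iff]
  rw [Matrix.det_of_isLowerTriangular]
  · refine isUnit_iff_ne_zero.2 (Finset.prod_ne_zero_iff.2 fun k _ => ?_)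
    rw [RingHom.mapMatrix_apply, Matrix.map_apply, hcoeff k k le_rfl, if_pos rfl]
    exact one_ne_zero
  · intro j k hjk
    have hjk' : j < k := by simpa using hjk
    rw [RingHom.mapMatrix_apply, Matrix.map_apply, hcoeff j k hjk'.le, if_neg hjk'.ne]

end UnitDet


/-! ### The characteristic polynomial -/

section CharPoly

variable {K : Type*} [Field K] {p ℓ : ℕ}

/-- Coefficients of the characteristic equation. -/
def beta (p : ℕ) {ℓ : ℕ} (g : Fin ℓ → K) (R : K) (j : ℕ) : K := R⁻¹ ^ j * alphaCoeff p g R j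

/-- The characteristic polynomial divided by `x ^ N_0`. -/
def charFun (p : ℕ) {ℓ : ℕ} (g : Fin ℓ → K) (R x : K) : K :=
  1 - ∑ j ∈ Finset.Icc 1 ℓ, beta p g R j * xi p x ^ j * ∑ n ∈ Finset.Icc 1 (p * j - 1), x⁻¹ ^ n

theorem xi_eq (hp : 1 ≤ p) (x : K) : xi p x = x * ∑ k ∈ Finset.range (p - 1), x ^ k := by
  obtain ⟨q, rfl⟩ : ∃ q, p = q + 1 := ⟨p - 1, by omega⟩
  rw [xi, Nat.add_sub_cancel]
  clear hp
  induction q with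
  | zero => simp
  | succ q ih => rw [Finset.sum_Icc_succ_top (by omega), ih, Finset.sum_range_succ, mul_add, pow_succ']

theorem sub_one_mul_xi (hp : 1 ≤ p) (x : K) : (x - 1) * xi p x = x ^ p - x := by
  rw [xi_eq hp, mul_left_comm, mul_geom_sum, mul_sub, ← pow_succ', Nat.sub_add_cancel hp, mul_one]

theorem chi_eq_xi_inv (x : K) : chi p x = xi p x⁻¹ := rfl

theorem pow_mul_chi (hp : 1 ≤ p) {x : K} (hx : x ≠ 0) : x ^ p * chi p x = xi p x := by
  by_cases h : x = 1
  · rw [chi_eq_xi_inv, h]; simp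
  have h1 := sub_one_mul_xi hp x
  have h2 := sub_one_mul_xi hp x⁻¹
  have h3 : x⁻¹ ^ p * x ^ p = 1 := by rw [← mul_pow, inv_mul_cancel₀ hx, one_pow]
  refine mul_left_cancel₀ (sub_ne_zero.2 h) ?_
  rw [h1, chi_eq_xi_inv]
  have h4 : (x - 1) = -x * (x⁻¹ - 1) := by field_simp; ring
  rw [h4]
  have h5 : x * x⁻¹ = 1 := mul_inv_cancel₀ hx
  linear_combination (-x * x ^ p) * h2 - x * h3 + x ^ p * h5

theorem sub_one_mul_eta {x : K} (hx : x ≠ 0) (m : ℕ) :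
    (x - 1) * ∑ n ∈ Finset.Icc 1 m, x⁻¹ ^ n = 1 - x⁻¹ ^ m := by
  induction m with
  | zero => simp
  | succ m ih =>
    rw [Finset.sum_Icc_succ_top (by omega), mul_add, ih]
    have h5 : x * x⁻¹ = 1 := mul_inv_cancel₀ hx
    rw [pow_succ]
    linear_combination (x⁻¹ ^ m) * h5

theorem pow_mul_eta {x : K} (hx : x ≠ 0) (m : ℕ) :
    x ^ (m + 1) * ∑ n ∈ Finset.Icc 1 m, x⁻¹ ^ n = ∑ n ∈ Finset.Icc 1 m, x ^ n := by
  by_cases h : x = 1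
  · subst h; simp
  refine mul_left_cancel₀ (sub_ne_zero.2 h) ?_
  have h1 := sub_one_mul_eta hx m
  have h2 := sub_one_mul_eta (inv_ne_zero hx) m
  rw [inv_inv] at h2
  have h4 : x * (x⁻¹ - 1) = -(x - 1) := by field_simp; ring
  have h3 : x⁻¹ ^ m * x ^ m = 1 := by rw [← mul_pow, inv_mul_cancel₀ hx, one_pow]
  rw [pow_succ]
  linear_combination (x ^ m * x) * h1 - x * h3 + x * h2 - (∑ n ∈ Finset.Icc 1 m, x ^ n) * h4

/-- For x ↦ 1/x, ξ(x)^j acquires x^{-pj}, while the sum of x^{-n} over 1 ≤ n ≤ pj - 1 acquires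
x^{pj}. The two factors cancel. -/
theorem charFun_inv (hp : 2 ≤ p) (g : Fin ℓ → K) (R : K) {x : K} (hx : x ≠ 0) :
    charFun p g R x⁻¹ = charFun p g R x := by
  rw [charFun, charFun]
  congr 1
  refine Finset.sum_congr rfl fun j hj => ?_
  have hj1 := (Finset.mem_Icc.1 hj).1
  rw [inv_inv, ← pow_mul_eta hx, ← pow_mul_chi (by omega) hx, chi_eq_xi_inv, mul_pow, ← pow_mul,
    Nat.sub_add_cancel (Nat.mul_pos (by omega) hj1)]
  ring

theorem orbitCount_add_one (hp : 2 ≤ p) (hℓ : 1 ≤ ℓ) : orbitCount p ℓ + 1 = (p - 1) * ℓ := by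
  have h1 : ℓ * 2 ≤ ℓ * p := Nat.mul_le_mul_left _ hp
  rw [orbitCount, Nat.sub_mul, one_mul]
  rw [mul_comm p]
  omega

/-- Guarantees that the subtraction in the exponent N_0 + j - n is never truncated, and locates its
only zero, which produces the constant term of the sum. -/
theorem le_orbitCount_add (hp : 2 ≤ p) (hℓ : 1 ≤ ℓ) {j n : ℕ} (hj : j ∈ Finset.Icc 1 ℓ)
    (hn : n ∈ Finset.Icc 1 (p * j - 1)) :
    n ≤ orbitCount p ℓ + j ∧ (n = orbitCount p ℓ + j ↔ j = ℓ ∧ n = p * ℓ - 1) := by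
  rw [Finset.mem_Icc] at hj hn
  have h1 := orbitCount_add_one hp hℓ
  obtain ⟨q, rfl⟩ : ∃ q, p = q + 1 := ⟨p - 1, by omega⟩
  rw [Nat.add_sub_cancel] at h1
  have h2 : q * j ≤ q * ℓ := Nat.mul_le_mul_left _ hj.2
  have h3 : (q + 1) * j = q * j + j := by ring
  have h4 : (q + 1) * ℓ = q * ℓ + ℓ := by ring
  refine ⟨by omega, ⟨fun h => ?_, ?_⟩⟩
  · have h5 : q * ℓ ≤ q * j := by omega
    have : ℓ ≤ j := le_of_mul_le_mul_left h5 (by omega)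
    omega
  · rintro ⟨rfl, rfl⟩
    omega

/-- Stated over a semiring because 0 is substituted both in K and, for the reduction of the rescaled
polynomial, in polynomials over the residue field. -/
theorem sum_zero_pow {A : Type*} [CommSemiring A] (hp : 2 ≤ p) (hℓ : 1 ≤ ℓ) (c : ℕ → A) :
    ∑ j ∈ Finset.Icc 1 ℓ, c j * (∑ k ∈ Finset.range (p - 1), (0 : A) ^ k) ^ j *
      ∑ n ∈ Finset.Icc 1 (p * j - 1), (0 : A) ^ (orbitCount p ℓ + j - n) = c ℓ := by
  have h1 : ∑ k ∈ Finset.range (p - 1), (0 : A) ^ k = 1 := by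
    rw [Finset.sum_eq_single_of_mem 0 (Finset.mem_range.2 (by omega))]
    · exact pow_zero _
    · intro k _ hk
      exact zero_pow hk
  have hℓm : ℓ ∈ Finset.Icc 1 ℓ := Finset.mem_Icc.2 ⟨hℓ, le_rfl⟩
  have hpℓ : ℓ * 2 ≤ p * ℓ := by rw [mul_comm p]; exact Nat.mul_le_mul_left _ hp
  have hm : p * ℓ - 1 ∈ Finset.Icc 1 (p * ℓ - 1) := Finset.mem_Icc.2 ⟨by omega, le_rfl⟩
  rw [Finset.sum_eq_single_of_mem ℓ hℓm]
  · rw [h1, one_pow, mul_one, Finset.sum_eq_single_of_mem _ hm]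
    · rw [← ((le_orbitCount_add hp hℓ hℓm hm).2.2 ⟨rfl, rfl⟩), Nat.sub_self, pow_zero, mul_one]
    · intro n hn hne
      have h := le_orbitCount_add hp hℓ hℓm hn
      refine zero_pow fun h0 => hne (h.2.1 (by omega)).2
  · intro j hj hne
    have hz : ∑ n ∈ Finset.Icc 1 (p * j - 1), (0 : A) ^ (orbitCount p ℓ + j - n) = 0 := by
      refine Finset.sum_eq_zero fun n hn => ?_
      have h := le_orbitCount_add hp hℓ hj hn
      exact zero_pow fun h0 => hne (h.2.1 (by omega)).1
    rw [hz, mul_zero]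

theorem eval_charPoly (g : Fin ℓ → K) (R x : K) : (charPoly p g R).eval x
    = x ^ orbitCount p ℓ - ∑ j ∈ Finset.Icc 1 ℓ, beta p g R j *
      (∑ k ∈ Finset.range (p - 1), x ^ k) ^ j *
        ∑ n ∈ Finset.Icc 1 (p * j - 1), x ^ (orbitCount p ℓ + j - n) := by
  simp [charPoly, beta, Polynomial.eval_finsetSum]

theorem eval_charPoly_zero (hp : 2 ≤ p) (hℓ : 1 ≤ ℓ) (g : Fin ℓ → K) (R : K) :
    (charPoly p g R).eval 0 = 0 ^ orbitCount p ℓ - beta p g R ℓ := by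
  rw [eval_charPoly, sum_zero_pow hp hℓ]

theorem eval_charPoly_eq (hp : 2 ≤ p) (hℓ : 1 ≤ ℓ) (g : Fin ℓ → K) (R : K) {x : K} (hx : x ≠ 0) :
    (charPoly p g R).eval x = x ^ orbitCount p ℓ * charFun p g R x := by
  rw [eval_charPoly, charFun, mul_sub, mul_one, Finset.mul_sum]
  congr 1
  refine Finset.sum_congr rfl fun j hj => ?_
  rw [xi_eq (by omega), mul_pow, Finset.mul_sum, Finset.mul_sum, Finset.mul_sum]
  refine Finset.sum_congr rfl fun n hn => ?_
  have h := (le_orbitCount_add hp hℓ hj hn).1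
  have h1 : x ^ (orbitCount p ℓ + j - n) = x ^ orbitCount p ℓ * x ^ j * x⁻¹ ^ n := by
    rw [← pow_add, inv_pow, eq_mul_inv_iff_mul_eq₀ (pow_ne_zero _ hx), ← pow_add,
      Nat.sub_add_cancel h]
  rw [h1]
  ring

theorem natDegree_charPoly_le (hp : 2 ≤ p) (hℓ : 1 ≤ ℓ) (g : Fin ℓ → K) (R : K) :
    (charPoly p g R).natDegree ≤ 2 * orbitCount p ℓ := by
  have hN := orbitCount_add_one hp hℓ
  rw [charPoly]
  refine (Polynomial.natDegree_sub_le _ _).trans (max_le ?_ ?_)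
  · rw [Polynomial.natDegree_X_pow]; omega
  refine Polynomial.natDegree_sum_le_of_forall_le _ _ fun j hj => ?_
  have hj' := Finset.mem_Icc.1 hj
  obtain ⟨q, rfl⟩ : ∃ q, p = q + 2 := ⟨p - 2, by omega⟩
  rw [show q + 2 - 1 = q + 1 by omega] at hN ⊢
  have h2 : (q + 1) * j ≤ (q + 1) * ℓ := Nat.mul_le_mul_left _ hj'.2
  have h3 : (q + 1) * j = j * q + j := by ring
  have h4 : (∑ k ∈ Finset.range (q + 1), (Polynomial.X : Polynomial K) ^ k).natDegree ≤ q := by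
    refine Polynomial.natDegree_sum_le_of_forall_le _ _ fun k hk => ?_
    rw [Polynomial.natDegree_X_pow]
    have := Finset.mem_range.1 hk
    omega
  have h5 : (∑ n ∈ Finset.Icc 1 ((q + 2) * j - 1),
      (Polynomial.X : Polynomial K) ^ (orbitCount (q + 2) ℓ + j - n)).natDegree
      ≤ orbitCount (q + 2) ℓ + j - 1 := by
    refine Polynomial.natDegree_sum_le_of_forall_le _ _ fun k hk => ?_
    rw [Polynomial.natDegree_X_pow]
    have := Finset.mem_Icc.1 hk
    omega
  refine (Polynomial.natDegree_mul_le).trans ((add_le_add ((Polynomial.natDegree_C_mul_le _ _).trans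
    (Polynomial.natDegree_pow_le_of_le j h4)) h5).trans ?_)
  omega

/-- The polynomial is x^{N_0} times a function invariant under x ↦ 1/x. Equality is tested at the
infinitely many nonzero points. -/
theorem reflect_charPoly [Infinite K] (hp : 2 ≤ p) (hℓ : 1 ≤ ℓ) (g : Fin ℓ → K) (R : K) :
    (charPoly p g R).reflect (2 * orbitCount p ℓ) = charPoly p g R := by
  refine Polynomial.eq_of_infinite_eval_eq _ _
    (Set.Infinite.mono (s := {x : K | x ≠ 0}) (fun x hx => ?_) ?_)
  · have hx : x ≠ 0 := hx
    let _ := invertibleOfNonzero (inv_ne_zero hx)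
    have h := Polynomial.eval₂_reflect_mul_pow (RingHom.id K) x⁻¹ (2 * orbitCount p ℓ)
      (charPoly p g R) (natDegree_charPoly_le hp hℓ g R)
    rw [invOf_eq_inv, inv_inv, ← Polynomial.eval, ← Polynomial.eval,
      eval_charPoly_eq hp hℓ _ _ (inv_ne_zero hx), charFun_inv hp g R hx] at h
    change Polynomial.eval _ _ = Polynomial.eval _ _
    rw [eval_charPoly_eq hp hℓ _ _ hx]
    have hpow : x⁻¹ ^ orbitCount p ℓ * x ^ orbitCount p ℓ = 1 := by
      rw [← mul_pow, inv_mul_cancel₀ hx, one_pow]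
    have h0 : x⁻¹ ^ (2 * orbitCount p ℓ) ≠ 0 := pow_ne_zero _ (inv_ne_zero hx)
    refine mul_right_cancel₀ h0 ?_
    rw [h, two_mul, pow_add]
    linear_combination -(x⁻¹ ^ orbitCount p ℓ * charFun p g R x) * hpow
  · exact (Set.finite_singleton (0 : K)).infinite_compl

theorem natDegree_charPoly [Infinite K] (hp : 2 ≤ p) (hℓ : 1 ≤ ℓ) (g : Fin ℓ → K) (R : K)
    (h : (charPoly p g R).eval 0 ≠ 0) : (charPoly p g R).natDegree = 2 * orbitCount p ℓ := by
  refine le_antisymm (natDegree_charPoly_le hp hℓ g R) (Polynomial.le_natDegree_of_ne_zero ?_)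
  have h1 := congrArg (fun q => Polynomial.coeff q 0) (reflect_charPoly hp hℓ g R)
  simp only [Polynomial.coeff_reflect, Polynomial.revAt_le (Nat.zero_le _), Nat.sub_zero] at h1
  rwa [h1, Polynomial.coeff_zero_eq_eval_zero]

theorem sq_dvd_charPoly_inv [Infinite K] (hp : 2 ≤ p) (hℓ : 1 ≤ ℓ) (g : Fin ℓ → K) (R : K)
    (h : (charPoly p g R).eval 0 ≠ 0) {x : K} (hx : x ≠ 0)
    (hd : (Polynomial.X - Polynomial.C x) ^ 2 ∣ charPoly p g R) :
    (Polynomial.X - Polynomial.C x⁻¹) ^ 2 ∣ charPoly p g R := by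
  have hrev : (charPoly p g R).reverse = charPoly p g R := by
    rw [Polynomial.reverse, natDegree_charPoly hp hℓ g R h, reflect_charPoly hp hℓ g R]
  obtain ⟨q, hq⟩ := hd
  have h2 : (Polynomial.X - Polynomial.C x).reverse
      = Polynomial.C (-x) * (Polynomial.X - Polynomial.C x⁻¹) := by
    rw [Polynomial.reverse, Polynomial.natDegree_X_sub_C, Polynomial.reflect_sub,
      Polynomial.reflect_C, mul_sub, ← Polynomial.C_mul, neg_mul, mul_inv_cancel₀ hx]
    have h3 : Polynomial.reflect 1 (Polynomial.X : Polynomial K) = 1 := by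
      simp
    rw [h3]
    simp only [pow_one, Polynomial.C_neg, Polynomial.C_1]
    ring
  have h1 : charPoly p g R = (Polynomial.X - Polynomial.C x).reverse ^ 2 * q.reverse := by
    rw [← hrev, hq, pow_two, Polynomial.reverse_mul_of_domain, Polynomial.reverse_mul_of_domain,
      ← pow_two]
  rw [h1, h2, mul_pow, mul_comm (_ ^ 2), mul_assoc]
  exact dvd_mul_right _ _

end CharPoly


/-! ### Roots of the characteristic polynomial in a valued field -/

section Roots

variable {K : Type*} [Field K] {p ℓ : ℕ}

/-- The valuation of the coefficients of the characteristic equation is less than one, and largest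
for the last coefficient; the residue characteristic is zero. -/
structure IsSmall (O : ValuationSubring K) (p : ℕ) {ℓ : ℕ} (g : Fin ℓ → K) (R : K) : Prop where
  beta_ne : beta p g R ℓ ≠ 0
  beta_lt : O.valuation (beta p g R ℓ) < 1
  beta_le : ∀ j ∈ Finset.Icc 1 ℓ, O.valuation (beta p g R j) ≤ O.valuation (beta p g R ℓ)
  natCast : ∀ n : ℕ, n ≠ 0 → O.valuation (n : K) = 1

theorem valuation_sum_le {O : ValuationSubring K} {ι : Type*} (s : Finset ι) (f : ι → K)
    (h : ∀ i ∈ s, O.valuation (f i) ≤ 1) : O.valuation (∑ i ∈ s, f i) ≤ 1 :=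
  O.valuation.map_sum_le h

/-- R is invertible, so |R| = 1. Every `alphaCoeff` is a combination of the g_m with integral
coefficients. The last one is exactly g_ℓ R^{pℓ-1}, since a path of length pℓ - 1 ending at 1 - pℓ
only descends. Nonzero integers are invertible because the coefficients are rational. -/
theorem ExtendsOrder.isSmall {φ : Series ℓ →+* K} {O : ValuationSubring K} (h : ExtendsOrder φ O)
    (hφ : Function.Injective φ) (hp : 2 ≤ p) (hℓ : 1 ≤ ℓ) :
    O.valuation (φ (limitSeries p ℓ)) = 1 ∧
      IsSmall O p (fun m => φ (MvPowerSeries.X m)) (φ (limitSeries p ℓ)) := by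
  set R := limitSeries p ℓ with hR
  have hunit : ∀ f f' : Series ℓ, f * f' = 1 → O.valuation (φ f) = 1 := by
    intro f f' hff
    have h1 : O.valuation (φ f) * O.valuation (φ f') = 1 := by
      rw [← map_mul, ← map_mul, hff, map_one, map_one]
    refine le_antisymm (h.le_one _) ?_
    rw [← h1]
    exact mul_le_of_le_one_right' (h.le_one _)
  have hv : O.valuation (φ R) = 1 := hunit _ _ (limitSeries_mul (by omega))
  set k0 : Fin ℓ := ⟨ℓ - 1, by omega⟩ with hk0
  have hX0 : φ (MvPowerSeries.X k0) ≠ 0 := by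
    intro h0
    have := hφ (h0.trans (map_zero φ).symm)
    have h1 := order_X k0
    rw [this, MvPowerSeries.order_zero] at h1
    exact absurd h1 (by decide)
  have hβ : ∀ j, O.valuation (beta p (fun m => φ (MvPowerSeries.X m)) (φ R) j)
      = O.valuation (φ (alphaCoeff p MvPowerSeries.X R j)) := by
    intro j
    rw [beta, map_mul, map_pow, map_inv₀, hv, inv_one, one_pow, one_mul, map_alphaCoeff]
  have hαle : ∀ j, O.valuation (φ (alphaCoeff p MvPowerSeries.X R j))
      ≤ O.valuation (φ (MvPowerSeries.X k0)) := by
    intro j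
    rw [alphaCoeff, map_sum]
    refine O.valuation.map_sum_le fun m _ => ?_
    rw [map_mul, map_mul, h.X_eq m k0]
    exact mul_le_of_le_one_right' (h.le_one _)
  have hαℓ : O.valuation (φ (alphaCoeff p MvPowerSeries.X R ℓ))
      = O.valuation (φ (MvPowerSeries.X k0)) := by
    have h1 : (Finset.univ.filter fun m : Fin ℓ => ℓ ≤ m.val + 1) = {k0} := by
      ext m
      simp only [Finset.mem_filter, Finset.mem_univ, true_and, Finset.mem_singleton, hk0,
        Fin.ext_iff]
      omega
    rw [alphaCoeff, h1, Finset.sum_singleton]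
    have h2 : pathSeries p R (p * (k0.val + 1) - 1) (1 - (p : ℤ) * ℓ)
        = R ^ (p * (k0.val + 1) - 1) := by
      have h3 : k0.val + 1 = ℓ := by simp only [hk0]; omega
      rw [h3]
      have h4 : 1 ≤ p * ℓ := Nat.mul_pos (by omega) hℓ
      have h5 : (1 : ℤ) - (p : ℤ) * ℓ = -((p * ℓ - 1 : ℕ) : ℤ) := by
        push_cast [Nat.cast_sub h4]; ring
      rw [h5]
      exact pathSeries_bottom (by omega) R _
    rw [h2, map_mul, map_mul, map_pow, map_pow, hv, one_pow, mul_one]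
  refine ⟨hv, ⟨?_, ?_, ?_, ?_⟩⟩
  · rw [← O.valuation.ne_zero_iff, hβ, hαℓ, O.valuation.ne_zero_iff]
    exact hX0
  · rw [hβ, hαℓ]; exact h.X_lt _
  · intro j _
    rw [hβ, hβ, hαℓ]; exact hαle _
  · intro n hn
    have h1 : ((n : ℕ) : Series ℓ) * MvPowerSeries.C ((n : ℚ)⁻¹) = 1 := by
      rw [← map_natCast (MvPowerSeries.C (σ := Fin ℓ) (R := ℚ)) n, ← map_mul,
        mul_inv_cancel₀ (Nat.cast_ne_zero.2 hn), map_one]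
    have := hunit _ _ h1
    rwa [map_natCast] at this

theorem valuation_geom_sum {O : ValuationSubring K} {x : K} (hx : O.valuation x < 1) {m : ℕ}
    (hm : 1 ≤ m) : O.valuation (∑ k ∈ Finset.range m, x ^ k) = 1 := by
  obtain ⟨m, rfl⟩ : ∃ q, m = q + 1 := ⟨m - 1, by omega⟩
  rw [Finset.sum_range_succ', pow_zero]
  have h1 : O.valuation (∑ k ∈ Finset.range m, x ^ (k + 1)) < 1 := by
    refine O.valuation.map_sum_lt one_ne_zero fun k _ => ?_
    rw [map_pow]
    exact pow_lt_one₀ zero_le hx (by omega)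
  rw [add_comm, Valuation.map_add_eq_of_lt_left]
  · exact map_one _
  · rwa [map_one]

theorem valuation_xi {O : ValuationSubring K} (hp : 2 ≤ p) {x : K} (hx : O.valuation x < 1) :
    O.valuation (xi p x) = O.valuation x := by
  rw [xi_eq (by omega), map_mul, valuation_geom_sum hx (by omega), mul_one]

/-- The product x^{p-1} ξ(1/x) = 1 + ⋯ + x^{p-2} is a unit. -/
theorem one_lt_valuation_xi_inv {O : ValuationSubring K} (hp : 2 ≤ p) {x : K} (hx0 : x ≠ 0)
    (hx : O.valuation x < 1) : 1 < O.valuation (xi p x⁻¹) := by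
  have h := pow_mul_chi (p := p) (by omega) hx0
  rw [xi_eq (by omega), ← Nat.sub_add_cancel (show 1 ≤ p by omega), pow_succ', mul_assoc,
    Nat.sub_add_cancel (show 1 ≤ p by omega)] at h
  have h1 := congrArg O.valuation (mul_left_cancel₀ hx0 h)
  rw [map_mul, valuation_geom_sum hx (by omega), map_pow, chi_eq_xi_inv] at h1
  have h2 : O.valuation x ^ (p - 1) < 1 := pow_lt_one₀ zero_le hx (by omega)
  by_contra h3
  exact absurd h1 (mul_lt_one_of_nonneg_of_lt_one_left zero_le h2 (not_lt.1 h3)).ne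

variable {O : ValuationSubring K} {g : Fin ℓ → K} {R : K}

/-- For |x| ≤ 1 every term on the right of the characteristic equation is bounded by |β_ℓ|. -/
theorem IsSmall.pow_le (h : IsSmall O p g R) {x : K} (hx : (charPoly p g R).eval x = 0)
    (hx1 : O.valuation x ≤ 1) :
    O.valuation x ^ orbitCount p ℓ ≤ O.valuation (beta p g R ℓ) := by
  rw [eval_charPoly, sub_eq_zero] at hx
  rw [← map_pow, hx]
  refine O.valuation.map_sum_le fun j hj => ?_
  have hpow : ∀ n : ℕ, O.valuation (x ^ n) ≤ 1 := fun n => by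
    rw [map_pow]; exact pow_le_one₀ zero_le hx1
  rw [map_mul, map_mul, map_pow]
  refine mul_le_of_le_of_le_one (mul_le_of_le_of_le_one (h.beta_le j hj) ?_) ?_
  · exact pow_le_one₀ zero_le (valuation_sum_le _ _ fun k _ => hpow k)
  · exact valuation_sum_le _ _ fun k _ => hpow _

theorem IsSmall.eval_zero_ne (h : IsSmall O p g R) (hp : 2 ≤ p) (hℓ : 1 ≤ ℓ) :
    (charPoly p g R).eval 0 ≠ 0 := by
  intro h0
  by_cases hN : orbitCount p ℓ = 0
  · have := h.pow_le h0 (by simp)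
    rw [hN, pow_zero] at this
    exact absurd h.beta_lt this.not_gt
  · rw [eval_charPoly_zero hp hℓ, zero_pow hN, zero_sub, neg_eq_zero] at h0
    exact h.beta_ne h0

theorem IsSmall.charPoly_ne_zero (h : IsSmall O p g R) (hp : 2 ≤ p) (hℓ : 1 ≤ ℓ) :
    charPoly p g R ≠ 0 := fun h0 => h.eval_zero_ne hp hℓ (by rw [h0, Polynomial.eval_zero])

theorem IsSmall.ne_zero_of_root (h : IsSmall O p g R) (hp : 2 ≤ p) (hℓ : 1 ≤ ℓ) {x : K}
    (hx : (charPoly p g R).eval x = 0) : x ≠ 0 := fun h0 => h.eval_zero_ne hp hℓ (h0 ▸ hx)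

theorem eval_charPoly_inv (hp : 2 ≤ p) (hℓ : 1 ≤ ℓ) {x : K} (hx0 : x ≠ 0)
    (hx : (charPoly p g R).eval x = 0) : (charPoly p g R).eval x⁻¹ = 0 := by
  rw [eval_charPoly_eq hp hℓ _ _ hx0] at hx
  rw [eval_charPoly_eq hp hℓ _ _ (inv_ne_zero hx0), charFun_inv hp _ _ hx0,
    (mul_eq_zero.1 hx).resolve_left (pow_ne_zero _ hx0), mul_zero]

theorem IsSmall.valuation_ne_one (h : IsSmall O p g R) {x : K}
    (hx : (charPoly p g R).eval x = 0) : O.valuation x ≠ 1 := by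
  intro h1
  have := h.pow_le hx h1.le
  rw [h1, one_pow] at this
  exact absurd h.beta_lt this.not_gt

/-- If N_0 = 0 (that is, p = 2 and ℓ = 1), no root has |x| ≤ 1; but x and 1/x are both roots, so
there is none at all. -/
theorem IsSmall.orbitCount_ne_zero (h : IsSmall O p g R) (hp : 2 ≤ p) (hℓ : 1 ≤ ℓ) {x : K}
    (hx : (charPoly p g R).eval x = 0) : orbitCount p ℓ ≠ 0 := by
  intro hN
  have key : ∀ y : K, (charPoly p g R).eval y = 0 → ¬ O.valuation y ≤ 1 := by
    intro y hy h1
    have := h.pow_le hy h1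
    rw [hN, pow_zero] at this
    exact absurd h.beta_lt this.not_gt
  have hx0 := h.ne_zero_of_root hp hℓ hx
  have h1 := key x hx
  have h2 := key _ (eval_charPoly_inv hp hℓ hx0 hx)
  rw [map_inv₀, not_le] at h2
  rw [not_le] at h1
  exact absurd h2 (inv_lt_one_of_one_lt₀ h1).not_gt

/-- The rescaled characteristic polynomial reduces to `T ^ N_0 - 1` in the residue field. -/
theorem IsSmall.exists_reduction (h : IsSmall O p g R) (hp : 2 ≤ p) (hℓ : 1 ≤ ℓ) {b : O}
    (hb : (b : K) ^ orbitCount p ℓ = beta p g R ℓ) :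
    ∃ Q : Polynomial O,
      (charPoly p g R).comp (Polynomial.C (b : K) * Polynomial.X)
        = Polynomial.C (beta p g R ℓ) * Q.map (algebraMap O K) ∧
      Q.map (IsLocalRing.residue O) = Polynomial.X ^ orbitCount p ℓ - 1 := by
  have hb1 : IsLocalRing.residue O b = 0 := by
    rw [IsLocalRing.residue_eq_zero_iff, ValuationSubring.valuation_lt_one_iff]
    by_contra h1
    have h2 : (1 : O.ValueGroup) ≤ O.valuation (b : K) ^ orbitCount p ℓ :=
      one_le_pow₀ (not_lt.1 h1)
    rw [← map_pow, hb] at h2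
    exact absurd h.beta_lt h2.not_gt
  have hγ : ∀ j, ∃ c : O, j ∈ Finset.Icc 1 ℓ → beta p g R j = beta p g R ℓ * c := by
    intro j
    by_cases hj : j ∈ Finset.Icc 1 ℓ
    · have h1 : O.valuation (beta p g R j / beta p g R ℓ) ≤ 1 := by
        rw [map_div₀]
        exact div_le_one_of_le₀ (h.beta_le j hj) zero_le
      refine ⟨⟨_, (ValuationSubring.valuation_le_one_iff _ _).1 h1⟩, fun _ => ?_⟩
      exact (mul_div_cancel₀ _ h.beta_ne).symm
    · exact ⟨0, fun hj' => absurd hj' hj⟩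
  choose c hc using hγ
  have hcℓ : c ℓ = 1 := by
    have h1 := hc ℓ (Finset.mem_Icc.2 ⟨hℓ, le_rfl⟩)
    refine Subtype.ext (mul_left_cancel₀ h.beta_ne ?_)
    rw [← h1]; simp
  -- Dividing by b^{N_0} = β_ℓ leaves the integral ratios c_j = β_j / β_ℓ. Modulo the maximal ideal
  -- bT vanishes, so only the constant term c_ℓ = 1 of the sum remains.
  refine ⟨Polynomial.X ^ orbitCount p ℓ - ∑ j ∈ Finset.Icc 1 ℓ, Polynomial.C (c j)
      * (∑ k ∈ Finset.range (p - 1), (Polynomial.C b * Polynomial.X) ^ k) ^ j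
      * ∑ n ∈ Finset.Icc 1 (p * j - 1), (Polynomial.C b * Polynomial.X) ^ (orbitCount p ℓ + j - n),
    ?_, ?_⟩
  · rw [charPoly]
    simp only [Polynomial.sub_comp, Polynomial.pow_comp, Polynomial.X_comp, Polynomial.mul_comp,
      Polynomial.C_comp, Polynomial.sum_comp, Polynomial.map_sub, Polynomial.map_pow,
      Polynomial.map_X, Polynomial.map_sum, Polynomial.map_mul, Polynomial.map_C]
    rw [mul_sub, Finset.mul_sum, mul_pow, ← Polynomial.C_pow, hb]
    congr 1
    refine Finset.sum_congr rfl fun j hj => ?_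
    have h1 := hc j hj
    rw [beta] at h1
    rw [h1, Polynomial.C_mul]
    simp only [ValuationSubring.algebraMap_apply, mul_assoc]
  · simp only [Polynomial.map_sub, Polynomial.map_pow,
      Polynomial.map_X, Polynomial.map_sum, Polynomial.map_mul, Polynomial.map_C, hb1,
      Polynomial.C_0, zero_mul]
    rw [sum_zero_pow hp hℓ, hcℓ, map_one, map_one]

theorem IsSmall.residue_natCast_ne (h : IsSmall O p g R) {n : ℕ} (hn : n ≠ 0) :
    (n : IsLocalRing.ResidueField O) ≠ 0 := by
  rw [← map_natCast (IsLocalRing.residue O), Ne, IsLocalRing.residue_eq_zero_iff,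
    ValuationSubring.valuation_lt_one_iff]
  have := h.natCast n hn
  simpa using this.ge

/-- Small roots are separated by their residues after rescaling. -/
theorem IsSmall.residue_ne (h : IsSmall O p g R) (hp : 2 ≤ p) (hℓ : 1 ≤ ℓ) {b : O}
    (hN : orbitCount p ℓ ≠ 0) (hb : (b : K) ^ orbitCount p ℓ = beta p g R ℓ) {y z : O}
    (hd : (Polynomial.X - Polynomial.C (b * y : K)) * (Polynomial.X - Polynomial.C (b * z : K))
      ∣ charPoly p g R) :
    IsLocalRing.residue O y ≠ IsLocalRing.residue O z := by
  obtain ⟨Q, hQ, hQ'⟩ := h.exists_reduction hp hℓ hb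
  have hb0 : (b : K) ≠ 0 := by
    intro h0
    rw [h0, zero_pow hN] at hb
    exact h.beta_ne hb.symm
  -- The case y = z is allowed, where the divisibility hypothesis describes a double root. Equal
  -- residues would give a square factor of T^{N_0} - 1, which is separable because N_0 is nonzero
  -- in the residue field.
  intro hyz
  have h1 : (Polynomial.X - Polynomial.C y) * (Polynomial.X - Polynomial.C z) ∣ Q := by
    refine (Polynomial.map_dvd_map (algebraMap O K) Subtype.val_injective
      ((Polynomial.monic_X_sub_C _).mul (Polynomial.monic_X_sub_C _))).1 ?_
    have h2 := map_dvd (Polynomial.compRingHom (Polynomial.C (b : K) * Polynomial.X)) hd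
    simp only [Polynomial.coe_compRingHom_apply] at h2
    rw [hQ, (Polynomial.isUnit_C.2 h.beta_ne.isUnit).dvd_mul_left] at h2
    refine (Dvd.intro_left (Polynomial.C ((b : K) * b)) ?_).trans h2
    simp only [Polynomial.map_mul, Polynomial.map_sub, Polynomial.map_X, Polynomial.map_C,
      Polynomial.sub_comp, Polynomial.mul_comp, Polynomial.X_comp, Polynomial.C_comp,
      ValuationSubring.algebraMap_apply, Polynomial.C_mul]
    ring
  have h3 := Polynomial.map_dvd (IsLocalRing.residue O) h1
  rw [hQ', Polynomial.map_mul, Polynomial.map_sub, Polynomial.map_sub, Polynomial.map_C,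
    Polynomial.map_C, Polynomial.map_X, hyz] at h3
  have h4 := (Polynomial.separable_X_pow_sub_C (1 : IsLocalRing.ResidueField O)
    (h.residue_natCast_ne hN) one_ne_zero).squarefree
  rw [Polynomial.C_1] at h4
  exact Polynomial.not_isUnit_X_sub_C _ (h4 _ h3)

theorem IsSmall.residue_pow (h : IsSmall O p g R) (hp : 2 ≤ p) (hℓ : 1 ≤ ℓ) {b : O}
    (hb : (b : K) ^ orbitCount p ℓ = beta p g R ℓ) {y : O}
    (hy : (charPoly p g R).eval (b * y : K) = 0) :
    IsLocalRing.residue O y ^ orbitCount p ℓ = 1 := by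
  obtain ⟨Q, hQ, hQ'⟩ := h.exists_reduction hp hℓ hb
  have h1 := congrArg (Polynomial.eval (y : K)) hQ
  rw [Polynomial.eval_comp, Polynomial.eval_mul, Polynomial.eval_mul, Polynomial.eval_C,
    Polynomial.eval_C, Polynomial.eval_X, hy] at h1
  have h2 := (mul_eq_zero.1 h1.symm).resolve_left h.beta_ne
  have h3 : Q.eval y = 0 := by
    refine Subtype.val_injective ?_
    rw [← ValuationSubring.algebraMap_apply, Polynomial.eval_map_apply] at h2
    simpa using h2
  have h4 : (Q.map (IsLocalRing.residue O)).eval (IsLocalRing.residue O y) = 0 := by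
    rw [Polynomial.eval_map_apply, h3, map_zero]
  rw [hQ'] at h4
  simpa [sub_eq_zero] using h4

theorem IsSmall.exists_scale [IsAlgClosed K] (h : IsSmall O p g R) (hN : orbitCount p ℓ ≠ 0) :
    ∃ b : O, (b : K) ^ orbitCount p ℓ = beta p g R ℓ ∧
      ∀ x, (charPoly p g R).eval x = 0 → O.valuation x ≤ 1 → ∃ y : O, x = b * y := by
  obtain ⟨b, hb⟩ := IsAlgClosed.exists_pow_nat_eq (beta p g R ℓ) (Nat.pos_of_ne_zero hN)
  have hb0 : b ≠ 0 := by
    intro h0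
    rw [h0, zero_pow hN] at hb
    exact h.beta_ne hb.symm
  have hb1 : O.valuation b ≤ 1 := by
    by_contra h1
    have h2 : (1 : O.ValueGroup) < O.valuation b ^ orbitCount p ℓ :=
      one_lt_pow₀ (not_le.1 h1) hN
    rw [← map_pow, hb] at h2
    exact absurd h.beta_lt h2.not_gt
  refine ⟨⟨b, (ValuationSubring.valuation_le_one_iff _ _).1 hb1⟩, hb, fun x hx hx1 => ?_⟩
  have h1 := h.pow_le hx hx1
  rw [← hb, map_pow] at h1
  have h2 := (pow_le_pow_iff_left₀ zero_le zero_le hN).1 h1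
  have h3 : O.valuation (x / b) ≤ 1 := by
    rw [map_div₀]
    exact div_le_one_of_le₀ h2 zero_le
  exact ⟨⟨_, (ValuationSubring.valuation_le_one_iff _ _).1 h3⟩, (mul_div_cancel₀ _ hb0).symm⟩

/-- A double root with |x| ≤ 1 contradicts `IsSmall.residue_ne` with y = z; one with |x| > 1 is
moved inside by the palindromic symmetry. -/
theorem IsSmall.nodup_roots [IsAlgClosed K] (h : IsSmall O p g R) (hp : 2 ≤ p) (hℓ : 1 ≤ ℓ) :
    (charPoly p g R).roots.Nodup := by
  classical
  have hP := h.charPoly_ne_zero hp hℓ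
  have key : ∀ x, O.valuation x ≤ 1 → ¬ (Polynomial.X - Polynomial.C x) ^ 2 ∣ charPoly p g R := by
    intro x hx1 hd
    have hx : (charPoly p g R).eval x = 0 :=
      Polynomial.dvd_iff_isRoot.1 ((dvd_pow_self _ two_ne_zero).trans hd)
    have hN := h.orbitCount_ne_zero hp hℓ hx
    obtain ⟨b, hb, hy⟩ := h.exists_scale hN
    obtain ⟨y, rfl⟩ := hy x hx hx1
    rw [pow_two] at hd
    exact h.residue_ne hp hℓ hN hb hd rfl
  refine Multiset.nodup_iff_count_le_one.2 fun x => ?_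
  rw [Polynomial.count_roots]
  by_contra h1
  have hd : (Polynomial.X - Polynomial.C x) ^ 2 ∣ charPoly p g R :=
    (Polynomial.le_rootMultiplicity_iff hP).1 (by omega)
  have hx : (charPoly p g R).eval x = 0 :=
    Polynomial.dvd_iff_isRoot.1 ((dvd_pow_self _ two_ne_zero).trans hd)
  have hx0 := h.ne_zero_of_root hp hℓ hx
  rcases le_total (O.valuation x) 1 with h2 | h2
  · exact key x h2 hd
  · refine key x⁻¹ ?_ (sq_dvd_charPoly_inv hp hℓ g R (h.eval_zero_ne hp hℓ) hx0 hd)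
    rw [map_inv₀]
    exact inv_le_one_of_one_le₀ h2

theorem IsSmall.card_roots [IsAlgClosed K] (h : IsSmall O p g R) (hp : 2 ≤ p) (hℓ : 1 ≤ ℓ) :
    (charPoly p g R).roots.card = 2 * orbitCount p ℓ := by
  rw [IsAlgClosed.card_roots_eq_natDegree, natDegree_charPoly hp hℓ g R (h.eval_zero_ne hp hℓ)]

/-- Half of the roots are in the maximal ideal, and the other ones are their inverses. -/
theorem IsSmall.exists_small_roots [IsAlgClosed K] (h : IsSmall O p g R) (hp : 2 ≤ p)
    (hℓ : 1 ≤ ℓ) : ∃ x : Fin (orbitCount p ℓ) → K, Function.Injective x ∧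
      (∀ a, O.valuation (x a) < 1) ∧ (∀ a, (charPoly p g R).eval (x a) = 0) ∧
      ∀ z, (charPoly p g R).eval z = 0 → ∃ a, z = x a ∨ z = (x a)⁻¹ := by
  classical
  have hP := h.charPoly_ne_zero hp hℓ
  set S := (charPoly p g R).roots.toFinset with hS
  have hmem : ∀ z, z ∈ S ↔ (charPoly p g R).eval z = 0 := fun z => by
    rw [hS, Multiset.mem_toFinset, Polynomial.mem_roots hP, Polynomial.IsRoot]
  have hScard : S.card = 2 * orbitCount p ℓ := by
    rw [hS, Multiset.toFinset_card_of_nodup (h.nodup_roots hp hℓ), h.card_roots hp hℓ]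
  set A := S.filter fun z => O.valuation z < 1 with hA
  have hB : (S.filter fun z => ¬ O.valuation z < 1) = A.image fun z => z⁻¹ := by
    ext z
    simp only [Finset.mem_filter, Finset.mem_image, hA, hmem]
    constructor
    · rintro ⟨hz, hz1⟩
      have hz0 := h.ne_zero_of_root hp hℓ hz
      refine ⟨z⁻¹, ⟨eval_charPoly_inv hp hℓ hz0 hz, ?_⟩, inv_inv _⟩
      rw [map_inv₀]
      exact inv_lt_one_of_one_lt₀ (lt_of_le_of_ne (not_lt.1 hz1) (h.valuation_ne_one hz).symm)
    · rintro ⟨y, ⟨hy, hy1⟩, rfl⟩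
      have hy0 := h.ne_zero_of_root hp hℓ hy
      refine ⟨eval_charPoly_inv hp hℓ hy0 hy, ?_⟩
      rw [map_inv₀, not_lt]
      exact (one_le_inv₀ (O.valuation.pos_iff.2 hy0)).2 hy1.le
  have hAcard : A.card = orbitCount p ℓ := by
    have h1 := Finset.card_filter_add_card_filter_not (s := S) fun z => O.valuation z < 1
    rw [hB, Finset.card_image_of_injective _ inv_injective, hScard] at h1
    simp only [← hA] at h1
    omega
  refine ⟨fun a => (A.equivFinOfCardEq hAcard).symm a, ?_, ?_, ?_, ?_⟩
  · exact Subtype.val_injective.comp (A.equivFinOfCardEq hAcard).symm.injective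
  · exact fun a => (Finset.mem_filter.1 ((A.equivFinOfCardEq hAcard).symm a).2).2
  · exact fun a => (hmem _).1 (Finset.mem_filter.1 ((A.equivFinOfCardEq hAcard).symm a).2).1
  · intro z hz
    have hA' : ∀ y ∈ A, ∃ a, y = (A.equivFinOfCardEq hAcard).symm a := fun y hy =>
      ⟨A.equivFinOfCardEq hAcard ⟨y, hy⟩, by simp⟩
    by_cases hz1 : O.valuation z < 1
    · obtain ⟨a, ha⟩ := hA' z (Finset.mem_filter.2 ⟨(hmem z).2 hz, hz1⟩)
      exact ⟨a, Or.inl ha⟩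
    · have h1 : z ∈ A.image fun z => z⁻¹ := by
        rw [← hB]
        exact Finset.mem_filter.2 ⟨(hmem z).2 hz, hz1⟩
      obtain ⟨y, hy, rfl⟩ := Finset.mem_image.1 h1
      obtain ⟨a, ha⟩ := hA' y hy
      exact ⟨a, Or.inr (congrArg (·⁻¹) ha)⟩

/-- For x ≠ y with common value s, subtracting x^p - x = (x - 1)s and y^p - y = (y - 1)s gives (x^p
- y^p)/(x - y) = 1 + s. The left side has valuation less than 1 and the right side has valuation 1.
-/
theorem xi_injOn_small (hp : 2 ≤ p) {x y : K} (hx : O.valuation x < 1) (hy : O.valuation y < 1)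
    (hxy : xi p x = xi p y) : x = y := by
  by_contra hne
  have h1 := sub_one_mul_xi (p := p) (by omega) x
  have h2 := sub_one_mul_xi (p := p) (by omega) y
  rw [← hxy] at h2
  have h3 : (∑ i ∈ Finset.range p, x ^ i * y ^ (p - 1 - i)) = 1 + xi p x := by
    refine mul_right_cancel₀ (sub_ne_zero.2 hne) ?_
    rw [Commute.geom_sum₂_mul (Commute.all x y)]
    linear_combination h2 - h1
  have h4 : O.valuation (1 + xi p x) = 1 := by
    rw [Valuation.map_add_eq_of_lt_left, map_one]
    rw [valuation_xi hp hx, map_one]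
    exact hx
  rw [← h3] at h4
  refine absurd h4 (ne_of_lt (O.valuation.map_sum_lt one_ne_zero fun i hi => ?_))
  have hi := Finset.mem_range.1 hi
  rw [map_mul, map_pow, map_pow]
  rcases Nat.eq_zero_or_pos i with rfl | hi0
  · rw [pow_zero, one_mul]
    exact pow_lt_one₀ zero_le hy (by omega)
  · exact mul_lt_one_of_nonneg_of_lt_one_left zero_le (pow_lt_one₀ zero_le hx (by omega))
      (pow_le_one₀ zero_le hy.le)

/-- To leading order ξ(1/x) is x^{-(p-1)}, so the residues of the rescaled roots have equal (p -
1)-th powers. They are also N_0-th roots of unity and N_0 + 1 = (p - 1)ℓ. Each residue is thus the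
ℓ-th power of its (p - 1)-th power, and the residues coincide. -/
theorem IsSmall.xi_inv_injOn [IsAlgClosed K] (h : IsSmall O p g R) (hp : 2 ≤ p) (hℓ : 1 ≤ ℓ)
    {x z : K} (hx : (charPoly p g R).eval x = 0) (hz : (charPoly p g R).eval z = 0)
    (hx1 : O.valuation x < 1) (hz1 : O.valuation z < 1) (hxz : xi p x⁻¹ = xi p z⁻¹) : x = z := by
  have hN := h.orbitCount_ne_zero hp hℓ hx
  obtain ⟨b, hb, hy⟩ := h.exists_scale hN
  have hx0 := h.ne_zero_of_root hp hℓ hx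
  have hz0 := h.ne_zero_of_root hp hℓ hz
  by_contra hne
  obtain ⟨y, rfl⟩ := hy x hx hx1.le
  obtain ⟨t, rfl⟩ := hy z hz hz1.le
  have hb0 := left_ne_zero_of_mul hx0
  have hd : (Polynomial.X - Polynomial.C (b * y : K)) * (Polynomial.X - Polynomial.C (b * t : K))
      ∣ charPoly p g R :=
    IsCoprime.mul_dvd (Polynomial.isCoprime_X_sub_C_of_isUnit_sub (sub_ne_zero.2 hne).isUnit)
      (Polynomial.dvd_iff_isRoot.2 hx) (Polynomial.dvd_iff_isRoot.2 hz)
  refine h.residue_ne hp hℓ hN hb hd ?_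
  have hr : ∀ y : O, O.valuation ((b : K) * y) < 1 → IsLocalRing.residue O (b * y) = 0 := by
    intro y hy
    rw [IsLocalRing.residue_eq_zero_iff, ValuationSubring.valuation_lt_one_iff]
    simpa using hy
  have hs : ∀ y : O, O.valuation ((b : K) * y) < 1 →
      IsLocalRing.residue O (∑ k ∈ Finset.range (p - 1), (b * y) ^ k) = 1 := by
    intro y hy
    rw [map_sum]
    simp only [map_pow, hr y hy]
    rw [Finset.sum_eq_single_of_mem 0 (Finset.mem_range.2 (by omega)), pow_zero]
    intro k _ hk
    exact zero_pow hk
  have key : ∀ y : O, (b * y : K) ≠ 0 →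
      (b * y : K) ^ (p - 1) * xi p (b * y : K)⁻¹ = ∑ k ∈ Finset.range (p - 1), (b * y : K) ^ k := by
    intro y hy0
    have h2 := pow_mul_chi (p := p) (by omega) hy0
    rw [xi_eq (by omega), ← Nat.sub_add_cancel (show 1 ≤ p by omega), pow_succ', mul_assoc,
      Nat.sub_add_cancel (show 1 ≤ p by omega)] at h2
    exact mul_left_cancel₀ hy0 h2
  have h3 : t ^ (p - 1) * ∑ k ∈ Finset.range (p - 1), (b * y) ^ k
      = y ^ (p - 1) * ∑ k ∈ Finset.range (p - 1), (b * t) ^ k := by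
    refine Subtype.val_injective ?_
    push_cast
    rw [← key y hx0, ← key t hz0, hxz]
    ring
  have h4 := congrArg (IsLocalRing.residue O) h3
  rw [map_mul, map_mul, hs _ hx1, hs _ hz1, mul_one, mul_one, map_pow, map_pow] at h4
  have h5 : ∀ y : O, (charPoly p g R).eval (b * y : K) = 0 →
      IsLocalRing.residue O y = (IsLocalRing.residue O y ^ (p - 1)) ^ ℓ := by
    intro y hy
    rw [← pow_mul, ← orbitCount_add_one hp hℓ, pow_succ, h.residue_pow hp hℓ hb hy, one_mul]
  rw [h5 y hx, h5 t hz, h4]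

/-- ξ keeps small roots small and large roots large, so a collision can only occur within one of the
two classes. -/
theorem IsSmall.xi_injOn [IsAlgClosed K] (h : IsSmall O p g R) (hp : 2 ≤ p) (hℓ : 1 ≤ ℓ)
    {x z : K} (hx : (charPoly p g R).eval x = 0) (hz : (charPoly p g R).eval z = 0)
    (hxz : xi p x = xi p z) : x = z := by
  have hx0 := h.ne_zero_of_root hp hℓ hx
  have hz0 := h.ne_zero_of_root hp hℓ hz
  have hinv : ∀ {x : K}, 1 < O.valuation x → O.valuation x⁻¹ < 1 := fun {x} hx => by
    rw [map_inv₀]; exact inv_lt_one_of_one_lt₀ hx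
  have hlarge : ∀ {x : K}, x ≠ 0 → 1 < O.valuation x → 1 < O.valuation (xi p x) := by
    intro x hx0 hx
    have := one_lt_valuation_xi_inv hp (inv_ne_zero hx0) (hinv hx)
    rwa [inv_inv] at this
  rcases lt_or_gt_of_ne (h.valuation_ne_one hx) with h1 | h1 <;>
    rcases lt_or_gt_of_ne (h.valuation_ne_one hz) with h2 | h2
  · exact xi_injOn_small hp h1 h2 hxz
  · have h3 := hlarge hz0 h2
    rw [← hxz, valuation_xi hp h1] at h3
    exact absurd h1 h3.not_gt
  · have h3 := hlarge hx0 h1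
    rw [hxz, valuation_xi hp h2] at h3
    exact absurd h2 h3.not_gt
  · refine inv_injective (h.xi_inv_injOn hp hℓ (eval_charPoly_inv hp hℓ hx0 hx)
      (eval_charPoly_inv hp hℓ hz0 hz) (hinv h1) (hinv h2) ?_)
    rw [inv_inv, inv_inv, hxz]

theorem IsSmall.xi_ne_zero (h : IsSmall O p g R) (hp : 2 ≤ p) (hℓ : 1 ≤ ℓ)
    {x : K} (hx : (charPoly p g R).eval x = 0) : xi p x ≠ 0 := by
  have hx0 := h.ne_zero_of_root hp hℓ hx
  rcases lt_or_gt_of_ne (h.valuation_ne_one hx) with h1 | h1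
  · rw [← O.valuation.ne_zero_iff, valuation_xi hp h1, O.valuation.ne_zero_iff]
    exact hx0
  · have h2 : O.valuation x⁻¹ < 1 := by
      rw [map_inv₀]; exact inv_lt_one_of_one_lt₀ h1
    have h3 := one_lt_valuation_xi_inv hp (inv_ne_zero hx0) h2
    rw [inv_inv] at h3
    exact O.valuation.ne_zero_iff.1 (zero_lt_one.trans h3).ne'

end Roots


/-! ### Double points -/

section DoublePoints

variable {K : Type*} [Field K] {p ℓ : ℕ} {φ : Series ℓ →+* K} {R : Series ℓ}

theorem eval_curveY (hp : 1 ≤ p) (z : Kˣ) : LaurentPolynomial.eval₂ φ z (curveY p R)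
    = φ R * (z : K)⁻¹ + (z : K) ^ (p - 1) := by
  rw [curveY, map_add, LaurentPolynomial.eval₂_C_mul_T, LaurentPolynomial.eval₂_T]
  have h : ((p : ℤ) - 1) = ((p - 1 : ℕ) : ℤ) := by push_cast [Nat.cast_sub hp]; ring
  rw [h, zpow_natCast]
  simp

theorem eval_curveX (z : Kˣ) : LaurentPolynomial.eval₂ φ z (curveX p MvPowerSeries.X R)
    = (z : K) * (1 + ∑ j ∈ Finset.Icc 1 ℓ,
      alphaCoeff p (fun m => φ (MvPowerSeries.X m)) (φ R) j * ((z : K) ^ p)⁻¹ ^ j) := by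
  rw [curveX, map_add, map_sum, LaurentPolynomial.eval₂_T, mul_add, mul_one, Finset.mul_sum]
  congr 1
  · simp
  refine Finset.sum_congr rfl fun j _ => ?_
  rw [LaurentPolynomial.eval₂_C_mul_T, map_alphaCoeff]
  have h : ((z ^ (1 - (p : ℤ) * j) : Kˣ) : K) = z * ((z : K) ^ p)⁻¹ ^ j := by
    rw [zpow_sub, zpow_one, zpow_mul, zpow_natCast, zpow_natCast]
    push_cast
    rw [inv_pow]
  rw [h]
  ring

/-- With a = xb, (Y(a) - Y(b)) xb = (x - 1)(b^p ξ(x) - R). Once b^{-p} = ξ(x)/R is substituted, X(a)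
- X(b) = b(x - 1) F(x) with F = `charFun`. The factor x - 1 is nonzero as a ≠ b. -/
theorem mem_doublePoints_iff (hp : 2 ≤ p) (hℓ : 1 ≤ ℓ) (hR : φ R ≠ 0) (z : Kˣ × Kˣ) :
    z ∈ doublePoints p φ R ↔ z.1 ≠ z.2 ∧
      φ R = (z.2 : K) ^ p * xi p ((z.1 : K) / z.2) ∧
      (charPoly p (fun m => φ (MvPowerSeries.X m)) (φ R)).eval ((z.1 : K) / z.2) = 0 := by
  obtain ⟨a, b⟩ := z
  rw [doublePoints, Set.mem_ofPred_eq, eval_curveY (by omega), eval_curveY (by omega), eval_curveX,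
    eval_curveX]
  dsimp only
  refine and_congr_right fun hab => ?_
  have ha : (a : K) ≠ 0 := a.ne_zero
  have hb : (b : K) ≠ 0 := b.ne_zero
  obtain ⟨x, hx⟩ : ∃ x : K, x = a / b := ⟨_, rfl⟩
  rw [← hx]
  have hx0 : x ≠ 0 := hx ▸ div_ne_zero ha hb
  have hax : (a : K) = x * b := by rw [hx, div_mul_cancel₀ _ hb]
  have hx1 : x - 1 ≠ 0 := by
    intro h
    rw [sub_eq_zero.1 h, one_mul] at hax
    exact hab (Units.ext hax)
  have hY : (φ R * (a : K)⁻¹ + (a : K) ^ (p - 1) = φ R * (b : K)⁻¹ + (b : K) ^ (p - 1)) ↔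
      φ R = (b : K) ^ p * xi p x := by
    have h1 := sub_one_mul_xi (p := p) (by omega) x
    have h2 : x ^ p = x * x ^ (p - 1) := by rw [← pow_succ', Nat.sub_add_cancel (by omega)]
    have h3 : (b : K) ^ p = b * (b : K) ^ (p - 1) := by
      rw [← pow_succ', Nat.sub_add_cancel (by omega)]
    have h4 : (φ R * (a : K)⁻¹ + (a : K) ^ (p - 1) - (φ R * (b : K)⁻¹ + (b : K) ^ (p - 1)))
        * (x * b) = (x - 1) * ((b : K) ^ p * xi p x - φ R) := by
      have h5 : (x - 1) * ((b : K) ^ p * xi p x - φ R)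
          = b ^ p * (x ^ p - x) - (x - 1) * φ R := by rw [← h1]; ring
      rw [h5, hax, h2, h3, mul_pow]
      field_simp
      ring
    rw [← sub_eq_zero, ← mul_eq_zero_iff_right (mul_ne_zero hx0 hb), h4,
      mul_eq_zero_iff_left hx1, sub_eq_zero]
    exact eq_comm
  rw [and_comm, hY]
  refine and_congr_right fun hRb => ?_
  rw [eval_charPoly_eq hp hℓ _ _ hx0, mul_eq_zero_iff_left (pow_ne_zero _ hx0)]
  have hξ : xi p x ≠ 0 := fun h => hR (by rw [hRb, h, mul_zero])
  have hbp : ((b : K) ^ p)⁻¹ = (φ R)⁻¹ * xi p x := by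
    rw [hRb, mul_inv, mul_assoc, inv_mul_cancel₀ hξ, mul_one]
  have hap : ((a : K) ^ p)⁻¹ = x⁻¹ ^ p * ((φ R)⁻¹ * xi p x) := by
    rw [hax, mul_pow, mul_inv, hbp, inv_pow]
  rw [← sub_eq_zero, hap, hbp, hax]
  have h5 : x * (b : K) * (1 + ∑ j ∈ Finset.Icc 1 ℓ,
        alphaCoeff p (fun m => φ (MvPowerSeries.X m)) (φ R) j *
          (x⁻¹ ^ p * ((φ R)⁻¹ * xi p x)) ^ j)
      - b * (1 + ∑ j ∈ Finset.Icc 1 ℓ,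
        alphaCoeff p (fun m => φ (MvPowerSeries.X m)) (φ R) j * ((φ R)⁻¹ * xi p x) ^ j)
      = (b * (x - 1)) * charFun p (fun m => φ (MvPowerSeries.X m)) (φ R) x := by
    have h6 : (b * (x - 1)) * charFun p (fun m => φ (MvPowerSeries.X m)) (φ R) x
        = x * b - b - ∑ j ∈ Finset.Icc 1 ℓ, (b * (alphaCoeff p (fun m => φ (MvPowerSeries.X m)) (φ R) j
            * ((φ R)⁻¹ * xi p x) ^ j) - x * b * (alphaCoeff p (fun m => φ (MvPowerSeries.X m)) (φ R) j
            * (x⁻¹ ^ p * ((φ R)⁻¹ * xi p x)) ^ j)) := by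
      rw [charFun, mul_sub, Finset.mul_sum]
      congr 1
      · ring
      refine Finset.sum_congr rfl fun j hj => ?_
      have hj1 := (Finset.mem_Icc.1 hj).1
      have h7 := sub_one_mul_eta hx0 (p * j - 1)
      have h8 : x * x⁻¹ ^ (p * j) = x⁻¹ ^ (p * j - 1) := by
        obtain ⟨q, hq⟩ : ∃ q, p * j = q + 1 := ⟨p * j - 1, by
          have := Nat.mul_pos (show 0 < p by omega) hj1
          omega⟩
        rw [hq, Nat.add_sub_cancel, pow_succ', mul_inv_cancel_left₀ hx0]
      rw [beta, mul_pow (x⁻¹ ^ p), ← pow_mul, mul_pow]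
      linear_combination (b * (φ R)⁻¹ ^ j * alphaCoeff p (fun m => φ (MvPowerSeries.X m)) (φ R) j
        * xi p x ^ j) * (h7 + h8)
    rw [h6, Finset.sum_sub_distrib, ← Finset.mul_sum, ← Finset.mul_sum]
    ring
  rw [h5, mul_eq_zero_iff_left (mul_ne_zero hb hx1)]

theorem swap_mem_doublePoints {z : Kˣ × Kˣ} (h : z ∈ doublePoints p φ R) :
    z.swap ∈ doublePoints p φ R := ⟨h.1.symm, h.2.1.symm, h.2.2.symm⟩

/-- Double points with the same ratio are in the same orbit. -/
theorem exists_eq_mul_pow (hp : 2 ≤ p) (hℓ : 1 ≤ ℓ) (hR : φ R ≠ 0) {Ω : Kˣ}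
    (hΩ : IsPrimitiveRoot Ω p) {z t : Kˣ × Kˣ} (hz : z ∈ doublePoints p φ R)
    (ht : t ∈ doublePoints p φ R) (h : (z.1 : K) / z.2 = t.1 / t.2) :
    ∃ s : Fin p, z = (t.1 * Ω ^ s.val, t.2 * Ω ^ s.val) := by
  rw [mem_doublePoints_iff hp hℓ hR] at hz ht
  have h1 : (z.2 : K) ^ p = (t.2 : K) ^ p := by
    have hξ : xi p ((t.1 : K) / t.2) ≠ 0 := fun h0 => hR (by rw [ht.2.1, h0, mul_zero])
    refine mul_right_cancel₀ hξ ?_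
    rw [← ht.2.1, ← h, ← hz.2.1]
  have h2 : (z.2 / t.2) ^ p = 1 := by
    refine Units.ext ?_
    push_cast
    rw [div_pow, h1, div_self (pow_ne_zero _ t.2.ne_zero)]
  have : NeZero p := ⟨by omega⟩
  obtain ⟨s, hs, hs'⟩ := (IsPrimitiveRoot.coe_units_iff.2 hΩ).eq_pow_of_pow_eq_one
    (by simpa using congrArg Units.val h2 : ((z.2 / t.2 : Kˣ) : K) ^ p = 1)
  have h3 : z.2 = t.2 * Ω ^ s := by
    rw [(Units.ext (by simpa using hs') : Ω ^ s = z.2 / t.2), mul_div_cancel]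
  refine ⟨⟨s, hs⟩, Prod.ext ?_ h3⟩
  refine Units.ext ?_
  rw [div_eq_iff z.2.ne_zero, h3] at h
  rw [h]
  push_cast
  field_simp

/-- The X_a are the small roots, and w̄_a is any p-th root of R / ξ(X_a); the other p-th roots form
its orbit. The order inside a pair is recognized by whether the ratio is small or large. -/
theorem exists_isClassification [IsAlgClosed K] {O : ValuationSubring K} (hp : 2 ≤ p)
    (hℓ : 1 ≤ ℓ) (hR : φ R ≠ 0)
    (h : IsSmall O p (fun m => φ (MvPowerSeries.X m)) (φ R)) {Ω : Kˣ}
    (hΩ : IsPrimitiveRoot Ω p) : ∃ w wb : Fin (orbitCount p ℓ) → Kˣ,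
      IsClassification p φ R Ω w wb ∧ ∀ a, O.valuation (root w wb a) < 1 := by
  obtain ⟨x, hinj, hx1, hx, hall⟩ := h.exists_small_roots hp hℓ
  have hx0 : ∀ a, x a ≠ 0 := fun a => h.ne_zero_of_root hp hℓ (hx a)
  have hξ : ∀ a, xi p (x a) ≠ 0 := fun a => h.xi_ne_zero hp hℓ (hx a)
  have hex : ∀ a, ∃ t : Kˣ, φ R = (t : K) ^ p * xi p (x a) := by
    intro a
    obtain ⟨t, ht⟩ := IsAlgClosed.exists_pow_nat_eq (φ R / xi p (x a)) (show 0 < p by omega)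
    have ht0 : t ≠ 0 := by
      rintro rfl
      rw [zero_pow (by omega)] at ht
      exact div_ne_zero hR (hξ a) ht.symm
    exact ⟨Units.mk0 t ht0, by rw [Units.val_mk0, ht, div_mul_cancel₀ _ (hξ a)]⟩
  choose wb hwb using hex
  set w : Fin (orbitCount p ℓ) → Kˣ := fun a => Units.mk0 (x a) (hx0 a) * wb a with hw
  have hroot : ∀ a, (w a : K) / wb a = x a := by
    intro a
    simp only [hw]
    push_cast
    rw [Units.val_mk0, mul_div_cancel_right₀ _ (wb a).ne_zero]
  have hmem0 : ∀ a, (w a, wb a) ∈ doublePoints p φ R := by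
    intro a
    rw [mem_doublePoints_iff hp hℓ hR]
    dsimp only
    rw [hroot]
    refine ⟨fun h0 => ?_, hwb a, hx a⟩
    have h1 := hroot a
    rw [h0, div_self (wb a).ne_zero] at h1
    have h2 := hx1 a
    rw [← h1, map_one] at h2
    exact lt_irrefl _ h2
  have hΩp : (Ω : K) ^ p = 1 := by
    have := congrArg Units.val hΩ.pow_eq_one
    simpa using this
  have hmul : ∀ z ∈ doublePoints p φ R, ∀ s : ℕ,
      (z.1 * Ω ^ s, z.2 * Ω ^ s) ∈ doublePoints p φ R := by
    intro z hz s
    rw [mem_doublePoints_iff hp hℓ hR] at hz ⊢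
    dsimp only
    have h1 : ((z.1 * Ω ^ s : Kˣ) : K) / (z.2 * Ω ^ s : Kˣ) = z.1 / z.2 := by
      push_cast
      rw [mul_div_mul_right _ _ (pow_ne_zero _ Ω.ne_zero)]
    rw [h1]
    refine ⟨fun h0 => hz.1 (mul_right_cancel h0), ?_, hz.2.2⟩
    push_cast
    rw [mul_pow, ← pow_mul, mul_comm s, pow_mul, hΩp, one_pow, mul_one]
    exact hz.2.1
  have hmem : ∀ t, orbitPoint (p := p) Ω w wb t ∈ doublePoints p φ R := by
    rintro ⟨a, s, _ | _⟩
    · exact hmul _ (hmem0 a) s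
    · exact hmul _ (swap_mem_doublePoints (hmem0 a)) s
  have hratio : ∀ a s, ((orbitPoint (p := p) Ω w wb (a, s, false)).1 : K)
        / (orbitPoint (p := p) Ω w wb (a, s, false)).2 = x a ∧
      ((orbitPoint (p := p) Ω w wb (a, s, true)).1 : K)
        / (orbitPoint (p := p) Ω w wb (a, s, true)).2 = (x a)⁻¹ := by
    intro a s
    simp only [orbitPoint]
    push_cast
    rw [mul_div_mul_right _ _ (pow_ne_zero _ Ω.ne_zero),
      mul_div_mul_right _ _ (pow_ne_zero _ Ω.ne_zero), hroot, ← hroot a, inv_div]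
    exact ⟨rfl, rfl⟩
  have hxinv : ∀ a, 1 < O.valuation (x a)⁻¹ := fun a => by
    rw [map_inv₀]
    exact (one_lt_inv₀ (O.valuation.pos_iff.2 (hx0 a))).2 (hx1 a)
  refine ⟨w, wb, ⟨fun t _ => hmem t, ?_, ?_⟩, fun a => by rw [root, hroot]; exact hx1 a⟩
  · have hpow : ∀ s t : Fin p, Ω ^ s.val = Ω ^ t.val → s = t := fun s t hst =>
      Fin.ext (hΩ.pow_inj s.2 t.2 hst)
    rintro ⟨a, s, c⟩ _ ⟨b, t, d⟩ _ heq
    have hq := congrArg (fun z : Kˣ × Kˣ => (z.1 : K) / z.2) heq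
    cases c <;> cases d
    · rw [(hratio _ _).1, (hratio _ _).1] at hq
      obtain rfl := hinj hq
      simp only [orbitPoint, Prod.mk.injEq, mul_right_inj] at heq
      rw [hpow _ _ heq.1]
    · rw [(hratio _ _).1, (hratio _ _).2] at hq
      have h1 := hxinv b
      rw [← hq] at h1
      exact absurd (hx1 a) h1.not_gt
    · rw [(hratio _ _).1, (hratio _ _).2] at hq
      have h1 := hxinv a
      rw [hq] at h1
      exact absurd (hx1 b) h1.not_gt
    · rw [(hratio _ _).2, (hratio _ _).2] at hq
      obtain rfl := hinj (inv_injective hq)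
      simp only [orbitPoint, Prod.mk.injEq, mul_right_inj] at heq
      rw [hpow _ _ heq.1]
  · intro z hz
    obtain ⟨a, ha | ha⟩ := hall _ ((mem_doublePoints_iff hp hℓ hR z).1 hz).2.2
    · obtain ⟨s, hs⟩ := exists_eq_mul_pow hp hℓ hR hΩ hz (hmem0 a) (by rw [ha, hroot])
      exact ⟨(a, s, false), trivial, hs.symm⟩
    · obtain ⟨s, hs⟩ := exists_eq_mul_pow hp hℓ hR hΩ hz (swap_mem_doublePoints (hmem0 a))
        (by rw [ha, ← hroot, inv_div]; rfl)
      exact ⟨(a, s, true), trivial, hs.symm⟩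

/-- Properties of a choice of representatives of the orbits of double points. -/
structure RootData (p : ℕ) {ℓ : ℕ} (g : Fin ℓ → K) (R : K) (w wb : Fin (orbitCount p ℓ) → Kˣ) :
    Prop where
  eq_xi : ∀ a, R = (wb a : K) ^ p * xi p (root w wb a)
  eq_chi : ∀ a, R = (w a : K) ^ p * chi p (root w wb a)
  eval_eq : ∀ a, (charPoly p g R).eval (root w wb a) = 0
  injective : Function.Injective (root w wb)
  ne_inv : ∀ a b, root w wb a ≠ (root w wb b)⁻¹

/-- Two pairs with the same ratio lie in one orbit. A coincidence X_a = X_b with a ≠ b, or X_a =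
1/X_b, would hence give two labels to one double point. -/
theorem IsClassification.rootData (hp : 2 ≤ p) (hℓ : 1 ≤ ℓ) (hR : φ R ≠ 0) {Ω : Kˣ}
    (hΩ : IsPrimitiveRoot Ω p) {w wb : Fin (orbitCount p ℓ) → Kˣ}
    (h : IsClassification p φ R Ω w wb) :
    RootData p (fun m => φ (MvPowerSeries.X m)) (φ R) w wb := by
  have h0 : ∀ a, orbitPoint (p := p) Ω w wb (a, ⟨0, by omega⟩, false) = (w a, wb a) := by
    intro a; simp [orbitPoint]
  have hmem : ∀ a, (w a, wb a) ∈ doublePoints p φ R := fun a => by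
    rw [← h0]; exact h.1 trivial
  have hdp := fun a => (mem_doublePoints_iff hp hℓ hR _).1 (hmem a)
  have hdp' := fun a => (mem_doublePoints_iff hp hℓ hR _).1 (swap_mem_doublePoints (hmem a))
  refine ⟨fun a => (hdp a).2.1, fun a => ?_, fun a => (hdp a).2.2, fun a b hab => ?_,
    fun a b hab => ?_⟩
  · rw [chi_eq_xi_inv, root, inv_div]
    exact (hdp' a).2.1
  · obtain ⟨s, hs⟩ := exists_eq_mul_pow hp hℓ hR hΩ (hmem a) (hmem b) hab
    have h1 : orbitPoint (p := p) Ω w wb (a, ⟨0, by omega⟩, false)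
        = orbitPoint Ω w wb (b, s, false) := (h0 a).trans hs
    exact congrArg Prod.fst (h.2.1 trivial trivial h1)
  · rw [root, root, inv_div] at hab
    obtain ⟨s, hs⟩ := exists_eq_mul_pow hp hℓ hR hΩ (hmem a) (swap_mem_doublePoints (hmem b)) hab
    have h1 : orbitPoint (p := p) Ω w wb (a, ⟨0, by omega⟩, false)
        = orbitPoint Ω w wb (b, s, true) := (h0 a).trans hs
    have := h.2.1 trivial trivial h1
    simp at this

/-- The first element a of a double point (a, b) determines ξ(b/a) by R = a^p ξ(b/a), hence b/a
since ξ separates the roots, hence b. -/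
theorem IsClassification.injective_fst [IsAlgClosed K] {O : ValuationSubring K} (hp : 2 ≤ p)
    (hℓ : 1 ≤ ℓ) (hR : φ R ≠ 0)
    (hs : IsSmall O p (fun m => φ (MvPowerSeries.X m)) (φ R)) {Ω : Kˣ}
    {w wb : Fin (orbitCount p ℓ) → Kˣ} (h : IsClassification p φ R Ω w wb) :
    Function.Injective fun t => (orbitPoint (p := p) Ω w wb t).1 := by
  intro t t' htt
  dsimp only at htt
  have h1 := (mem_doublePoints_iff hp hℓ hR _).1 (swap_mem_doublePoints (h.1 (Set.mem_univ t)))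
  have h2 := (mem_doublePoints_iff hp hℓ hR _).1 (swap_mem_doublePoints (h.1 (Set.mem_univ t')))
  simp only [Prod.fst_swap, Prod.snd_swap, ← htt] at h1 h2
  have h3 := hs.xi_injOn hp hℓ h1.2.2 h2.2.2
    (mul_left_cancel₀ (pow_ne_zero p (Units.ne_zero _)) (h1.2.1.symm.trans h2.2.1))
  rw [div_left_inj' (Units.ne_zero _)] at h3
  exact h.2.1 trivial trivial (Prod.ext htt (Units.ext h3))

theorem RootData.roots_eq [IsAlgClosed K] {O : ValuationSubring K} {g : Fin ℓ → K} {r : K}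
    {w wb : Fin (orbitCount p ℓ) → Kˣ} (hp : 2 ≤ p) (hℓ : 1 ≤ ℓ)
    (hs : IsSmall O p g r) (h : RootData p g r w wb) :
    (charPoly p g r).roots = Finset.univ.val.map (fun a => root w wb a)
      + Finset.univ.val.map (fun a => (root w wb a)⁻¹) := by
  have hP := hs.charPoly_ne_zero hp hℓ
  refine (Multiset.eq_of_le_of_card_le ((Multiset.le_iff_subset ?_).2 ?_) ?_).symm
  · rw [Multiset.nodup_add]
    refine ⟨Finset.univ.nodup.map h.injective,
      Finset.univ.nodup.map (inv_injective.comp h.injective), ?_⟩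
    rw [Multiset.disjoint_left]
    intro x hx hx'
    obtain ⟨a, -, rfl⟩ := Multiset.mem_map.1 hx
    obtain ⟨b, -, hb⟩ := Multiset.mem_map.1 hx'
    exact h.ne_inv a b hb.symm
  · intro x hx
    rw [Polynomial.mem_roots hP, Polynomial.IsRoot]
    rcases Multiset.mem_add.1 hx with hx | hx
    · obtain ⟨a, -, rfl⟩ := Multiset.mem_map.1 hx
      exact h.eval_eq a
    · obtain ⟨a, -, rfl⟩ := Multiset.mem_map.1 hx
      exact eval_charPoly_inv hp hℓ (hs.ne_zero_of_root hp hℓ (h.eval_eq a)) (h.eval_eq a)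
  · rw [hs.card_roots hp hℓ]
    simp
    omega

end DoublePoints


/-! ### Exchange of the two halves of the roots -/

section Exchange

variable {K : Type*} [Field K] {p ℓ : ℕ}

theorem exists_fin_of_multiset {A : Type*} (s : Multiset A) {n : ℕ} (h : s.card = n) :
    ∃ f : Fin n → A, Finset.univ.val.map f = s := by
  subst h
  induction s using Quotient.inductionOn with
  | h l => exact ⟨l.get, (Fin.univ_val_map _).trans (congrArg _ (List.ofFn_get l))⟩

theorem exists_eval_eq_prod [IsAlgClosed K] {E : Polynomial K} (hE : E.Monic) {n : ℕ}
    (hn : E.natDegree = n) : ∃ t : Fin n → K, ∀ y, E.eval y = ∏ k, (y - t k) := by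
  obtain ⟨t, ht⟩ := exists_fin_of_multiset E.roots ((IsAlgClosed.card_roots_eq_natDegree).trans hn)
  refine ⟨t, fun y => ?_⟩
  have h := (IsAlgClosed.splits E).eq_prod_roots
  rw [hE.leadingCoeff, Polynomial.C_1, one_mul, ← ht, Multiset.map_map] at h
  change E = ∏ k, (Polynomial.X - Polynomial.C (t k)) at h
  rw [h, Polynomial.eval_prod]
  simp

/-- Factorization of `ξ(y) - ξ(x)`. -/
theorem exists_xi_sub_eq [IsAlgClosed K] (hp : 2 ≤ p) (x : K) :
    ∃ t : Fin (p - 2) → K, (∀ y, xi p y - xi p x = (y - x) * ∏ k, (y - t k)) ∧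
      (x - 1) * ∏ k, (x - t k) = p * x ^ (p - 1) - (1 + xi p x) := by
  obtain ⟨q, rfl⟩ : ∃ q, p = q + 2 := ⟨p - 2, by omega⟩
  rw [show q + 2 - 2 = q by omega, show q + 2 - 1 = q + 1 by omega]
  set A : Polynomial K := ∑ k ∈ Finset.Icc 1 (q + 1), Polynomial.X ^ k - Polynomial.C (xi (q + 2) x)
    with hA
  have hev : ∀ y, A.eval y = xi (q + 2) y - xi (q + 2) x := fun y => by
    simp [hA, xi, Polynomial.eval_finsetSum]
  have hAform : A = Polynomial.X ^ (q + 1)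
      + (∑ k ∈ Finset.Icc 1 q, Polynomial.X ^ k - Polynomial.C (xi (q + 2) x)) := by
    rw [hA, Finset.sum_Icc_succ_top (by omega)]; ring
  have hnat : (∑ k ∈ Finset.Icc 1 q, (Polynomial.X : Polynomial K) ^ k
      - Polynomial.C (xi (q + 2) x)).natDegree ≤ q := by
    refine (Polynomial.natDegree_sub_le _ _).trans (max_le ?_ ?_)
    · refine Polynomial.natDegree_sum_le_of_forall_le _ _ fun k hk => ?_
      rw [Polynomial.natDegree_X_pow]
      exact (Finset.mem_Icc.1 hk).2
    · simp
  have hAm : A.Monic := by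
    rw [hAform]
    refine Polynomial.monic_X_pow_add (lt_of_le_of_lt (Polynomial.degree_le_of_natDegree_le hnat) ?_)
    exact_mod_cast Nat.lt_succ_self q
  have hAd : A.natDegree = q + 1 := by
    rw [hAform, Polynomial.natDegree_add_eq_left_of_natDegree_lt, Polynomial.natDegree_X_pow]
    rw [Polynomial.natDegree_X_pow]
    omega
  obtain ⟨E, hE⟩ : (Polynomial.X - Polynomial.C x) ∣ A :=
    Polynomial.dvd_iff_isRoot.2 (by rw [Polynomial.IsRoot, hev, sub_self])
  have hEm : E.Monic := (Polynomial.monic_X_sub_C x).of_mul_monic_left (hE ▸ hAm)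
  have hEd : E.natDegree = q := by
    have h := congrArg Polynomial.natDegree hE
    rw [(Polynomial.monic_X_sub_C x).natDegree_mul hEm, Polynomial.natDegree_X_sub_C, hAd] at h
    omega
  obtain ⟨t, ht⟩ := exists_eval_eq_prod hEm hEd
  refine ⟨t, fun y => ?_, ?_⟩
  · rw [← hev, hE, Polynomial.eval_mul, ht]; simp
  · rw [← ht]
    -- Differentiating this identity at x isolates (x - 1) E(x), which tells when x is a multiple
    -- preimage.
    have h1 : (Polynomial.X - 1) * ((Polynomial.X - Polynomial.C x) * E) = Polynomial.X ^ (q + 2)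
        - Polynomial.C (1 + xi (q + 2) x) * Polynomial.X + Polynomial.C (xi (q + 2) x) := by
      rw [← hE]
      refine Polynomial.funext fun y => ?_
      have h2 := sub_one_mul_xi (p := q + 2) (by omega) y
      simp only [Polynomial.eval_mul, Polynomial.eval_sub, Polynomial.eval_X, Polynomial.eval_one,
        Polynomial.eval_add, Polynomial.eval_pow, Polynomial.eval_C, hev]
      linear_combination h2
    have h2 := congrArg (fun f => (Polynomial.derivative f).eval x) h1
    simp only [Polynomial.derivative_mul, Polynomial.derivative_sub, Polynomial.derivative_add,
      Polynomial.derivative_X, Polynomial.derivative_C, Polynomial.derivative_one,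
      Polynomial.derivative_X_pow, Polynomial.eval_mul, Polynomial.eval_sub, Polynomial.eval_X,
      Polynomial.eval_one, Polynomial.eval_add, Polynomial.eval_pow, Polynomial.eval_C,
      Polynomial.eval_zero] at h2
    rw [show q + 2 - 1 = q + 1 by omega] at h2
    linear_combination h2

variable {g : Fin ℓ → K} {R : K}

/-- Put w = x w̄ with w̄^p ξ(x) = R. Up to the factor w̄, the right side is X(w̄t) - X(w̄) and the
left side is X(w̄t) - X(w). They agree because F(x) = 0 means X(w) = X(w̄). -/
theorem charFun_div (hp : 2 ≤ p) {x t : K} (hx0 : x ≠ 0) (ht0 : t ≠ 0) (htx : t ≠ x)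
    (hxt : xi p t = xi p x) (hx : charFun p g R x = 0) :
    (t - x) * charFun p g R (t / x) = (t - 1) * charFun p g R t := by
  have hdx := sub_one_mul_xi (p := p) (by omega) x
  have hdt := sub_one_mul_xi (p := p) (by omega) t
  rw [hxt] at hdt
  have hy0 : t / x ≠ 0 := div_ne_zero ht0 hx0
  have hξ : xi p (t / x) = x⁻¹ ^ p * xi p x := by
    have h1 := sub_one_mul_xi (p := p) (by omega) (t / x)
    have h2 : t / x - 1 ≠ 0 := by
      rw [sub_ne_zero]
      exact fun h => htx ((div_eq_one_iff_eq hx0).1 h)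
    refine mul_left_cancel₀ h2 ?_
    rw [h1, div_pow, inv_pow]
    field_simp
    linear_combination t * hdx - x * hdt
  have h3 : ∀ y : K, y ≠ 0 → (y - 1) * charFun p g R y = y - 1 - ∑ j ∈ Finset.Icc 1 ℓ,
      beta p g R j * xi p y ^ j * (1 - y * y⁻¹ ^ (p * j)) := by
    intro y hy
    rw [charFun, mul_sub, mul_one, Finset.mul_sum]
    congr 1
    refine Finset.sum_congr rfl fun j hj => ?_
    have h4 := sub_one_mul_eta hy (p * j - 1)
    have h8 : y * y⁻¹ ^ (p * j) = y⁻¹ ^ (p * j - 1) := by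
      obtain ⟨q, hq⟩ : ∃ q, p * j = q + 1 := ⟨p * j - 1, by
        have := Nat.mul_pos (show 0 < p by omega) (Finset.mem_Icc.1 hj).1
        omega⟩
      rw [hq, Nat.add_sub_cancel, pow_succ', mul_inv_cancel_left₀ hy]
    rw [h8, ← h4]
    ring
  have h5 := h3 x hx0
  have h6 := h3 (t / x) hy0
  have h7 := h3 t ht0
  rw [hx, mul_zero] at h5
  have h9 : (t - x) * charFun p g R (t / x) = x * ((t / x - 1) * charFun p g R (t / x)) := by
    field_simp
  rw [h9, h6, h7, hxt, hξ]
  have h10 : x * (t / x - 1 - ∑ j ∈ Finset.Icc 1 ℓ, beta p g R j * (x⁻¹ ^ p * xi p x) ^ j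
      * (1 - t / x * (t / x)⁻¹ ^ (p * j))) = t - x - ∑ j ∈ Finset.Icc 1 ℓ,
        beta p g R j * xi p x ^ j * (x * x⁻¹ ^ (p * j) - t * t⁻¹ ^ (p * j)) := by
    rw [mul_sub, Finset.mul_sum]
    congr 1
    · field_simp
    refine Finset.sum_congr rfl fun j _ => ?_
    have h11 : (t / x)⁻¹ ^ (p * j) * x⁻¹ ^ (p * j) = t⁻¹ ^ (p * j) := by
      rw [← mul_pow]
      congr 1
      field_simp
    rw [mul_pow, ← pow_mul]
    have h12 : x * (t / x) = t := by field_simp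
    linear_combination (-(beta p g R j * xi p x ^ j) * x * (t / x)) * h11
      - (beta p g R j * xi p x ^ j * t⁻¹ ^ (p * j)) * h12
  rw [h10]
  have h13 : ∑ j ∈ Finset.Icc 1 ℓ, beta p g R j * xi p x ^ j
        * (x * x⁻¹ ^ (p * j) - t * t⁻¹ ^ (p * j))
      = ∑ j ∈ Finset.Icc 1 ℓ, beta p g R j * xi p x ^ j * (1 - t * t⁻¹ ^ (p * j))
        - ∑ j ∈ Finset.Icc 1 ℓ, beta p g R j * xi p x ^ j * (1 - x * x⁻¹ ^ (p * j)) := by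
    rw [← Finset.sum_sub_distrib]
    exact Finset.sum_congr rfl fun j _ => by ring
  rw [h13]
  linear_combination h5

/-- Let t_k be the preimages of ξ(X_a) under ξ other than X_a. Those of χ(X_a) are 1/X_a and the t_k
/ X_a: the same fibre of Y, seen from w_a instead of w̄_a. Both sides become products of values of
G, the characteristic polynomial without its factors at X_a and 1/X_a, and `charFun_div` compares
G(t_k) with G(t_k / X_a). The conditions on ξ and χ keep the t_k away from 0, 1, X_a and 1/X_a, so
that all cancellations are legitimate. -/
theorem prod_xi_sub_exchange [IsAlgClosed K] (hp : 2 ≤ p) (hℓ : 1 ≤ ℓ)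
    {N : ℕ} (hN : N = orbitCount p ℓ) {x : Fin N → K} (hx0 : ∀ c, x c ≠ 0) {lc : K} (hlc : lc ≠ 0)
    (hP : ∀ z, (charPoly p g R).eval z = lc * ∏ c, ((z - x c) * (z - (x c)⁻¹)))
    (hx1' : ∀ c, x c ^ 2 ≠ 1) (a : Fin N) (hξ0 : xi p (x a) ≠ 0)
    (hξ : xi p (x a) ≠ p - 1) (hχ : chi p (x a) ≠ p - 1) (hne : xi p (x a) ≠ chi p (x a)) :
    (∏ c ∈ Finset.univ.erase a, (xi p (x a) - chi p (x c)))
        * ∏ c ∈ Finset.univ.erase a, (xi p (x a) - xi p (x c))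
      = x a ^ (p * (N - 1)) * ((∏ c ∈ Finset.univ.erase a, (chi p (x a) - chi p (x c)))
        * ∏ c ∈ Finset.univ.erase a, (chi p (x a) - xi p (x c))) := by
  obtain ⟨t, ht, htd⟩ := exists_xi_sub_eq hp (x a)
  set X := x a with hX
  set s := xi p X with hs
  have hx1 : X ^ 2 ≠ 1 := hx1' a
  have hX0 : X ≠ 0 := hx0 a
  have hX1 : X ≠ 1 := fun h => hx1 (by rw [h, one_pow])
  set E : K → K := fun y => ∏ k, (y - t k) with hE
  have hdX := sub_one_mul_xi (p := p) (by omega) X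
  have hχX := pow_mul_chi (p := p) (by omega) hX0
  rw [← hs] at hdX hχX
  have hD : ∀ y, (y - 1) * ((y - X) * E y) = y ^ p - (1 + s) * y + s := fun y => by
    have := sub_one_mul_xi (p := p) (by omega) y
    rw [← ht y]
    linear_combination this
  have hXp : X ^ p = X * X ^ (p - 1) := by rw [← pow_succ', Nat.sub_add_cancel (by omega)]
  have hE1 : E 1 ≠ 0 := by
    intro h0
    have h1 := ht 1
    change _ = _ * E 1 at h1
    rw [h0, mul_zero, sub_eq_zero] at h1
    refine hξ (h1.symm.trans ?_)
    simp [xi, Nat.cast_sub (show 1 ≤ p by omega)]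
  have hEX : E X ≠ 0 := by
    intro h0
    change _ * E X = _ at htd
    rw [h0, mul_zero] at htd
    refine hχ (mul_left_cancel₀ (pow_ne_zero p hX0) ?_)
    linear_combination hχX + X * htd - hdX - p * hXp
  have hEinv : E X⁻¹ ≠ 0 := by
    intro h0
    have h1 := ht X⁻¹
    change _ = _ * E X⁻¹ at h1
    rw [h0, mul_zero, sub_eq_zero] at h1
    exact hne h1.symm
  have ht1 : ∀ k, t k ≠ 1 := fun k h =>
    hE1 (Finset.prod_eq_zero (Finset.mem_univ k) (by rw [h, sub_self]))
  have htX : ∀ k, t k ≠ X := fun k h =>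
    hEX (Finset.prod_eq_zero (Finset.mem_univ k) (by rw [h, sub_self]))
  have hEt : ∀ k, E (t k) = 0 := fun k =>
    Finset.prod_eq_zero (Finset.mem_univ k) (sub_self _)
  have hξt : ∀ k, xi p (t k) = s := fun k => by
    have h1 := ht (t k)
    change _ = _ * E (t k) at h1
    rwa [hEt, mul_zero, sub_eq_zero] at h1
  have ht0 : ∀ k, t k ≠ 0 := fun k h => by
    have h1 := hξt k
    rw [h, xi_eq (by omega), zero_mul] at h1
    exact hξ0 h1.symm
  set G : K → K := fun z => ∏ c ∈ Finset.univ.erase a, ((z - x c) * (z - (x c)⁻¹)) with hG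
  have hPG : ∀ z, (charPoly p g R).eval z = lc * ((z - X) * (z - X⁻¹) * G z) := fun z => by
    rw [hP, ← Finset.mul_prod_erase _ _ (Finset.mem_univ a)]
  have hFX : charFun p g R X = 0 := by
    have h1 := hPG X
    rw [sub_self, zero_mul, zero_mul, mul_zero, eval_charPoly_eq hp hℓ _ _ hX0] at h1
    exact (mul_eq_zero.1 h1).resolve_left (pow_ne_zero _ hX0)
  -- This is `charFun_div` after removing the nonzero factors lc, t_k - X and t_k - 1.
  have hGt : ∀ k, X ^ 2 * ((X⁻¹ - t k) * G (t k)) = X ^ N * ((X ^ 2 - t k) * G (t k / X)) := by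
    intro k
    have h1 := charFun_div (g := g) (R := R) hp hX0 (ht0 k) (htX k) (hξt k) hFX
    have h2 := eval_charPoly_eq hp hℓ g R (ht0 k)
    have h3 := eval_charPoly_eq hp hℓ g R (div_ne_zero (ht0 k) hX0)
    rw [hPG, ← hN] at h2 h3
    have h4 : (t k / X) ^ N * X ^ N = t k ^ N := by rw [← mul_pow, div_mul_cancel₀ _ hX0]
    have h5 : X ^ 2 * ((t k / X - X) * (t k / X - X⁻¹)) = (t k - X ^ 2) * (t k - 1) := by
      field_simp
    refine mul_left_cancel₀ (mul_ne_zero hlc (mul_ne_zero (sub_ne_zero.2 (htX k))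
      (sub_ne_zero.2 (ht1 k)))) ?_
    linear_combination (-X ^ 2 * (t k - 1)) * h2 + X ^ 2 * (t k - X) * X ^ N * h3
      + X ^ 2 * t k ^ N * h1 - X ^ N * lc * (t k - X) * G (t k / X) * h5
      + X ^ 2 * (t k - X) * charFun p g R (t k / X) * h4
  have hprod : X ^ (2 * (p - 2)) * (E X⁻¹ * ∏ k, G (t k))
      = X ^ (N * (p - 2)) * (E (X ^ 2) * ∏ k, G (t k / X)) := by
    have h1 := Finset.prod_congr (rfl : (Finset.univ : Finset (Fin (p - 2))) = _) fun k _ => hGt k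
    rw [Finset.prod_mul_distrib, Finset.prod_mul_distrib, Finset.prod_mul_distrib,
      Finset.prod_mul_distrib, Finset.prod_const, Finset.prod_const, Finset.card_univ,
      Fintype.card_fin, ← pow_mul, ← pow_mul] at h1
    exact h1
  -- Compares y^p - (1 + s)y + s at X² and at 1/X, using that it vanishes at X. These are the
  -- factors left over in `hprod`.
  have hEE : E (X ^ 2) = X ^ (p - 2) * E X⁻¹ := by
    have h1 := hD (X ^ 2)
    have h2 := hD X⁻¹
    have h3 : X ^ p = X ^ 2 * X ^ (p - 2) := by rw [← pow_add]; congr 1; omega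
    have h4 : X⁻¹ ^ p * X ^ p = 1 := by rw [← mul_pow, inv_mul_cancel₀ hX0, one_pow]
    have h5 : X * X⁻¹ = 1 := mul_inv_cancel₀ hX0
    have h6 : (X ^ 2) ^ p = (X ^ p) ^ 2 := by rw [← pow_mul, ← pow_mul, mul_comm]
    have h7 : X ^ p = (1 + s) * X - s := by linear_combination -hdX
    have h8 : (X ^ 2 - 1) * ((X ^ 2 - X) * E (X ^ 2))
        = X * X ^ p * ((X⁻¹ - 1) * ((X⁻¹ - X) * E X⁻¹)) := by
      rw [h1, h2, h6]
      have h9 : X * X ^ p * (X⁻¹ ^ p - (1 + s) * X⁻¹ + s)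
          = X - (1 + s) * X ^ p + s * X * X ^ p := by
        linear_combination X * h4 - (1 + s) * X ^ p * h5
      rw [h9, h7]
      ring
    have h10 : X * X ^ p * ((X⁻¹ - 1) * ((X⁻¹ - X) * E X⁻¹))
        = (X ^ 2 - 1) * ((X ^ 2 - X) * (X ^ (p - 2) * E X⁻¹)) := by
      rw [h3]
      field_simp
      ring
    rw [h10] at h8
    refine mul_left_cancel₀ (sub_ne_zero.2 ?_) (mul_left_cancel₀ (sub_ne_zero.2 hx1) h8)
    rw [pow_two]
    exact fun h => hX1 (mul_left_cancel₀ hX0 (h.trans (mul_one X).symm))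
  have hGX : G X = X ^ (2 * (N - 1)) * G X⁻¹ := by
    have h1 : X ^ (2 * (N - 1)) = ∏ _c ∈ (Finset.univ.erase a : Finset (Fin N)), X ^ 2 := by
      rw [Finset.prod_const, Finset.card_erase_of_mem (Finset.mem_univ a), Finset.card_univ,
        Fintype.card_fin, ← pow_mul]
    rw [h1, ← Finset.prod_mul_distrib]
    refine Finset.prod_congr rfl fun c _ => ?_
    have h2 := hx0 c
    field_simp
    ring
  have hL : (∏ c ∈ Finset.univ.erase a, (s - chi p (x c)))
        * ∏ c ∈ Finset.univ.erase a, (s - xi p (x c)) = G X * ∏ k, G (t k) := by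
    rw [Finset.prod_comm, ← Finset.prod_mul_distrib, ← Finset.prod_mul_distrib]
    refine Finset.prod_congr rfl fun c _ => ?_
    have h1 := ht (x c)
    have h2 := ht (x c)⁻¹
    rw [← chi_eq_xi_inv] at h2
    have h3 : (s - chi p (x c)) * (s - xi p (x c)) = (X - x c) * (X - (x c)⁻¹) *
        ((∏ k, (x c - t k)) * ∏ k, ((x c)⁻¹ - t k)) := by
      linear_combination -(s - chi p (x c)) * h1 - (X - x c) * (∏ k, (x c - t k)) * h2
    rw [h3, ← Finset.prod_mul_distrib]
    congr 1
    exact Finset.prod_congr rfl fun k _ => by ring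
  -- Rescaling the fibre by X. The point y = 1 is excluded since the identity is obtained after
  -- multiplication by y - 1.
  have ht' : ∀ y, y ≠ 1 → xi p y - chi p X = (y - X⁻¹) * ∏ k, (y - t k / X) := by
    intro y hy
    have h1 := hD (X * y)
    have h2 := sub_one_mul_xi (p := p) (by omega) y
    have h3 : E (X * y) = X ^ (p - 2) * ∏ k, (y - t k / X) := by
      have h4 : X ^ (p - 2) = ∏ _k : Fin (p - 2), X := by simp
      rw [h4, ← Finset.prod_mul_distrib]
      refine Finset.prod_congr rfl fun k _ => ?_
      field_simp
    have h5 : X ^ p = X ^ 2 * X ^ (p - 2) := by rw [← pow_add]; congr 1; omega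
    have h6 : X * X⁻¹ = 1 := mul_inv_cancel₀ hX0
    rw [h3, mul_pow] at h1
    refine mul_left_cancel₀ (mul_ne_zero (pow_ne_zero p hX0) (sub_ne_zero.2 hy)) ?_
    have h7 : X ^ p * (y - 1) * (xi p y - chi p X) = X ^ p * y ^ p - (1 + s) * (X * y) + s := by
      linear_combination X ^ p * h2 - (y - 1) * hχX + y * hdX
    rw [h7, ← h1, h5]
    linear_combination (X ^ (p - 2) * X * (y - 1) * ∏ k, (y - t k / X)) * h6
  have hR : (∏ c ∈ Finset.univ.erase a, (chi p X - chi p (x c)))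
        * ∏ c ∈ Finset.univ.erase a, (chi p X - xi p (x c)) = G X⁻¹ * ∏ k, G (t k / X) := by
    rw [Finset.prod_comm, ← Finset.prod_mul_distrib, ← Finset.prod_mul_distrib]
    refine Finset.prod_congr rfl fun c _ => ?_
    have hc : x c ≠ 1 := fun h => hx1' c (by rw [h, one_pow])
    have h1 := ht' (x c) hc
    have h2 := ht' (x c)⁻¹ (fun h => hc (inv_eq_one.1 h))
    rw [← chi_eq_xi_inv] at h2
    have h3 : (chi p X - chi p (x c)) * (chi p X - xi p (x c)) = (X⁻¹ - x c) * (X⁻¹ - (x c)⁻¹) *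
        ((∏ k, (x c - t k / X)) * ∏ k, ((x c)⁻¹ - t k / X)) := by
      linear_combination -(chi p X - chi p (x c)) * h1
        - (X⁻¹ - x c) * (∏ k, (x c - t k / X)) * h2
    rw [h3, ← Finset.prod_mul_distrib]
    congr 1
    exact Finset.prod_congr rfl fun k _ => by ring
  rw [hL, hR]
  rw [hEE] at hprod
  have hprod2 : X ^ (2 * (p - 2)) * ∏ k, G (t k)
      = X ^ (N * (p - 2)) * (X ^ (p - 2) * ∏ k, G (t k / X)) := by
    refine mul_left_cancel₀ hEinv ?_
    linear_combination hprod
  refine mul_left_cancel₀ (pow_ne_zero (2 * (p - 2)) hX0) ?_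
  have hpow : X ^ (2 * (p - 2)) * X ^ (p * (N - 1))
      = X ^ (N * (p - 2)) * X ^ (p - 2) * X ^ (2 * (N - 1)) := by
    rw [← pow_add, ← pow_add, ← pow_add]
    congr 1
    have hN1 : 1 ≤ N := Nat.one_le_iff_ne_zero.2 fun h => (Fin.cast h a).elim0
    obtain ⟨n, hn⟩ : ∃ n, N = n + 1 := ⟨N - 1, by omega⟩
    obtain ⟨q, rfl⟩ : ∃ q, p = q + 2 := ⟨p - 2, by omega⟩
    rw [hn, Nat.add_sub_cancel, Nat.add_sub_cancel]
    ring
  rw [hGX]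
  linear_combination (X ^ (2 * (N - 1)) * G X⁻¹) * hprod2
    - (G X⁻¹ * ∏ k, G (t k / X)) * hpow

end Exchange


/-! ### The determinants of the double points -/

section CurveDeterminants

variable {K : Type*} [Field K] {p ℓ : ℕ} {g : Fin ℓ → K} {R : K} {O : ValuationSubring K}
  {w wb : Fin (orbitCount p ℓ) → Kˣ}

/-- The integer p - 1 has valuation 1, while ξ at a root never does. -/
theorem IsSmall.xi_ne_natCast (h : IsSmall O p g R) (hp : 2 ≤ p) (hℓ : 1 ≤ ℓ) {x : K}
    (hx : (charPoly p g R).eval x = 0) : xi p x ≠ p - 1 := by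
  have hx0 := h.ne_zero_of_root hp hℓ hx
  have h1 : O.valuation ((p : K) - 1) = 1 := by
    have := h.natCast (p - 1) (by omega)
    rwa [Nat.cast_sub (by omega), Nat.cast_one] at this
  intro he
  rw [← he] at h1
  rcases lt_or_gt_of_ne (h.valuation_ne_one hx) with h2 | h2
  · rw [valuation_xi hp h2] at h1
    exact h2.ne h1
  · have h3 : O.valuation x⁻¹ < 1 := by
      rw [map_inv₀]; exact inv_lt_one_of_one_lt₀ h2
    have h4 := one_lt_valuation_xi_inv hp (inv_ne_zero hx0) h3
    rw [inv_inv] at h4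
    exact h4.ne' h1

namespace RootData

theorem ne_zero (a : Fin (orbitCount p ℓ)) : root w wb a ≠ 0 :=
  div_ne_zero (w a).ne_zero (wb a).ne_zero

variable (h : RootData p g R w wb) (hs : IsSmall O p g R) (hp : 2 ≤ p) (hℓ : 1 ≤ ℓ)

include h hs hp hℓ

omit hs in
theorem eval_inv_eq (a : Fin (orbitCount p ℓ)) : (charPoly p g R).eval (root w wb a)⁻¹ = 0 :=
  eval_charPoly_inv hp hℓ (ne_zero a) (h.eval_eq a)

theorem xi_ne_zero (a : Fin (orbitCount p ℓ)) : xi p (root w wb a) ≠ 0 :=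
  hs.xi_ne_zero hp hℓ (h.eval_eq a)

theorem chi_ne_zero (a : Fin (orbitCount p ℓ)) : chi p (root w wb a) ≠ 0 :=
  hs.xi_ne_zero hp hℓ (h.eval_inv_eq hp hℓ a)

theorem injective_xi [IsAlgClosed K] : Function.Injective fun a => xi p (root w wb a) :=
  fun a b hab => h.injective (hs.xi_injOn hp hℓ (h.eval_eq a) (h.eval_eq b) hab)

theorem injective_chi [IsAlgClosed K] : Function.Injective fun a => chi p (root w wb a) :=
  fun a b hab => h.injective (inv_injective
    (hs.xi_injOn hp hℓ (h.eval_inv_eq hp hℓ a) (h.eval_inv_eq hp hℓ b) hab))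

theorem xi_ne_chi [IsAlgClosed K] (a b : Fin (orbitCount p ℓ)) :
    xi p (root w wb a) ≠ chi p (root w wb b) :=
  fun hab => h.ne_inv a b (hs.xi_injOn hp hℓ (h.eval_eq a) (h.eval_inv_eq hp hℓ b) hab)

theorem wb_pow (a : Fin (orbitCount p ℓ)) : (wb a : K) ^ p = R / xi p (root w wb a) :=
  (eq_div_iff (h.xi_ne_zero hs hp hℓ a)).2 (h.eq_xi a).symm

theorem w_pow (a : Fin (orbitCount p ℓ)) : (w a : K) ^ p = R / chi p (root w wb a) :=
  (eq_div_iff (h.chi_ne_zero hs hp hℓ a)).2 (h.eq_chi a).symm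

/-- As w̄_a^p = R/ξ_a and w_a^p = R/χ_a, `ratioDet_div` applies, and its factor (χ_a/ξ_a)^{N_0-1} =
X_a^{-p(N_0-1)} absorbs the shift of the exponent. For `vDet` the same factor appears inverted and
creates the shift. -/
theorem uDet_eq (hR : R ≠ 0) (i : ℕ) : uDet w wb p i = ratioDet (fun a => xi p (root w wb a))
    (fun a => chi p (root w wb a)) (fun a => root w wb a ^ i) := by
  rw [uDet]
  simp only [h.wb_pow hs hp hℓ, h.w_pow hs hp hℓ]
  rw [ratioDet_div hR (h.xi_ne_zero hs hp hℓ) (h.chi_ne_zero hs hp hℓ)]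
  congr 1
  funext a
  have h1 := pow_mul_chi (p := p) (by omega) (ne_zero (w := w) (wb := wb) a)
  rw [← h1, Fintype.card_fin, pow_add, pow_mul, mul_assoc, ← mul_pow,
    ← mul_div_assoc, div_self (mul_ne_zero (pow_ne_zero _ (ne_zero a)) (h.chi_ne_zero hs hp hℓ a)),
    one_pow, mul_one]

theorem vDet_eq (hR : R ≠ 0) (i : ℕ) : vDet w wb p i = ratioDet (fun a => chi p (root w wb a))
    (fun a => xi p (root w wb a)) (fun a => root w wb a ^ (i + p * (orbitCount p ℓ - 1))) := by
  rw [vDet]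
  simp only [h.wb_pow hs hp hℓ, h.w_pow hs hp hℓ]
  rw [ratioDet_div hR (h.chi_ne_zero hs hp hℓ) (h.xi_ne_zero hs hp hℓ)]
  congr 1
  funext a
  have h1 := pow_mul_chi (p := p) (by omega) (ne_zero (w := w) (wb := wb) a)
  rw [← h1, Fintype.card_fin, pow_add, pow_mul, mul_div_cancel_right₀ _ (h.chi_ne_zero hs hp hℓ a)]

/-- The interaction of two indices in the subset sum is symmetric in ξ and χ, so it is enough to
compare the weights of single indices, which is `prod_xi_sub_exchange`. -/
theorem uDet_eq_vDet [IsAlgClosed K] (hR : R ≠ 0) (i : ℕ) : uDet w wb p i = vDet w wb p i := by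
  have hne := h.xi_ne_chi hs hp hℓ
  rw [h.uDet_eq hs hp hℓ hR, h.vDet_eq hs hp hℓ hR,
    ratioDet_eq_subsetSum (h.injective_chi hs hp hℓ) hne,
    ratioDet_eq_subsetSum (h.injective_xi hs hp hℓ) fun a b => (hne b a).symm]
  refine subsetSum_swap fun a => ?_
  have hP : ∀ z, (charPoly p g R).eval z = (charPoly p g R).leadingCoeff
      * ∏ c, ((z - root w wb c) * (z - (root w wb c)⁻¹)) := by
    intro z
    have h1 := (IsAlgClosed.splits (charPoly p g R)).eq_prod_roots
    rw [h.roots_eq hp hℓ hs, Multiset.map_add, Multiset.prod_add, Multiset.map_map,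
      Multiset.map_map] at h1
    change _ = Polynomial.C _ * ((∏ c, (Polynomial.X - Polynomial.C (root w wb c)))
      * ∏ c, (Polynomial.X - Polynomial.C (root w wb c)⁻¹)) at h1
    conv_lhs => rw [h1]
    rw [Finset.prod_mul_distrib]
    simp [Polynomial.eval_prod]
  have h1 := prod_xi_sub_exchange hp hℓ rfl (fun c => ne_zero (w := w) (wb := wb) c)
    (Polynomial.leadingCoeff_ne_zero.2 (hs.charPoly_ne_zero hp hℓ)) hP
    (fun c hc => h.ne_inv c c (eq_inv_of_mul_eq_one_left ((pow_two _).symm.trans hc))) a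
    (h.xi_ne_zero hs hp hℓ a) (hs.xi_ne_natCast hp hℓ (h.eval_eq a))
    (hs.xi_ne_natCast hp hℓ (h.eval_inv_eq hp hℓ a)) (hne a a)
  have h2 : ∏ c ∈ Finset.univ.erase a, (chi p (root w wb a) - chi p (root w wb c)) ≠ 0 :=
    Finset.prod_ne_zero_iff.2 fun c hc => sub_ne_zero.2 fun he =>
      (Finset.mem_erase.1 hc).1 (h.injective_chi hs hp hℓ he).symm
  have h3 : ∏ c ∈ Finset.univ.erase a, (xi p (root w wb a) - xi p (root w wb c)) ≠ 0 :=
    Finset.prod_ne_zero_iff.2 fun c hc => sub_ne_zero.2 fun he =>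
      (Finset.mem_erase.1 hc).1 (h.injective_xi hs hp hℓ he).symm
  rw [div_mul_eq_mul_div, div_mul_eq_mul_div, div_eq_div_iff h2 h3, pow_add]
  linear_combination root w wb a ^ i * h1

omit h hs hℓ

theorem hBar_eq_prod {Ω : Kˣ} (hΩ : IsPrimitiveRoot Ω p)
    (hinj : Function.Injective fun t => (orbitPoint (p := p) Ω w wb t).1) (i : ℕ) :
    hBar Ω w wb p i = ∏ s ∈ Finset.Icc 1 p, uDet w wb p (i + s) := by
  have hΩp : (Ω : K) ^ p = 1 := by
    have := congrArg Units.val hΩ.pow_eq_one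
    simpa using this
  have h1 : Function.Injective fun as : Fin (orbitCount p ℓ) × Fin p =>
      (w as.1 : K) * (Ω : K) ^ as.2.val := by
    intro as bt hab
    have := @hinj (as.1, as.2, false) (bt.1, bt.2, false) (Units.ext (by simpa [orbitPoint] using hab))
    simp only [Prod.mk.injEq, and_true] at this
    exact Prod.ext this.1 this.2
  rw [hBar, (ratioDet_orbits (by omega) hΩp (fun a => (w a).ne_zero) h1
    (x := fun a => (wb a : K))
    (f := fun a => root w wb a ^ (i + orbitCount p ℓ * p))).2]
  have h2 : ∀ r : Fin p, ratioDet (fun a => (wb a : K) ^ p) (fun a => (w a : K) ^ p)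
      (fun a => root w wb a ^ (i + orbitCount p ℓ * p) * ((wb a : K) / w a) ^ r.val)
      = uDet w wb p (i + (p - r.val)) := by
    intro r
    rw [uDet]
    congr 1
    funext a
    have h3 : ((wb a : K) / w a) = (root w wb a)⁻¹ := by rw [root, inv_div]
    have hN : 1 ≤ orbitCount p ℓ := Nat.one_le_iff_ne_zero.2 fun h => (Fin.cast h a).elim0
    -- The Fourier factor lowers the exponent by r, so residue r gives u_{i+s} with s = p - r in 1,
    -- ..., p. The index a itself shows N_0 ≥ 1.
    have h4 : i + orbitCount p ℓ * p = (i + (p - r.val) + p * (orbitCount p ℓ - 1)) + r.val := by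
      obtain ⟨n, hn⟩ : ∃ n, orbitCount p ℓ = n + 1 := ⟨orbitCount p ℓ - 1, by omega⟩
      rw [hn, Nat.add_sub_cancel]
      have := r.2
      have h5 : (n + 1) * p = p * n + p := by ring
      omega
    rw [h3, h4, pow_add _ _ r.val, mul_assoc, ← mul_pow, mul_inv_cancel₀ (ne_zero a), one_pow,
      mul_one]
  simp only [h2]
  rw [Fin.prod_univ_eq_prod_range (fun r => uDet w wb p (i + (p - r))) p]
  refine Finset.prod_bij' (fun r _ => p - r) (fun s _ => p - s) ?_ ?_ ?_ ?_ ?_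
  all_goals
    intro r hr
    simp only [Finset.mem_range, Finset.mem_Icc] at hr ⊢
  all_goals omega

theorem hBar'_eq_prod {Ω : Kˣ} (hΩ : IsPrimitiveRoot Ω p)
    (hinj : Function.Injective fun t => (orbitPoint (p := p) Ω w wb t).1) (i : ℕ) :
    hBar' Ω w wb p i = ∏ s ∈ Finset.Icc 1 p, vDet w wb p (i + s) := by
  have hΩp : (Ω : K) ^ p = 1 := by
    have := congrArg Units.val hΩ.pow_eq_one
    simpa using this
  have h1 : Function.Injective fun as : Fin (orbitCount p ℓ) × Fin p =>
      (wb as.1 : K) * (Ω : K) ^ as.2.val := by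
    intro as bt hab
    have := @hinj (as.1, as.2, true) (bt.1, bt.2, true) (Units.ext (by simpa [orbitPoint] using hab))
    simp only [Prod.mk.injEq, and_true] at this
    exact Prod.ext this.1 this.2
  rw [hBar', (ratioDet_orbits (by omega) hΩp (fun a => (wb a).ne_zero) h1
    (x := fun a => (w a : K))
    (f := fun a => root w wb a ^ (i + 1))).2]
  have h2 : ∀ r : Fin p, ratioDet (fun a => (w a : K) ^ p) (fun a => (wb a : K) ^ p)
      (fun a => root w wb a ^ (i + 1) * ((w a : K) / wb a) ^ r.val)
      = vDet w wb p (i + (1 + r.val)) := by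
    intro r
    rw [vDet]
    congr 1
    funext a
    rw [← root, ← pow_add, add_assoc]
  simp only [h2]
  rw [Fin.prod_univ_eq_prod_range (fun r => vDet w wb p (i + (1 + r))) p]
  refine Finset.prod_bij' (fun r _ => 1 + r) (fun s _ => s - 1) ?_ ?_ ?_ ?_ ?_
  all_goals
    intro r hr
    simp only [Finset.mem_range, Finset.mem_Icc] at hr ⊢
  all_goals omega

end RootData

end CurveDeterminants


/-! ### Non-vanishing of the determinants -/

section PairDet

variable {K : Type*} [Field K] {p N : ℕ}

/-- The determinant of the differences of powers at the two elements of the double points. -/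
def pairDet (p : ℕ) (w wb : Fin N → Kˣ) (j : ℕ) : K :=
  Matrix.det (Matrix.of fun a k : Fin N => (wb a : K) ^ (j + p * k.val) - (w a : K) ^ (j + p * k.val))

/-- Trades v_i, which depends on the order in each pair, for a determinant that is odd under
exchanging the two elements of any pair. -/
theorem vDet_mul_eq_pairDet {w wb : Fin N → Kˣ} (hinj : Function.Injective fun a => (wb a : K) ^ p)
    (i : ℕ) : vDet w wb p i * ((Matrix.vandermonde fun a => (wb a : K) ^ p).det
      * (∏ a, (wb a : K)) ^ i) = pairDet p w wb i := by
  rw [← mul_assoc, vDet, ratioDet_mul_det_vandermonde hinj, ← Finset.prod_pow, mul_comm,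
    ← Matrix.det_mul_column, pairDet]
  congr 1
  ext a k
  have h1 : root w wb a ^ i * (wb a : K) ^ i = (w a : K) ^ i := by
    rw [← mul_pow, root, div_mul_cancel₀ _ (wb a).ne_zero]
  simp only [Matrix.of_apply, pow_add, pow_mul]
  linear_combination -((w a : K) ^ p) ^ k.val * h1

theorem pairDet_swap (w wb : Fin N → Kˣ) (e : Fin N → Prop) [DecidablePred e] (j : ℕ) :
    pairDet p (fun a => if e a then wb a else w a) (fun a => if e a then w a else wb a) j
      = (∏ a, if e a then (-1 : K) else 1) * pairDet p w wb j := by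
  rw [pairDet, pairDet, ← Matrix.det_mul_column]
  congr 1
  ext a k
  by_cases h : e a <;> simp [h]

end PairDet

-- Reduction to small roots, for which v_i is a unit

section Orientation

variable {K : Type*} [Field K] {p ℓ : ℕ} {g : Fin ℓ → K} {R : K} {O : ValuationSubring K}
  {w wb : Fin (orbitCount p ℓ) → Kˣ}

theorem RootData.injective_wb_pow [IsAlgClosed K] (h : RootData p g R w wb) (hs : IsSmall O p g R)
    (hp : 2 ≤ p) (hℓ : 1 ≤ ℓ) : Function.Injective fun a => (wb a : K) ^ p := by
  intro a b hab
  have h1 := h.eq_xi a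
  have h2 := h.eq_xi b
  dsimp only at hab
  rw [hab, h2] at h1
  exact (h.injective_xi hs hp hℓ (mul_left_cancel₀ (pow_ne_zero _ (wb b).ne_zero) h1)).symm

theorem RootData.swap (h : RootData p g R w wb) (hp : 2 ≤ p) (hℓ : 1 ≤ ℓ)
    (e : Fin (orbitCount p ℓ) → Prop) [DecidablePred e] :
    RootData p g R (fun a => if e a then wb a else w a) (fun a => if e a then w a else wb a) := by
  have hroot : ∀ a, root (fun a => if e a then wb a else w a) (fun a => if e a then w a else wb a) a
      = if e a then (root w wb a)⁻¹ else root w wb a := by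
    intro a
    by_cases ha : e a <;> simp [root, ha]
  refine ⟨fun a => ?_, fun a => ?_, fun a => ?_, fun a b hab => ?_, fun a b hab => ?_⟩
  · rw [hroot]
    by_cases ha : e a
    · simpa only [ha, if_true, chi_eq_xi_inv] using h.eq_chi a
    · simpa [ha] using h.eq_xi a
  · rw [hroot]
    by_cases ha : e a
    · simp only [ha, if_true, chi_eq_xi_inv, inv_inv]
      exact h.eq_xi a
    · simpa [ha] using h.eq_chi a
  · rw [hroot]
    by_cases ha : e a
    · simpa [ha] using h.eval_inv_eq hp hℓ a
    · simpa [ha] using h.eval_eq a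
  · rw [hroot, hroot] at hab
    by_cases ha : e a <;> by_cases hb : e b <;> simp only [ha, hb, if_true, if_false] at hab
    · exact h.injective (inv_injective hab)
    · exact absurd hab.symm (h.ne_inv b a)
    · exact absurd hab (h.ne_inv a b)
    · exact h.injective hab
  · rw [hroot, hroot] at hab
    by_cases ha : e a <;> by_cases hb : e b <;> simp only [ha, hb, if_true, if_false, inv_inv] at hab
    · exact absurd hab.symm (h.ne_inv b a)
    · exact hb (h.injective (inv_injective hab) ▸ ha)
    · exact ha (h.injective hab ▸ hb)
    · exact absurd hab (h.ne_inv a b)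

theorem RootData.exists_small_orientation (h : RootData p g R w wb) (hs : IsSmall O p g R) :
    ∃ e : Fin (orbitCount p ℓ) → Prop, ∃ _ : DecidablePred e, ∀ a,
      O.valuation (root (fun a => if e a then wb a else w a)
        (fun a => if e a then w a else wb a) a) < 1 := by
  classical
  refine ⟨fun a => 1 < O.valuation (root w wb a), inferInstance, fun a => ?_⟩
  have h1 := fun e : Fin (orbitCount p ℓ) → Prop => fun _ : DecidablePred e =>
    show root (fun a => if e a then wb a else w a) (fun a => if e a then w a else wb a) a
      = if e a then (root w wb a)⁻¹ else root w wb a by by_cases ha : e a <;> simp [root, ha]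
  rw [h1]
  split_ifs with ha
  · rw [map_inv₀]
    exact inv_lt_one_of_one_lt₀ ha
  · exact lt_of_le_of_ne (not_lt.1 ha) (hs.valuation_ne_one (h.eval_eq a))

/-- Multiply by the Vandermonde determinant of the ξ(y_a). Since y^p χ(y) = ξ(y), the entries become
ξ^k (1 - y^{i+p(N-1-k)}), polynomials of the form T^k + ⋯ because i ≥ 1. By `exists_unit_det_eval`
both determinants are units times the same Vandermonde determinant. -/
theorem valuation_ratioDet_chi_xi (hp : 2 ≤ p) {N : ℕ} {y : Fin N → K} (hinj : Function.Injective y)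
    (hξ : Function.Injective fun a => xi p (y a)) (hy0 : ∀ a, y a ≠ 0)
    (hsmall : ∀ a, O.valuation (y a) < 1) {i : ℕ} (hi : 1 ≤ i) :
    O.valuation (ratioDet (fun a => chi p (y a)) (fun a => xi p (y a))
      fun a => y a ^ (i + p * (N - 1))) = 1 := by
  set x : Fin N → O := fun a => ⟨y a,
    (ValuationSubring.valuation_le_one_iff _ _).1 (hsmall a).le⟩ with hx
  have hx0 : ∀ a, IsLocalRing.residue O (x a) = 0 := fun a => by
    rw [IsLocalRing.residue_eq_zero_iff, ValuationSubring.valuation_lt_one_iff]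
    exact hsmall a
  set Ξ : Polynomial O := Polynomial.X * ∑ k ∈ Finset.range (p - 1), Polynomial.X ^ k with hΞ
  have hΞdvd : Polynomial.X ^ 2 ∣ Ξ - Polynomial.X := by
    obtain ⟨q, rfl⟩ : ∃ q, p = q + 2 := ⟨p - 2, by omega⟩
    rw [hΞ, show q + 2 - 1 = q + 1 by omega, Finset.sum_range_succ']
    refine ⟨∑ k ∈ Finset.range q, Polynomial.X ^ k, ?_⟩
    rw [Finset.sum_congr rfl fun k _ => pow_succ (Polynomial.X : Polynomial O) k,
      ← Finset.sum_mul]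
    ring
  have hpow : ∀ k : ℕ, (Polynomial.X : Polynomial O) ^ (k + 1) ∣ Ξ ^ k - Polynomial.X ^ k := by
    intro k
    obtain ⟨c, hc⟩ := hΞdvd
    have h1 : Ξ = Polynomial.X * (1 + Polynomial.X * c) := by linear_combination hc
    rw [h1, mul_pow, pow_succ, ← mul_sub_one]
    refine mul_dvd_mul_left _ ?_
    have h2 := sub_dvd_pow_sub_pow (1 + Polynomial.X * c) 1 k
    rw [one_pow, add_sub_cancel_left] at h2
    exact (dvd_mul_right _ _).trans h2
  have hev : ∀ a, ((Ξ.eval (x a) : O) : K) = xi p (y a) := by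
    intro a
    rw [xi_eq (by omega)]
    simp [hΞ, Polynomial.eval_finsetSum, hx]
  obtain ⟨u₁, hu₁, h₁⟩ := exists_unit_det_eval (fun k : Fin N => Ξ ^ k.val) x hx0 fun k => hpow k
  obtain ⟨u₂, hu₂, h₂⟩ := exists_unit_det_eval
    (fun k : Fin N => Ξ ^ k.val * (1 - Polynomial.X ^ (i + p * (N - 1 - k.val)))) x hx0 fun k => by
      have h3 : Ξ ^ k.val * (1 - Polynomial.X ^ (i + p * (N - 1 - k.val))) - Polynomial.X ^ k.val
          = (Ξ ^ k.val - Polynomial.X ^ k.val)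
            * (1 - Polynomial.X ^ (i + p * (N - 1 - k.val)))
            - Polynomial.X ^ k.val * Polynomial.X ^ (i + p * (N - 1 - k.val)) := by ring
      rw [h3]
      refine dvd_sub ((hpow k).mul_right _) ?_
      rw [← pow_add]
      exact pow_dvd_pow _ (by omega)
  have hV : (Matrix.vandermonde x).det ≠ 0 :=
    Matrix.det_vandermonde_ne_zero_iff.2 fun a b hab => hinj (congrArg Subtype.val hab)
  have hcast : ∀ M : Matrix (Fin N) (Fin N) O, ((M.det : O) : K) = (M.map fun t => (t : K)).det :=
    fun M => RingHom.map_det (algebraMap O K) M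
  have hdet := ratioDet_mul_det_vandermonde (x := fun a => chi p (y a))
    (f := fun a => y a ^ (i + p * (N - 1))) hξ
  have hL : (Matrix.vandermonde fun a => xi p (y a)).det
      = ((u₁ * (Matrix.vandermonde x).det : O) : K) := by
    rw [← h₁, hcast]
    congr 1
    ext a k
    simp [Matrix.vandermonde_apply, hev]
  have hRt : (Matrix.of fun a (k : Fin N) => xi p (y a) ^ k.val
      - y a ^ (i + p * (N - 1)) * chi p (y a) ^ k.val).det
      = ((u₂ * (Matrix.vandermonde x).det : O) : K) := by
    rw [← h₂, hcast]
    congr 1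
    ext a k
    have h4 : i + p * (N - 1) = i + p * (N - 1 - k.val) + p * k.val := by
      rw [add_assoc, ← mul_add]
      congr 2
      have := k.2
      omega
    have h5 : y a ^ (i + p * (N - 1)) * chi p (y a) ^ k.val
        = y a ^ (i + p * (N - 1 - k.val)) * xi p (y a) ^ k.val := by
      rw [h4, ← pow_mul_chi (by omega) (hy0 a), pow_add, pow_mul _ p k.val]
      ring
    simp only [Matrix.of_apply, Matrix.map_apply, h5, Polynomial.eval_mul, Polynomial.eval_pow,
      Polynomial.eval_sub, Polynomial.eval_one, Polynomial.eval_X]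
    push_cast
    rw [hev]
    simp only [hx]
    ring
  rw [hL, hRt] at hdet
  push_cast at hdet
  rw [← mul_assoc] at hdet
  have h6 := mul_right_cancel₀ (fun h0 => hV (Subtype.val_injective h0)) hdet
  have h7 := congrArg O.valuation h6
  have hv : ∀ u : O, IsUnit u → O.valuation (u : K) = 1 := fun u hu =>
    ValuationSubring.valuation_unit O hu.unit
  rwa [map_mul, hv _ hu₁, hv _ hu₂, mul_one] at h7

theorem RootData.valuation_vDet [IsAlgClosed K] (h : RootData p g R w wb) (hs : IsSmall O p g R)
    (hp : 2 ≤ p) (hℓ : 1 ≤ ℓ) (hR : R ≠ 0) (hsmall : ∀ a, O.valuation (root w wb a) < 1)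
    {i : ℕ} (hi : 1 ≤ i) : O.valuation (vDet w wb p i) = 1 := by
  rw [h.vDet_eq hs hp hℓ hR]
  exact valuation_ratioDet_chi_xi hp h.injective (h.injective_xi hs hp hℓ) ne_zero hsmall hi

end Orientation


/-! ### Supports of Laurent polynomials -/

section Support

variable {K : Type*} [Field K]

theorem coeff_C_mul (a : K) (f : K[T;T⁻¹]) (n : ℤ) :
    (LaurentPolynomial.C a * f).coeff n = a * f.coeff n := by
  have := coeff_C_mul_T_mul a 0 n f
  rwa [LaurentPolynomial.T_zero, mul_one, sub_zero] at this

/-- Laurent polynomials with exponents in a given set. -/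
def supportedIn (A : Set ℤ) : AddSubgroup K[T;T⁻¹] where
  carrier := {f | ∀ n, n ∉ A → f.coeff n = 0}
  add_mem' hf hg n hn := by
    rw [AddMonoidAlgebra.coeff_add, Finsupp.add_apply, hf n hn, hg n hn, add_zero]
  zero_mem' _ _ := rfl
  neg_mem' hf n hn := by
    rw [AddMonoidAlgebra.coeff_neg, Finsupp.neg_apply, hf n hn, neg_zero]

theorem supportedIn_mono {A B : Set ℤ} (h : A ⊆ B) :
    (supportedIn A : AddSubgroup K[T;T⁻¹]) ≤ supportedIn B :=
  fun _ hf n hn => hf n fun hn' => hn (h hn')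

theorem C_mul_mem_supportedIn {A : Set ℤ} (a : K) {f : K[T;T⁻¹]} (hf : f ∈ supportedIn A) :
    LaurentPolynomial.C a * f ∈ supportedIn A := fun n hn => by
  rw [coeff_C_mul, hf n hn, mul_zero]

theorem C_mul_T_mem_supportedIn {A : Set ℤ} (a : K) {n : ℤ} (hn : n ∈ A) :
    LaurentPolynomial.C a * LaurentPolynomial.T n ∈ supportedIn A := fun m hm => by
  rw [coeff_C_mul_T, if_neg]
  rintro rfl
  exact hm hn

theorem coeff_mul_eq_sum (f g : K[T;T⁻¹]) (m : ℤ) :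
    (f * g).coeff m = ∑ n ∈ f.coeff.support, f.coeff n * g.coeff (m - n) := by
  have hf : f = ∑ n ∈ f.coeff.support,
      LaurentPolynomial.C (f.coeff n) * LaurentPolynomial.T n := by
    refine AddMonoidAlgebra.coeff_injective (Finsupp.ext fun k => ?_)
    rw [AddMonoidAlgebra.coeff_sum, Finsupp.finsetSum_apply]
    simp only [coeff_C_mul_T]
    rw [Finset.sum_ite_eq]
    split_ifs with h
    · rfl
    · exact Finsupp.notMem_support_iff.1 h
  conv_lhs => rw [hf, Finset.sum_mul]
  rw [AddMonoidAlgebra.coeff_sum, Finsupp.finsetSum_apply]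
  exact Finset.sum_congr rfl fun n _ => coeff_C_mul_T_mul _ _ _ _

theorem mul_mem_supportedIn {A B C : Set ℤ} {f g : K[T;T⁻¹]} (hf : f ∈ supportedIn A)
    (hg : g ∈ supportedIn B) (h : ∀ a ∈ A, ∀ b ∈ B, a + b ∈ C) : f * g ∈ supportedIn C := by
  intro m hm
  rw [coeff_mul_eq_sum]
  refine Finset.sum_eq_zero fun n _ => ?_
  by_cases hn : n ∈ A
  · rw [hg (m - n) fun hb => hm (by simpa using h n hn _ hb), mul_zero]
  · rw [hf n hn, zero_mul]

theorem coeff_mul_low {a b : ℤ} {f g : K[T;T⁻¹]} (hf : f ∈ supportedIn (Set.Ici a))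
    (hg : g ∈ supportedIn (Set.Ici b)) : (f * g).coeff (a + b) = f.coeff a * g.coeff b := by
  rw [coeff_mul_eq_sum]
  by_cases ha : a ∈ f.coeff.support
  · rw [Finset.sum_eq_single_of_mem a ha, add_sub_cancel_left]
    intro n _ hn
    rcases lt_or_gt_of_ne hn with h | h
    · rw [hf n (by simpa using h), zero_mul]
    · rw [hg (a + b - n) (by simp only [Set.mem_Ici]; omega), mul_zero]
  · rw [Finsupp.notMem_support_iff.1 ha, zero_mul]
    refine Finset.sum_eq_zero fun n hn => ?_
    have hna : n ≠ a := fun h => ha (h ▸ hn)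
    rcases lt_or_gt_of_ne hna with h | h
    · rw [hf n (by simpa using h), zero_mul]
    · rw [hg (a + b - n) (by simp only [Set.mem_Ici]; omega), mul_zero]

/-- Laurent polynomials with `N` exponents in arithmetic progression. -/
def progPoly (p N : ℕ) (c : ℕ → K) (j : ℤ) : K[T;T⁻¹] :=
  ∑ k ∈ Finset.range N, LaurentPolynomial.C (c k) * LaurentPolynomial.T (j + p * k)

theorem progPoly_mem {p N : ℕ} {c : ℕ → K} {j : ℤ} {A : Set ℤ}
    (h : ∀ k < N, j + (p : ℤ) * k ∈ A) : progPoly p N c j ∈ supportedIn A :=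
  sum_mem fun k hk => C_mul_T_mem_supportedIn _ (h k (Finset.mem_range.1 hk))

theorem coeff_progPoly {p N : ℕ} (hp : 0 < p) {c : ℕ → K} {j : ℤ} {k : ℕ} (hk : k < N) :
    (progPoly p N c j).coeff (j + p * k) = c k := by
  rw [progPoly, AddMonoidAlgebra.coeff_sum, Finsupp.finsetSum_apply,
    Finset.sum_eq_single_of_mem k (Finset.mem_range.2 hk)]
  · rw [coeff_C_mul_T, if_pos rfl]
  · intro k' _ hne
    rw [coeff_C_mul_T, if_neg]
    intro h
    have h1 : (p : ℤ) * k = p * k' := by linarith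
    exact hne (by exact_mod_cast (mul_left_cancel₀ (by omega : (p : ℤ) ≠ 0) h1).symm)

theorem coeff_progPoly_zero {p N : ℕ} (hp : 0 < p) {c : ℕ → K} {j : ℤ} (hN : 0 < N) :
    (progPoly p N c j).coeff j = c 0 := by
  have := coeff_progPoly (c := c) (j := j) hp hN
  simpa using this

theorem eq_progPoly {p N : ℕ} (hp : 0 < p) {j : ℤ} {f : K[T;T⁻¹]}
    (hf : f ∈ supportedIn {n : ℤ | ∃ k : ℕ, k < N ∧ n = j + p * k}) :
    f = progPoly p N (fun k => f.coeff (j + p * k)) j := by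
  refine AddMonoidAlgebra.coeff_injective (Finsupp.ext fun n => ?_)
  by_cases h : ∃ k : ℕ, k < N ∧ n = j + p * k
  · obtain ⟨k, hk, rfl⟩ := h
    rw [coeff_progPoly hp hk]
  · rw [hf n h]
    refine (progPoly_mem (A := {n : ℤ | ∃ k : ℕ, k < N ∧ n = j + p * k}) ?_ n h).symm
    exact fun k hk => ⟨k, hk, rfl⟩

/-- The two terms of Y send the progression to progressions starting at j and j + p, which overlap
except at one exponent on each side. -/
theorem curveY_mul_progPoly (p N : ℕ) (R : K) (c : ℕ → K) (j : ℤ) :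
    curveY p R * progPoly p (N + 1) c (j + 1) = LaurentPolynomial.C (R * c 0) * LaurentPolynomial.T j
      + progPoly p N (fun k => R * c (k + 1) + c k) (j + p)
      + LaurentPolynomial.C (c N) * LaurentPolynomial.T (j + p * (N + 1)) := by
  have h1 : ∀ (a : K) (n : ℤ), curveY p R * (LaurentPolynomial.C a * LaurentPolynomial.T n)
      = LaurentPolynomial.C (R * a) * LaurentPolynomial.T (n - 1)
        + LaurentPolynomial.C a * LaurentPolynomial.T (n - 1 + p) := by
    intro a n
    rw [curveY, map_mul, sub_eq_add_neg n 1, show n + -1 + (p : ℤ) = (p - 1) + n by ring,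
      LaurentPolynomial.T_add, LaurentPolynomial.T_add]
    ring
  rw [progPoly, Finset.mul_sum]
  simp only [h1]
  rw [Finset.sum_add_distrib, Finset.sum_range_succ', Finset.sum_range_succ (n := N), progPoly]
  have h2 : ∀ k ∈ Finset.range N, LaurentPolynomial.C (R * c (k + 1) + c k)
        * LaurentPolynomial.T (j + p + p * k)
      = LaurentPolynomial.C (R * c (k + 1))
          * LaurentPolynomial.T (j + 1 + (p : ℤ) * ((k + 1 : ℕ) : ℤ) - 1)
        + LaurentPolynomial.C (c k) * LaurentPolynomial.T (j + 1 + (p : ℤ) * k - 1 + p) := by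
    intro k _
    rw [map_add, add_mul]
    congr 3 <;> push_cast <;> ring
  rw [Finset.sum_congr rfl h2, Finset.sum_add_distrib]
  have h3 : j + 1 + (p : ℤ) * ((0 : ℕ) : ℤ) - 1 = j := by simp
  have h4 : j + 1 + (p : ℤ) * N - 1 + p = j + p * (N + 1) := by ring
  rw [h3, h4]
  ring

theorem progPoly_sub (p N : ℕ) (c c' : ℕ → K) (j : ℤ) :
    progPoly p N c j - progPoly p N c' j = progPoly p N (fun k => c k - c' k) j := by
  simp only [progPoly, ← Finset.sum_sub_distrib, map_sub, sub_mul]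

theorem progPoly_C_mul (p N : ℕ) (a : K) (c : ℕ → K) (j : ℤ) :
    LaurentPolynomial.C a * progPoly p N c j = progPoly p N (fun k => a * c k) j := by
  simp only [progPoly, Finset.mul_sum, map_mul, mul_assoc]

theorem progPoly_succ (p N : ℕ) (c : ℕ → K) (j : ℤ) : progPoly p (N + 1) c j
    = progPoly p N c j + LaurentPolynomial.C (c N) * LaurentPolynomial.T (j + p * N) :=
  Finset.sum_range_succ _ _

theorem progPoly_succ' (p N : ℕ) (c : ℕ → K) (j : ℤ) : progPoly p (N + 1) c j
    = LaurentPolynomial.C (c 0) * LaurentPolynomial.T j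
      + progPoly p N (fun k => c (k + 1)) (j + p) := by
  rw [progPoly, Finset.sum_range_succ', add_comm, progPoly]
  congr 1
  · simp
  · refine Finset.sum_congr rfl fun k _ => ?_
    congr 2
    push_cast
    ring

end Support

/-! ### Recursion for the determinants -/

section Glued

variable {K : Type*} [Field K] {N : ℕ}

/-- Laurent polynomials that take the same value at the two elements of each pair. -/
def glued (w wb : Fin N → Kˣ) : Subring K[T;T⁻¹] :=
  ⨅ a, RingHom.eqLocus (LaurentPolynomial.eval₂ (RingHom.id K) (w a))
    (LaurentPolynomial.eval₂ (RingHom.id K) (wb a))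

theorem mem_glued {w wb : Fin N → Kˣ} {f : K[T;T⁻¹]} : f ∈ glued w wb ↔
    ∀ a, LaurentPolynomial.eval₂ (RingHom.id K) (w a) f
      = LaurentPolynomial.eval₂ (RingHom.id K) (wb a) f := by
  simp [glued, Subring.mem_iInf, RingHom.mem_eqLocus]

theorem C_mem_glued (w wb : Fin N → Kˣ) (a : K) : LaurentPolynomial.C a ∈ glued w wb :=
  mem_glued.2 fun _ => by rw [LaurentPolynomial.eval₂_C, LaurentPolynomial.eval₂_C]

theorem eval_progPoly (p M : ℕ) (c : ℕ → K) (j : ℕ) (u : Kˣ) :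
    LaurentPolynomial.eval₂ (RingHom.id K) u (progPoly p M c j)
      = ∑ k ∈ Finset.range M, c k * (u : K) ^ (j + p * k) := by
  rw [progPoly, map_sum]
  refine Finset.sum_congr rfl fun k _ => ?_
  rw [LaurentPolynomial.eval₂_C_mul_T]
  have : (j : ℤ) + p * k = ((j + p * k : ℕ) : ℤ) := by push_cast; ring
  rw [this, zpow_natCast]
  simp

/-- Agreement at the N pairs is a square linear system in the N coefficients, with determinant
`pairDet`. -/
theorem eq_zero_of_mem_glued {p : ℕ} {w wb : Fin N → Kˣ} {j : ℕ} (hV : pairDet p w wb j ≠ 0)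
    {c : ℕ → K} (h : progPoly p N c j ∈ glued w wb) : progPoly p N c j = 0 := by
  have h1 : ∀ k : Fin N, c k.val = 0 := by
    have h2 := Matrix.eq_zero_of_mulVec_eq_zero hV (v := fun k : Fin N => c k.val) (by
      ext a
      have h3 := mem_glued.1 h a
      rw [eval_progPoly, eval_progPoly, Finset.sum_range, Finset.sum_range] at h3
      rw [Matrix.mulVec, Pi.zero_apply, dotProduct]
      simp only [Matrix.of_apply, sub_mul]
      rw [Finset.sum_sub_distrib, sub_eq_zero]
      simp only [mul_comm _ (c _)]
      exact h3.symm)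
    exact fun k => congrFun h2 k
  refine Finset.sum_eq_zero fun k hk => ?_
  rw [h1 ⟨k, Finset.mem_range.1 hk⟩, map_zero, zero_mul]

/-- Coefficients of the glued polynomial of minimal degree. -/
theorem exists_glued {p : ℕ} (w wb : Fin N → Kˣ) {j : ℕ} (hV : pairDet p w wb j ≠ 0) :
    ∃ e : ℕ → K, progPoly p (N + 1) e j ∈ glued w wb ∧ e N = 1 ∧
      e 0 * pairDet p w wb j = (-1) ^ N * pairDet p w wb (j + p) := by
  set M : Fin N → Fin (N + 1) → K := fun a k =>
    (wb a : K) ^ (j + p * k.val) - (w a : K) ^ (j + p * k.val) with hM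
  set D : Fin (N + 1) → K := fun k => (Matrix.of fun a (c : Fin N) => M a (k.succAbove c)).det with hD
  have hDlast : D (Fin.last N) = pairDet p w wb j := by
    simp [hD, hM, pairDet]
  have hD0 : D 0 = pairDet p w wb (j + p) := by
    simp only [hD, hM, pairDet]
    congr 1
    ext a c
    simp only [Matrix.of_apply, Fin.zero_succAbove, Fin.val_succ]
    rw [show j + p * (c.val + 1) = j + p + p * c.val by ring]
  -- Row a is repeated on top of M. Expanding the vanishing determinant along it shows that the
  -- maximal minors solve the N equations in N + 1 unknowns.
  have hsum : ∀ a, ∑ k : Fin (N + 1), (-1) ^ k.val * M a k * D k = 0 := by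
    intro a
    have h1 := Matrix.det_succ_row_zero (Matrix.of (Fin.cons (M a) M : Fin (N + 1) → Fin (N + 1) → K))
    rw [Matrix.det_zero_of_row_eq (i := 0) (j := a.succ) (Fin.succ_ne_zero a).symm
      (by ext k; simp)] at h1
    rw [h1]
    refine Finset.sum_congr rfl fun k _ => ?_
    rfl
  refine ⟨fun k => if h : k < N + 1 then (-1) ^ (k + N) * D ⟨k, h⟩ / pairDet p w wb j else 0,
    ?_, ?_, ?_⟩
  · rw [mem_glued]
    intro a
    rw [eval_progPoly, eval_progPoly, Finset.sum_range, Finset.sum_range, ← sub_eq_zero,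
      ← Finset.sum_sub_distrib, ← mul_zero (-((-1) ^ N / pairDet p w wb j)), ← hsum a,
      Finset.mul_sum]
    refine Finset.sum_congr rfl fun k _ => ?_
    rw [dif_pos k.2]
    simp only [hM]
    rw [pow_add (-1 : K)]
    ring
  · refine (dif_pos (Nat.lt_succ_self N)).trans ?_
    change (-1) ^ (N + N) * D (Fin.last N) / _ = 1
    rw [hDlast, ← two_mul, pow_mul, neg_one_sq, one_pow, one_mul, div_self hV]
  · refine (congrArg (· * _) (dif_pos (Nat.succ_pos N))).trans ?_
    change (-1) ^ (0 + N) * D 0 / _ * _ = _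
    rw [zero_add, hD0, div_mul_cancel₀ _ hV]

end Glued


/-! ### Solution of the recursion -/

section BakerAkhiezer

variable {K : Type*} [Field K] {p ℓ N : ℕ} {g : Fin ℓ → K} {R : K}

/-- The nonpositive parts cancel by `coeff_curveX_of_nonpos`, all exponents are 1 modulo p, and the
equation of R says that the coefficient of z is 1/R. -/
theorem curveX_sub_mem (hp : 1 ≤ p) (hR : R * (1 - ∑ k : Fin ℓ, g k
      * pathSeries p R (p * (k.val + 1) - 1) 1) = 1) :
    curveX p g R - ∑ k : Fin ℓ, LaurentPolynomial.C (g k) * curveY p R ^ (p * (k.val + 1) - 1)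
      ∈ supportedIn {n : ℤ | 1 ≤ n ∧ (p : ℤ) ∣ n - 1} ∧
    R * (curveX p g R - ∑ k : Fin ℓ, LaurentPolynomial.C (g k)
      * curveY p R ^ (p * (k.val + 1) - 1)).coeff 1 = 1 := by
  have hc : ∀ n, (curveX p g R - ∑ k : Fin ℓ, LaurentPolynomial.C (g k)
      * curveY p R ^ (p * (k.val + 1) - 1)).coeff n = (curveX p g R).coeff n
        - ∑ k : Fin ℓ, g k * pathSeries p R (p * (k.val + 1) - 1) n := by
    intro n
    rw [AddMonoidAlgebra.coeff_sub, Finsupp.sub_apply, AddMonoidAlgebra.coeff_sum,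
      Finsupp.finsetSum_apply]
    simp only [coeff_C_mul]
    rfl
  constructor
  · intro n hn
    rw [hc]
    by_cases h0 : n ≤ 0
    · rw [coeff_curveX_of_nonpos hp _ _ h0, sub_self]
    · have hd : ¬ (p : ℤ) ∣ n - 1 := fun h => hn ⟨by omega, h⟩
      rw [coeff_curveX, if_neg (by rintro rfl; simp at hd), zero_add, Finset.sum_eq_zero,
        Finset.sum_eq_zero, sub_zero]
      · intro k _
        rw [pathSeries_eq_zero hp, mul_zero]
        rintro ⟨h, -⟩
        have h1 : 1 ≤ p * (k.val + 1) := Nat.mul_pos hp (Nat.succ_pos _)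
        push_cast [Nat.cast_sub h1] at h
        refine hd ?_
        have h2 : n - 1 = (n + (p * (k.val + 1) - 1)) - p * (k.val + 1) := by ring
        rw [h2]
        exact dvd_sub h (dvd_mul_right _ _)
      · intro j _
        rw [if_neg]
        rintro rfl
        exact hd ⟨-j, by ring⟩
  · rw [hc, coeff_curveX, if_pos rfl, Finset.sum_eq_zero, add_zero, hR]
    intro j hj
    rw [if_neg]
    have h1 := (Finset.mem_Icc.1 hj).1
    have h2 : (1 : ℤ) ≤ p * j := by exact_mod_cast Nat.mul_pos hp h1
    omega

theorem curveX_eq_T_add (hp : 1 ≤ p) : ∃ f : K[T;T⁻¹],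
    curveX p g R = LaurentPolynomial.T 1 + f ∧ f ∈ supportedIn (Set.Iic (1 - (p : ℤ))) := by
  refine ⟨_, rfl, sum_mem fun j hj => C_mul_T_mem_supportedIn _ ?_⟩
  have h1 : (1 : ℤ) ≤ j := by exact_mod_cast (Finset.mem_Icc.1 hj).1
  have h2 : (p : ℤ) * 1 ≤ p * j := mul_le_mul_of_nonneg_left h1 (by omega)
  simp only [Set.mem_Iic]
  linarith

theorem curveY_pow_mem (hp : 1 ≤ p) (L : ℕ) :
    curveY p R ^ L ∈ supportedIn (Set.Iic (((p : ℤ) - 1) * L)) := by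
  induction L with
  | zero =>
    rw [pow_zero, ← LaurentPolynomial.T_zero, ← one_mul (LaurentPolynomial.T 0),
      ← map_one (LaurentPolynomial.C)]
    exact C_mul_T_mem_supportedIn _ (by simp)
  | succ L ih =>
    rw [pow_succ]
    refine mul_mem_supportedIn ih (B := Set.Iic ((p : ℤ) - 1)) ?_ ?_
    · rw [curveY, ← one_mul (LaurentPolynomial.T ((p : ℤ) - 1)), ← map_one (LaurentPolynomial.C)]
      refine add_mem (C_mul_T_mem_supportedIn _ ?_) (C_mul_T_mem_supportedIn _ ?_)
      · simp only [Set.mem_Iic]; omega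
      · simp
    · intro a ha b hb
      simp only [Set.mem_Iic] at *
      push_cast
      linarith

/-- Laurent polynomials `E_i = l_i z ^ (i + 1) + ⋯ + z ^ (i + 1 + pN)` on which multiplication by
`Y` acts as a two-term operator. -/
structure IsWave (p N : ℕ) (R : K) (r : ℤ → K) (e : ℕ → ℕ → K) : Prop where
  last : ∀ i, e i N = 1
  first : ∀ i, e i 0 ≠ 0
  mul_first : ∀ i : ℕ, r (i + 1) * e i 0 = R * e (i + 1) 0
  step : ∀ i : ℕ, curveY p R * progPoly p (N + 1) (e (i + 1)) (i + 2)
    = LaurentPolynomial.C (r (i + 1)) * progPoly p (N + 1) (e i) (i + 1)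
      + progPoly p (N + 1) (e (i + p)) (i + p + 1)
  step_zero : curveY p R * progPoly p (N + 1) (e 0) 1
    = LaurentPolynomial.C (R * e 0 0) + progPoly p (N + 1) (e (p - 1)) p

/-- In Y E_{i+1} - r_{i+1} E_i - E_{i+p} the lowest terms cancel by the choice of r and the highest
by normalization. What remains agrees at all pairs and has only N exponents in progression, so it
vanishes. -/
theorem exists_isWave (hp : 1 ≤ p) {w wb : Fin N → Kˣ} (hY : curveY p R ∈ glued w wb)
    (hV : ∀ j, 1 ≤ j → pairDet p w wb j ≠ 0) (r : ℤ → K)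
    (hr : ∀ i : ℕ, r (i + 1) = R * (pairDet p w wb (i + 1) * pairDet p w wb (i + p + 2))
      / (pairDet p w wb (i + 2) * pairDet p w wb (i + p + 1))) :
    ∃ e : ℕ → ℕ → K, IsWave p N R r e ∧
      ∀ i : ℕ, progPoly p (N + 1) (e i) (i + 1) ∈ glued w wb := by
  have hex := fun i : ℕ => exists_glued w wb (hV (i + 1) (by omega))
  choose e he hlast h0 using hex
  have hE : ∀ i : ℕ, progPoly p (N + 1) (e i) (i + 1) ∈ glued w wb := fun i => by
    have := he i
    push_cast at this
    exact this
  have hmul : ∀ i : ℕ, r (i + 1) * e i 0 = R * e (i + 1) 0 := by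
    intro i
    have h1 := h0 i
    have h2 := h0 (i + 1)
    have v1 := hV (i + 1) (by omega)
    have v2 := hV (i + 2) (by omega)
    have v3 := hV (i + p + 1) (by omega)
    rw [show i + 1 + p = i + p + 1 by ring] at h1
    rw [show i + 1 + 1 = i + 2 by ring, show i + 2 + p = i + p + 2 by ring] at h2
    rw [hr, div_mul_eq_mul_div, div_eq_iff (mul_ne_zero v2 v3)]
    linear_combination (R * pairDet p w wb (i + p + 2)) * h1 - (R * pairDet p w wb (i + p + 1)) * h2
  refine ⟨e, ⟨hlast, fun i h => ?_, hmul, fun i => ?_, ?_⟩, hE⟩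
  · have h1 := h0 i
    rw [h, zero_mul] at h1
    exact mul_ne_zero (pow_ne_zero _ (neg_ne_zero.2 one_ne_zero)) (hV _ (by omega)) h1.symm
  · have h1 : curveY p R * progPoly p (N + 1) (e (i + 1)) (i + 2)
          - LaurentPolynomial.C (r (i + 1)) * progPoly p (N + 1) (e i) (i + 1)
          - progPoly p (N + 1) (e (i + p)) (i + p + 1)
        = progPoly p N (fun k => R * e (i + 1) (k + 1) + e (i + 1) k - r (i + 1) * e i (k + 1)
          - e (i + p) k) ((i + 1 + p : ℕ) : ℤ) := by
      rw [← progPoly_sub, ← progPoly_sub, show (i : ℤ) + 2 = (i + 1) + 1 by ring,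
        curveY_mul_progPoly, progPoly_C_mul, progPoly_succ', progPoly_succ, hlast, hlast, hmul,
        show (i : ℤ) + p + 1 = i + 1 + p by ring,
        show (i : ℤ) + 1 + p + p * N = i + 1 + p * (N + 1) by ring]
      push_cast
      ring
    have h2 := eq_zero_of_mem_glued (hV (i + 1 + p) (by omega)) (h1 ▸ sub_mem (sub_mem
      (mul_mem hY (by have := hE (i + 1); push_cast at this; rwa [add_assoc] at this))
      (mul_mem (C_mem_glued _ _ _) (hE i))) (by have := hE (i + p); push_cast at this; exact this))
    rw [h2] at h1
    linear_combination h1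
  -- At label 0 the lowest term is a constant, which already agrees at all pairs, so it is
  -- subtracted as it is.
  · have h1 : curveY p R * progPoly p (N + 1) (e 0) 1 - LaurentPolynomial.C (R * e 0 0)
          - progPoly p (N + 1) (e (p - 1)) p
        = progPoly p N (fun k => R * e 0 (k + 1) + e 0 k - e (p - 1) k) ((p : ℕ) : ℤ) := by
      rw [← progPoly_sub, show (1 : ℤ) = 0 + 1 by ring, curveY_mul_progPoly, progPoly_succ, hlast,
        hlast, LaurentPolynomial.T_zero, zero_add, zero_add, mul_add_one, add_comm (p : ℤ)]
      ring
    have h2 := eq_zero_of_mem_glued (hV p hp) (h1 ▸ sub_mem (sub_mem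
      (mul_mem hY (by have := hE 0; simpa using this))
      (C_mem_glued _ _ _)) (by
        have := hE (p - 1)
        rwa [Nat.cast_sub hp, Nat.cast_one, sub_add_cancel] at this))
    rw [h2] at h1
    linear_combination h1

/-- Iterating the two-term relation sums over weighted paths. The relation fails only at height 0,
where a constant stands in place of r_0 E_{-1}; the multiples of this constant by later powers of Y
obey the degree bound. `M` exceeds every height that a path of length L can reach, so no path is
lost. -/
theorem IsWave.pow_mul_sub_mem {r : ℤ → K} {e : ℕ → ℕ → K} (h : IsWave p N R r e) (hp : 1 ≤ p)
    (hr0 : ∀ i ≤ 0, r i = 0) (M L i : ℕ) (hM : i + L * (p - 1) < M) :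
    curveY p R ^ L * progPoly p (N + 1) (e i) (i + 1)
      - ∑ j ∈ Finset.range M, LaurentPolynomial.C (pathWeight p r L i j)
        * progPoly p (N + 1) (e j) (j + 1)
      ∈ supportedIn (Set.Iic (((p : ℤ) - 1) * (L - 1))) := by
  induction L generalizing i with
  | zero =>
    rw [pow_zero, one_mul, Finset.sum_eq_single_of_mem i (Finset.mem_range.2 (by omega))]
    · rw [pathWeight, if_pos rfl, map_one, one_mul, sub_self]
      exact zero_mem _
    · intro j _ hj
      rw [pathWeight, if_neg (by exact_mod_cast hj.symm), map_zero, zero_mul]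
  | succ L ih =>
    have hM' : i + L * (p - 1) + (p - 1) < M := by rw [Nat.succ_mul] at hM; omega
    have hmono : (supportedIn (Set.Iic (((p : ℤ) - 1) * (L - 1))) : AddSubgroup K[T;T⁻¹])
        ≤ supportedIn (Set.Iic (((p : ℤ) - 1) * ((L + 1 : ℕ) - 1))) := by
      refine supportedIn_mono (Set.Iic_subset_Iic.2 ?_)
      push_cast
      nlinarith
    have hS : ∑ j ∈ Finset.range M, LaurentPolynomial.C (pathWeight p r (L + 1) i j)
          * progPoly p (N + 1) (e j) (j + 1)
        = LaurentPolynomial.C (r i) * ∑ j ∈ Finset.range M,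
            LaurentPolynomial.C (pathWeight p r L (i - 1) j) * progPoly p (N + 1) (e j) (j + 1)
          + ∑ j ∈ Finset.range M, LaurentPolynomial.C (pathWeight p r L ((i + (p - 1) : ℕ) : ℤ) j)
            * progPoly p (N + 1) (e j) (j + 1) := by
      rw [Finset.mul_sum, ← Finset.sum_add_distrib]
      refine Finset.sum_congr rfl fun j _ => ?_
      rw [pathWeight, map_add, map_mul, Nat.cast_add, Nat.cast_sub hp, Nat.cast_one]
      ring
    have h2 := ih (i + (p - 1)) (by omega)
    rw [hS, pow_succ, mul_assoc]
    rcases Nat.eq_zero_or_pos i with rfl | hi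
    · rw [Nat.cast_zero, zero_add, hr0 0 le_rfl, map_zero, zero_mul, zero_add, h.step_zero, mul_add,
        add_sub_assoc]
      refine add_mem ?_ (hmono ?_)
      · rw [mul_comm (curveY p R ^ L)]
        refine C_mul_mem_supportedIn _ ?_
        have := curveY_pow_mem (R := R) hp L
        simpa using this
      · have h6 : ((0 + (p - 1) : ℕ) : ℤ) = (p : ℤ) - 1 := by
          rw [zero_add, Nat.cast_sub hp, Nat.cast_one]
        rw [h6, sub_add_cancel, zero_add (p - 1)] at h2
        rw [h6]
        exact h2
    · obtain ⟨n, rfl⟩ : ∃ n, i = n + 1 := ⟨i - 1, by omega⟩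
      have h1 := ih n (by omega)
      have h3 := hmono (add_mem (C_mul_mem_supportedIn (r (n + 1)) h1) h2)
      have hst := h.step n
      have h4 : n + 1 + (p - 1) = n + p := by omega
      rw [h4] at h3 ⊢
      rw [show ((n + 1 : ℕ) : ℤ) = (n : ℤ) + 1 from Nat.cast_succ n, add_sub_cancel_right,
        show (n : ℤ) + 1 + 1 = n + 2 by ring, hst]
      rw [show ((n + p : ℕ) : ℤ) + 1 = n + p + 1 by push_cast; ring] at h3
      convert h3 using 1
      ring

/-- Expands X E_i in two ways: near the lowest exponent, where X may be replaced by its part U of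
positive exponents plus weighted paths, and near the highest, where X is z up to lower order. The
combination B is squeezed between the two bounds, hence vanishes, and its coefficient of z^{i+2} is
the recursion. -/
theorem IsWave.mul_one_sub_vertexSum {r : ℤ → K} {e : ℕ → ℕ → K} (h : IsWave p N R r e)
    (hp : 2 ≤ p) (hN : N + 1 = (p - 1) * ℓ) (hr0 : ∀ i ≤ 0, r i = 0)
    (hR : R * (1 - ∑ k : Fin ℓ, g k * pathSeries p R (p * (k.val + 1) - 1) 1) = 1)
    {w wb : Fin N → Kˣ} (hX : curveX p g R ∈ glued w wb) (hY : curveY p R ∈ glued w wb)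
    (hV : ∀ j, 1 ≤ j → pairDet p w wb j ≠ 0)
    (hE : ∀ i : ℕ, progPoly p (N + 1) (e i) (i + 1) ∈ glued w wb) (i : ℕ) :
    r (i + 1) * (1 - vertexSum p g r i (i + 1)) = 1 := by
  set E : ℕ → K[T;T⁻¹] := fun i => progPoly p (N + 1) (e i) (i + 1) with hEdef
  set len : Fin ℓ → ℕ := fun k => p * (k.val + 1) - 1 with hlen
  have hlen' : ∀ k, (len k : ℤ) = p * (k.val + 1) - 1 := fun k => by
    have : 1 ≤ p * (k.val + 1) := Nat.mul_pos (by omega) (Nat.succ_pos _)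
    simp only [hlen]
    push_cast [this]; ring
  set M := i + p * ℓ * (p - 1) + 2 with hM
  set D : Fin ℓ → K[T;T⁻¹] := fun k => curveY p R ^ len k * E i
    - ∑ j ∈ Finset.range M, LaurentPolynomial.C (pathWeight p r (len k) i j) * E j with hD
  have hDmem : ∀ k, D k ∈ supportedIn (Set.Iic ((i : ℤ) + 2 + p * ((N : ℤ) - 1))) := by
    intro k
    have hk : k.val + 1 ≤ ℓ := k.2
    have hk2 : p * (k.val + 1) ≤ p * ℓ := Nat.mul_le_mul_left _ hk
    refine supportedIn_mono (Set.Iic_subset_Iic.2 ?_)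
      (h.pow_mul_sub_mem (by omega) hr0 M (len k) i ?_)
    -- The degree bound is just sufficient: as N + 1 = (p - 1)ℓ, (p - 1)(pℓ - 2) = 2 + p(N - 1).
    · have h1 : ((N : ℤ) + 1) = (p - 1) * ℓ := by
        have := congrArg (Nat.cast (R := ℤ)) hN
        rwa [Nat.cast_mul, Nat.cast_sub (by omega), Nat.cast_succ, Nat.cast_one] at this
      rw [hlen', show (N : ℤ) - 1 = (p - 1) * ℓ - 2 by linarith]
      have h2 : (p : ℤ) * (k.val + 1) ≤ p * ℓ := by exact_mod_cast hk2
      have h3 : (0 : ℤ) ≤ (p : ℤ) - 1 := by omega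
      nlinarith [mul_le_mul_of_nonneg_left h2 h3]
    · have h1 : len k * (p - 1) ≤ p * ℓ * (p - 1) := by
        refine Nat.mul_le_mul_right _ ?_
        simp only [hlen]; omega
      omega
  set m : ℕ → K := fun j => vertexSum p g r i j with hm
  have hm0 : ∀ j : ℕ, ¬ (p : ℤ) ∣ (j : ℤ) - (i + 1) → m j = 0 := by
    intro j hj
    refine Finset.sum_eq_zero fun k _ => ?_
    rw [pathWeight_eq_zero (by omega), mul_zero]
    rintro ⟨hd, -⟩
    refine hj ?_
    have h2 : (j : ℤ) - (i + 1) = ((j : ℤ) - i + len k) - p * (k.val + 1) := by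
      rw [hlen']; ring
    rw [h2]
    exact dvd_sub hd (dvd_mul_right _ _)
  have hsumD : ∑ k, LaurentPolynomial.C (g k) * D k
      = (∑ k, LaurentPolynomial.C (g k) * curveY p R ^ len k) * E i
        - ∑ j ∈ Finset.range M, LaurentPolynomial.C (m j) * E j := by
    simp only [hD, hm, vertexSum, map_sum, map_mul, mul_sub, Finset.sum_sub_distrib, Finset.sum_mul,
      Finset.mul_sum, mul_assoc]
    congr 1
    exact Finset.sum_comm
  set U : K[T;T⁻¹] := curveX p g R - ∑ k, LaurentPolynomial.C (g k) * curveY p R ^ len k with hU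
  -- The subtracted terms with j ≤ i remove what would lie below z^{i+2}. Those with j > i stay, as
  -- seen in `hB2`.
  set B : K[T;T⁻¹] := curveX p g R * E i - ∑ k, LaurentPolynomial.C (g k) * D k - E (i + 1)
    - ∑ j ∈ Finset.range (i + 1), LaurentPolynomial.C (m j) * E j with hB
  have hrange : ∑ j ∈ Finset.range M, LaurentPolynomial.C (m j) * E j
      = ∑ j ∈ Finset.range (i + 1), LaurentPolynomial.C (m j) * E j
        + ∑ j ∈ Finset.Ico (i + 1) M, LaurentPolynomial.C (m j) * E j :=
    (Finset.sum_range_add_sum_Ico _ (by omega)).symm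
  have hB2 : B = U * E i + ∑ j ∈ Finset.Ico (i + 1) M, LaurentPolynomial.C (m j) * E j
      - E (i + 1) := by
    rw [hB, hsumD, hrange, hU]
    ring
  obtain ⟨hUmem, hU1⟩ := curveX_sub_mem (p := p) (g := g) (R := R) (by omega) hR
  change U ∈ _ at hUmem
  change R * U.coeff 1 = 1 at hU1
  have hBglued : B ∈ glued w wb := by
    have hC := C_mem_glued w wb
    refine sub_mem (sub_mem (sub_mem (mul_mem hX (hE i)) (sum_mem fun k _ => mul_mem (hC _)
      (sub_mem (mul_mem (pow_mem hY _) (hE i)) (sum_mem fun j _ => mul_mem (hC _) (hE j)))))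
      (by have := hE (i + 1); exact this)) (sum_mem fun j _ => mul_mem (hC _) (hE j))
  have hElow : ∀ j : ℕ, E j ∈ supportedIn {n : ℤ | (j : ℤ) + 1 ≤ n ∧ (p : ℤ) ∣ n - (j + 1)} :=
    fun j => progPoly_mem fun k _ => ⟨le_add_of_nonneg_right (by positivity), ⟨k, by ring⟩⟩
  have hEup : ∀ j : ℕ, E j ∈ supportedIn (Set.Iic ((j : ℤ) + 1 + p * N)) := fun j =>
    progPoly_mem fun k hk => by
      have h1 : (k : ℤ) ≤ N := by omega
      have h2 : (p : ℤ) * k ≤ p * N := mul_le_mul_of_nonneg_left h1 (by omega)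
      simp only [Set.mem_Iic]
      linarith
  have hElow' : ∀ j : ℕ, E j ∈ supportedIn (Set.Ici ((j : ℤ) + 1)) := fun j =>
    supportedIn_mono (fun n hn => hn.1) (hElow j)
  have hElead : ∀ j : ℕ, (E j).coeff ((j : ℤ) + 1) = e j 0 := fun j =>
    coeff_progPoly_zero (by omega) (Nat.succ_pos N)
  have hBlow : B ∈ supportedIn {n : ℤ | (i : ℤ) + 2 ≤ n ∧ (p : ℤ) ∣ n - (i + 2)} := by
    rw [hB2]
    refine sub_mem (add_mem ?_ (sum_mem fun j hj => ?_)) ?_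
    · refine mul_mem_supportedIn hUmem (hElow i) fun a ha b hb => ⟨?_, ?_⟩
      · have h1 := ha.1; have h2 := hb.1; omega
      · have h1 : a + b - (i + 2) = (a - 1) + (b - (i + 1)) := by ring
        rw [h1]
        exact dvd_add ha.2 hb.2
    · by_cases hd : (p : ℤ) ∣ (j : ℤ) - (i + 1)
      · refine C_mul_mem_supportedIn _ (supportedIn_mono ?_ (hElow j))
        intro n hn
        refine ⟨?_, ?_⟩
        · have h1 := hn.1
          have h2 := (Finset.mem_Ico.1 hj).1
          omega
        · have h1 : n - ((i : ℤ) + 2) = (n - (j + 1)) + (j - (i + 1)) := by ring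
          rw [h1]
          exact dvd_add hn.2 hd
      · rw [hm0 j hd, map_zero, zero_mul]
        exact zero_mem _
    · have h1 := hElow (i + 1)
      rw [Nat.cast_succ, show (i : ℤ) + 1 + 1 = i + 2 by ring] at h1
      exact h1
  have hBup : B ∈ supportedIn (Set.Iic ((i : ℤ) + 2 + p * ((N : ℤ) - 1))) := by
    obtain ⟨f, hf, hfmem⟩ := curveX_eq_T_add (p := p) (g := g) (R := R) (by omega)
    have hXE : curveX p g R * E i - E (i + 1)
        = progPoly p N (fun k => e i k - e (i + 1) k) (i + 2) + f * E i := by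
      have h1 : LaurentPolynomial.T 1 * E i = progPoly p (N + 1) (e i) (i + 2) := by
        simp only [hEdef, progPoly, Finset.mul_sum]
        refine Finset.sum_congr rfl fun k _ => ?_
        rw [mul_left_comm, ← LaurentPolynomial.T_add]
        congr 2
        ring
      have h2 : E (i + 1) = progPoly p (N + 1) (e (i + 1)) (i + 2) := by
        simp only [hEdef]
        rw [Nat.cast_succ, add_assoc, one_add_one_eq_two]
      rw [hf, add_mul, h1, h2, ← progPoly_sub, progPoly_succ, progPoly_succ, h.last, h.last]
      ring
    have hB3 : B = progPoly p N (fun k => e i k - e (i + 1) k) (i + 2) + f * E i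
        - ∑ k, LaurentPolynomial.C (g k) * D k
        - ∑ j ∈ Finset.range (i + 1), LaurentPolynomial.C (m j) * E j := by
      rw [hB, ← hXE]
      ring
    rw [hB3]
    refine sub_mem (sub_mem (add_mem ?_ ?_) (sum_mem fun k _ => C_mul_mem_supportedIn _ (hDmem k)))
      (sum_mem fun j hj => ?_)
    · refine progPoly_mem fun k hk => ?_
      have h1 : (k : ℤ) ≤ N - 1 := by omega
      have h2 : (p : ℤ) * k ≤ p * ((N : ℤ) - 1) := mul_le_mul_of_nonneg_left h1 (by omega)
      simp only [Set.mem_Iic]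
      linarith
    · refine mul_mem_supportedIn hfmem (hEup i) fun a ha b hb => ?_
      simp only [Set.mem_Iic] at *
      linarith
    · by_cases hd : (p : ℤ) ∣ (j : ℤ) - (i + 1)
      · refine C_mul_mem_supportedIn _ (supportedIn_mono (Set.Iic_subset_Iic.2 ?_) (hEup j))
        have h1 := Finset.mem_range.1 hj
        -- A nonzero m_j needs j ≡ i + 1 modulo p, so j ≤ i already forces j ≤ i + 1 - p and lowers
        -- the degree by a full period.
        have h2 : (p : ℤ) ≤ i + 1 - j :=
          Int.le_of_dvd (by omega) (by rw [← dvd_neg, neg_sub]; exact hd)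
        linarith
      · rw [hm0 j hd, map_zero, zero_mul]
        exact zero_mem _
  have hB0 : B = 0 := by
    have h1 : B ∈ supportedIn {n : ℤ | ∃ k : ℕ, k < N ∧ n = ((i + 2 : ℕ) : ℤ) + p * k} := by
      intro n hn
      by_cases h2 : (i : ℤ) + 2 ≤ n ∧ (p : ℤ) ∣ n - (i + 2)
      · refine hBup n fun h3 => hn ?_
        obtain ⟨h4, c, hc⟩ := h2
        have hp0 : (0 : ℤ) < p := by omega
        have hc0 : 0 ≤ c := by
          by_contra h5
          have h6 : (p : ℤ) * c < 0 := mul_neg_of_pos_of_neg hp0 (not_le.1 h5)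
          omega
        have hcN : c ≤ N - 1 := by
          simp only [Set.mem_Iic] at h3
          refine le_of_mul_le_mul_left ?_ hp0
          linarith
        obtain ⟨k, rfl⟩ := Int.eq_ofNat_of_zero_le hc0
        refine ⟨k, by omega, ?_⟩
        push_cast
        linarith
      · exact hBlow n h2
    have h2 := eq_progPoly (by omega) h1
    rw [h2] at hBglued
    rw [h2, eq_zero_of_mem_glued (hV (i + 2) (by omega)) hBglued]
  have hcoeff := congrArg (fun f : K[T;T⁻¹] => f.coeff ((i : ℤ) + 2)) (hB2.symm.trans hB0)
  have hUE : (U * E i).coeff ((i : ℤ) + 2) = U.coeff 1 * e i 0 := by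
    have h1 := coeff_mul_low (supportedIn_mono (fun n hn => hn.1) hUmem) (hElow' i)
    rwa [hElead, show (1 : ℤ) + (i + 1) = i + 2 by ring] at h1
  have hsum : (∑ j ∈ Finset.Ico (i + 1) M, LaurentPolynomial.C (m j) * E j).coeff ((i : ℤ) + 2)
      = m (i + 1) * e (i + 1) 0 := by
    rw [AddMonoidAlgebra.coeff_sum, Finsupp.finsetSum_apply,
      Finset.sum_eq_single_of_mem (i + 1) (Finset.mem_Ico.2 ⟨le_rfl, by omega⟩)]
    · have h1 := hElead (i + 1)
      rw [Nat.cast_succ, show (i : ℤ) + 1 + 1 = i + 2 by ring] at h1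
      rw [coeff_C_mul, h1]
    · intro j hj hne
      have h1 := (Finset.mem_Ico.1 hj).1
      rw [coeff_C_mul, hElow' j _ (by simp only [Set.mem_Ici]; omega), mul_zero]
  have hE1 : (E (i + 1)).coeff ((i : ℤ) + 2) = e (i + 1) 0 := by
    have h1 := hElead (i + 1)
    rwa [Nat.cast_succ, show (i : ℤ) + 1 + 1 = i + 2 by ring] at h1
  simp only [AddMonoidAlgebra.coeff_sub, AddMonoidAlgebra.coeff_add, Finsupp.sub_apply,
    Finsupp.add_apply, hUE, hsum, hE1] at hcoeff
  change _ = 0 at hcoeff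
  have hm1 : vertexSum p g r i (i + 1) = m (i + 1) := by
    simp only [hm]
    rw [Nat.cast_succ]
  rw [hm1]
  refine mul_right_cancel₀ (h.first i) ?_
  -- The vanishing coefficient reads U_1 e_i(0) = (1 - m_{i+1}) e_{i+1}(0). Then R U_1 = 1 and
  -- r_{i+1} e_i(0) = R e_{i+1}(0) eliminate the leading coefficients.
  linear_combination (1 - m (i + 1)) * h.mul_first i - R * hcoeff + e i 0 * hU1

end BakerAkhiezer


/-! ### Uniqueness of the solution of the recursion -/

section Uniqueness

variable {K : Type*} [Field K]

/-- The elements that are algebraic over the power series form a subfield. -/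
theorem exists_algebraic_subfield {ℓ : ℕ} (φ : Series ℓ →+* K) (hφ : Function.Injective φ) :
    ∃ A : Subfield K, (∀ f, φ f ∈ A) ∧
      (∀ (x : K) (q : Polynomial A), q ≠ 0 → q.eval₂ A.subtype x = 0 → x ∈ A) ∧
      ∀ x ∈ A, x ≠ 0 → ∃ q : Polynomial (Series ℓ), q.coeff 0 ≠ 0 ∧ q.eval₂ φ x = 0 := by
  have : IsDomain (Series ℓ) := hφ.isDomain φ
  let _ : Algebra (Series ℓ) K := φ.toAlgebra
  let _ : Algebra (FractionRing (Series ℓ)) K :=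
    (IsFractionRing.lift (K := FractionRing (Series ℓ)) hφ).toAlgebra
  have : IsScalarTower (Series ℓ) (FractionRing (Series ℓ)) K :=
    IsScalarTower.of_algebraMap_eq fun f => by
      rw [RingHom.algebraMap_toAlgebra (IsFractionRing.lift (K := FractionRing (Series ℓ)) hφ),
        IsFractionRing.lift_algebraMap]
      rfl
  refine ⟨(algebraicClosure (FractionRing (Series ℓ)) K).toSubfield, fun f => ?_,
    fun x q hq hx => ?_, fun x hx hx0 => ?_⟩
  · change φ f ∈ algebraicClosure (FractionRing (Series ℓ)) K
    rw [mem_algebraicClosure_iff, ← IsFractionRing.isAlgebraic_iff (Series ℓ)]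
    exact isAlgebraic_algebraMap f
  · change x ∈ algebraicClosure (FractionRing (Series ℓ)) K
    rw [mem_algebraicClosure_iff]
    have h1 : IsAlgebraic (algebraicClosure (FractionRing (Series ℓ)) K) x := ⟨q, hq, hx⟩
    exact h1.restrictScalars _
  · have h1 : x ∈ algebraicClosure (FractionRing (Series ℓ)) K := hx
    rw [mem_algebraicClosure_iff, ← IsFractionRing.isAlgebraic_iff (Series ℓ)] at h1
    exact h1.exists_nonzero_coeff_and_aeval_eq_zero (mem_nonZeroDivisors_of_ne_zero hx0)

theorem map_charPoly {F : Type*} [Field F] (f : F →+* K) (p : ℕ) {ℓ : ℕ} (g : Fin ℓ → F) (R : F) :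
    (charPoly p g R).map f = charPoly p (fun m => f (g m)) (f R) := by
  have h : ∀ j, f (R⁻¹ ^ j * alphaCoeff p g R j)
      = (f R)⁻¹ ^ j * alphaCoeff p (fun m => f (g m)) (f R) j := fun j => by
    rw [map_mul, map_pow, map_inv₀, map_alphaCoeff]
  simp only [charPoly, Polynomial.map_sub, Polynomial.map_sum, Polynomial.map_mul,
    Polynomial.map_pow, Polynomial.map_X, Polynomial.map_C, h]

/-- An algebraic element whose valuation is below all powers of the variables vanishes. -/
theorem ExtendsOrder.eq_zero_of_forall_le {ℓ : ℕ} {φ : Series ℓ →+* K} {O : ValuationSubring K}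
    (h : ExtendsOrder φ O) (hφ : Function.Injective φ) (k : Fin ℓ) {x : K}
    (hq : x ≠ 0 → ∃ q : Polynomial (Series ℓ), q.coeff 0 ≠ 0 ∧ q.eval₂ φ x = 0)
    (hx : ∀ n : ℕ, O.valuation x ≤ O.valuation (φ (MvPowerSeries.X k)) ^ n) : x = 0 := by
  by_contra hx0
  obtain ⟨q, hq0, hqx⟩ := hq hx0
  obtain ⟨d, hd⟩ := h.lower _ hq0
  have hx1 : O.valuation x ≤ 1 := by simpa using hx 0
  -- From q(0) = -x · (integral element) follows |φ(q(0))| ≤ |x|, which contradicts the lower bound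
  -- on the valuation of a nonzero series.
  rw [← Polynomial.divX_mul_X_add q, Polynomial.eval₂_add, Polynomial.eval₂_mul,
    Polynomial.eval₂_X, Polynomial.eval₂_C] at hqx
  have h1 : O.valuation (q.divX.eval₂ φ x) ≤ 1 := by
    rw [Polynomial.eval₂_eq_sum]
    refine O.valuation.map_sum_le fun n _ => ?_
    rw [map_mul, map_pow]
    exact mul_le_one' (h.le_one _) (pow_le_one' hx1 n)
  have h2 : O.valuation (φ (q.coeff 0)) ≤ O.valuation x := by
    rw [eq_neg_of_add_eq_zero_right hqx, Valuation.map_neg, map_mul]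
    exact mul_le_of_le_one_left' h1
  have h3 : O.valuation (φ (MvPowerSeries.X k)) ≠ 0 := by
    rw [Valuation.ne_zero_iff, map_ne_zero_iff φ hφ]
    intro h0
    have := congrArg MvPowerSeries.order h0
    rw [order_X, MvPowerSeries.order_zero] at this
    exact absurd this (by simp)
  have h4 := (hd k).trans (h2.trans (hx (d + 1)))
  rw [pow_succ] at h4
  have h5 : 0 < O.valuation (φ (MvPowerSeries.X k)) ^ d := pow_pos (zero_lt_iff.2 h3) _
  have h6 := mul_lt_mul_of_pos_left (h.X_lt k) h5
  rw [mul_one] at h6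
  exact absurd h4 (not_le.2 h6)

theorem valuation_pathWeight_le (v : ValuationSubring K) {r : ℤ → K}
    (hr : ∀ t, v.valuation (r t) ≤ 1) (p L : ℕ) (i j : ℤ) :
    v.valuation (pathWeight p r L i j) ≤ 1 := by
  induction L generalizing i with
  | zero => rw [pathWeight]; split_ifs <;> simp
  | succ L ih =>
    rw [pathWeight]
    refine v.valuation.map_add_le ?_ (ih _)
    rw [map_mul]
    exact mul_le_one' (hr _) (ih _)

theorem valuation_pathWeight_sub_le (v : ValuationSubring K) {r r' : ℤ → K}
    (hr : ∀ t, v.valuation (r t) ≤ 1) (hr' : ∀ t, v.valuation (r' t) ≤ 1) {c : v.ValueGroup}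
    (h : ∀ t, v.valuation (r t - r' t) ≤ c) (p L : ℕ) (i j : ℤ) :
    v.valuation (pathWeight p r L i j - pathWeight p r' L i j) ≤ c := by
  induction L generalizing i with
  | zero => simp [pathWeight]
  | succ L ih =>
    have h1 : pathWeight p r (L + 1) i j - pathWeight p r' (L + 1) i j
        = r i * (pathWeight p r L (i - 1) j - pathWeight p r' L (i - 1) j)
          + (r i - r' i) * pathWeight p r' L (i - 1) j
          + (pathWeight p r L (i + ((p : ℤ) - 1)) j
            - pathWeight p r' L (i + ((p : ℤ) - 1)) j) := by
      simp only [pathWeight]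
      ring
    rw [h1]
    refine v.valuation.map_add_le (v.valuation.map_add_le ?_ ?_) (ih _)
    · rw [map_mul]
      exact (mul_le_of_le_one_left' (hr i)).trans (ih _)
    · rw [map_mul]
      exact (mul_le_of_le_one_right' (valuation_pathWeight_le v hr' p L _ j)).trans (h i)

/-- Two bounded solutions of the recursion agree up to any power of the weights. -/
theorem valuation_sub_le_pow (v : ValuationSubring K) {p ℓ : ℕ} {g : Fin ℓ → K}
    {c : v.ValueGroup} (hg : ∀ k, v.valuation (g k) ≤ c) {r r' : ℤ → K}
    (hr : ∀ t, v.valuation (r t) ≤ 1) (hr' : ∀ t, v.valuation (r' t) ≤ 1)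
    (hr0 : ∀ i ≤ 0, r i = 0) (hr0' : ∀ i ≤ 0, r' i = 0)
    (h : ∀ i, 1 ≤ i → r i * (1 - vertexSum p g r (i - 1) i) = 1)
    (h' : ∀ i, 1 ≤ i → r' i * (1 - vertexSum p g r' (i - 1) i) = 1) (n : ℕ) (i : ℤ) :
    v.valuation (r i - r' i) ≤ c ^ n := by
  induction n generalizing i with
  | zero =>
    rw [pow_zero]
    exact v.valuation.map_sub_le (hr i) (hr' i)
  | succ n ih =>
    rcases le_or_gt i 0 with hi | hi
    · rw [hr0 i hi, hr0' i hi, sub_zero, map_zero]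
      exact zero_le
    -- Both values are inverses of 1 - `vertexSum`, so their difference is governed by that of the
    -- vertex sums, where a factor g_m is gained.
    · have h1 : r i - r' i = r i * r' i * (vertexSum p g r (i - 1) i
          - vertexSum p g r' (i - 1) i) := by
        linear_combination r' i * h i hi - r i * h' i hi
      have h2 : v.valuation (vertexSum p g r (i - 1) i - vertexSum p g r' (i - 1) i)
          ≤ c ^ (n + 1) := by
        rw [vertexSum, vertexSum, ← Finset.sum_sub_distrib]
        refine v.valuation.map_sum_le fun k _ => ?_
        rw [← mul_sub, map_mul, pow_succ']
        exact mul_le_mul' (hg k) (valuation_pathWeight_sub_le v hr hr' ih p _ _ _)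
      rw [h1, map_mul, map_mul]
      exact (mul_le_of_le_one_left' (mul_le_one' (hr i) (hr' i))).trans h2

end Uniqueness

-- Ratios of determinants, independent of the order in the pairs

section Ratios

variable {K : Type*} [Field K] {p N : ℕ}

/-- The ratio of determinants in the formula for the generating functions of mobiles. -/
def vRatio (p : ℕ) (w wb : Fin N → Kˣ) (i : ℕ) : K :=
  vDet w wb p i * vDet w wb p (i + p + 1) / (vDet w wb p (i + 1) * vDet w wb p (i + p))

theorem vRatio_eq {w wb : Fin N → Kˣ} (hinj : Function.Injective fun a => (wb a : K) ^ p)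
    (i : ℕ) : vRatio p w wb i = pairDet p w wb i * pairDet p w wb (i + p + 1)
      / (pairDet p w wb (i + 1) * pairDet p w wb (i + p)) := by
  simp only [← vDet_mul_eq_pairDet hinj]
  have hV : (Matrix.vandermonde fun a => (wb a : K) ^ p).det ≠ 0 :=
    Matrix.det_vandermonde_ne_zero_iff.2 hinj
  have hb : (∏ a, (wb a : K)) ≠ 0 := Finset.prod_ne_zero_iff.2 fun a _ => (wb a).ne_zero
  set V := (Matrix.vandermonde fun a => (wb a : K) ^ p).det
  set b := ∏ a, (wb a : K)
  -- The indices in the numerator and in the denominator both add up to 2i + p + 1, so the auxiliary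
  -- factors cancel.
  rw [vRatio, ← mul_div_mul_right _ _ (mul_ne_zero (mul_ne_zero hV hV)
    (pow_ne_zero (2 * i + p + 1) hb))]
  congr 1 <;> ring

theorem vDet_ne_zero_iff {w wb : Fin N → Kˣ} (hinj : Function.Injective fun a => (wb a : K) ^ p)
    (i : ℕ) : vDet w wb p i ≠ 0 ↔ pairDet p w wb i ≠ 0 := by
  rw [← vDet_mul_eq_pairDet hinj, mul_ne_zero_iff, and_iff_left]
  exact mul_ne_zero (Matrix.det_vandermonde_ne_zero_iff.2 hinj)
    (pow_ne_zero _ (Finset.prod_ne_zero_iff.2 fun a _ => (wb a).ne_zero))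

theorem prod_swap_sign_ne_zero (e : Fin N → Prop) [DecidablePred e] :
    (∏ a, if e a then (-1 : K) else 1) ≠ 0 :=
  Finset.prod_ne_zero_iff.2 fun a _ => by split_ifs <;> simp

theorem pairDet_ratio_swap (w wb : Fin N → Kˣ) (e : Fin N → Prop) [DecidablePred e]
    (i j k l : ℕ) :
    pairDet p (fun a => if e a then wb a else w a) (fun a => if e a then w a else wb a) i
      * pairDet p (fun a => if e a then wb a else w a) (fun a => if e a then w a else wb a) j
      / (pairDet p (fun a => if e a then wb a else w a) (fun a => if e a then w a else wb a) k
      * pairDet p (fun a => if e a then wb a else w a) (fun a => if e a then w a else wb a) l)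
    = pairDet p w wb i * pairDet p w wb j / (pairDet p w wb k * pairDet p w wb l) := by
  simp only [pairDet_swap]
  have h := prod_swap_sign_ne_zero (K := K) e
  rw [mul_mul_mul_comm, mul_mul_mul_comm _ (pairDet p w wb k), mul_div_mul_left _ _ (mul_ne_zero h h)]

theorem vDet_mem {A : Subfield K} {w wb : Fin N → Kˣ} (hw : ∀ a, (w a : K) ∈ A)
    (hwb : ∀ a, (wb a : K) ∈ A) (i : ℕ) : vDet w wb p i ∈ A := by
  rw [vDet, ratioDet, Matrix.det_apply']
  refine sum_mem fun σ _ => mul_mem (intCast_mem _ _) (prod_mem fun a _ => ?_)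
  have h : ∀ a b, (w a : K) ^ p - (wb b : K) ^ p ∈ A := fun a b =>
    sub_mem (pow_mem (hw a) _) (pow_mem (hwb b) _)
  refine sub_mem ?_ (mul_mem (div_mem (prod_mem fun c _ => h _ c)
    (prod_mem fun c _ => sub_mem (pow_mem (hwb _) _) (pow_mem (hwb c) _)))
    (pow_mem (div_mem (hw _) (hwb _)) _))
  split_ifs
  exacts [one_mem _, zero_mem _]

end Ratios


/-! ### The generating functions of mobiles -/

section Gluing

variable {K : Type*} [Field K] {p ℓ : ℕ}

theorem eval₂_curveY_map {S : Type*} [CommRing S] (φ : S →+* K) (R : S) (z : Kˣ) :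
    LaurentPolynomial.eval₂ (RingHom.id K) z (curveY p (φ R))
      = LaurentPolynomial.eval₂ φ z (curveY p R) := by
  simp only [curveY, map_add, LaurentPolynomial.eval₂_C_mul_T, LaurentPolynomial.eval₂_T,
    RingHom.id_apply]

theorem eval₂_curveX_map {S : Type*} [CommRing S] (φ : S →+* K) (g : Fin ℓ → S) (R : S) (z : Kˣ) :
    LaurentPolynomial.eval₂ (RingHom.id K) z (curveX p (fun m => φ (g m)) (φ R))
      = LaurentPolynomial.eval₂ φ z (curveX p g R) := by
  simp only [curveX, map_add, map_sum, LaurentPolynomial.eval₂_C_mul_T, LaurentPolynomial.eval₂_T,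
    RingHom.id_apply]
  simp only [map_alphaCoeff]

variable {φ : Series ℓ →+* K} {R : Series ℓ} {w wb : Fin (orbitCount p ℓ) → Kˣ}

theorem IsClassification.mem_doublePoints {Ω : Kˣ} (hp : 0 < p)
    (h : IsClassification p φ R Ω w wb) (a : Fin (orbitCount p ℓ)) :
    (w a, wb a) ∈ doublePoints p φ R := by
  have h1 : orbitPoint (p := p) Ω w wb (a, ⟨0, hp⟩, false) ∈ doublePoints p φ R := h.1 trivial
  simpa [orbitPoint] using h1

theorem curveX_mem_glued (h : ∀ a, (w a, wb a) ∈ doublePoints p φ R) :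
    curveX p (fun m => φ (MvPowerSeries.X m)) (φ R) ∈ glued w wb :=
  mem_glued.2 fun a => by
    rw [eval₂_curveX_map, eval₂_curveX_map]
    exact (h a).2.1

theorem curveY_mem_glued (h : ∀ a, (w a, wb a) ∈ doublePoints p φ R) :
    curveY p (φ R) ∈ glued w wb :=
  mem_glued.2 fun a => by
    rw [eval₂_curveY_map, eval₂_curveY_map]
    exact (h a).2.2

end Gluing

-- Identification of the solution with the series of mobiles

section Solution

variable {K : Type*} [Field K] [IsAlgClosed K] {p ℓ : ℕ} {φ : Series ℓ →+* K}
  {O : ValuationSubring K} {w wb : Fin (orbitCount p ℓ) → Kˣ}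

omit [IsAlgClosed K] in
theorem RootData.root_mem {r : K} (h : RootData p (fun m => φ (MvPowerSeries.X m)) r w wb)
    (hs : IsSmall O p (fun m => φ (MvPowerSeries.X m)) r) (hp : 2 ≤ p) (hℓ : 1 ≤ ℓ)
    {A : Subfield K} (hA : ∀ f, φ f ∈ A) (hr : r ∈ A)
    (hroot : ∀ (x : K) (q : Polynomial A), q ≠ 0 → q.eval₂ A.subtype x = 0 → x ∈ A)
    (a : Fin (orbitCount p ℓ)) : (w a : K) ∈ A ∧ (wb a : K) ∈ A := by
  have hmap := map_charPoly A.subtype p (fun m : Fin ℓ => ⟨φ (MvPowerSeries.X m), hA _⟩) ⟨r, hr⟩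
  have hx : root w wb a ∈ A := by
    refine hroot _ (charPoly p (fun m : Fin ℓ => ⟨φ (MvPowerSeries.X m), hA _⟩) ⟨r, hr⟩)
      (fun h0 => ?_) ?_
    · rw [h0, Polynomial.map_zero] at hmap
      exact hs.charPoly_ne_zero hp hℓ hmap.symm
    · rw [← Polynomial.eval_map, hmap]
      exact h.eval_eq a
  have hξ : xi p (root w wb a) ∈ A := sum_mem fun k _ => pow_mem hx _
  have hξ0 : xi p (root w wb a) ≠ 0 := hs.xi_ne_zero hp hℓ (h.eval_eq a)
  have hb : (wb a : K) ∈ A := by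
    have h1 : (wb a : K) ^ p ∈ A := by
      rw [eq_div_of_mul_eq hξ0 (h.eq_xi a).symm]
      exact div_mem hr hξ
    refine hroot _ (Polynomial.X ^ p - Polynomial.C ⟨_, h1⟩)
      (Polynomial.X_pow_sub_C_ne_zero (by omega) _) ?_
    simp
  refine ⟨?_, hb⟩
  rw [← div_mul_cancel₀ (w a : K) (wb a).ne_zero]
  exact mul_mem hx hb

/-- For small roots the v_j with j ≥ 1 are units, so the candidate r is bounded and solves the same
recursion as the images of the R_i, with the same zero values at nonpositive labels. -/
theorem map_mobileSeries_of_small (hφ : Function.Injective φ) (ho : ExtendsOrder φ O) (hp : 2 ≤ p)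
    (hℓ : 1 ≤ ℓ) (h : RootData p (fun m => φ (MvPowerSeries.X m)) (φ (limitSeries p ℓ)) w wb)
    (hX : curveX p (fun m => φ (MvPowerSeries.X m)) (φ (limitSeries p ℓ)) ∈ glued w wb)
    (hY : curveY p (φ (limitSeries p ℓ)) ∈ glued w wb)
    (hsmall : ∀ a, O.valuation (root w wb a) < 1) {i : ℕ} (hi : 1 ≤ i) :
    φ (mobileSeries p ℓ i) = φ (limitSeries p ℓ) * vRatio p w wb i := by
  obtain ⟨hR1, hs⟩ := ho.isSmall hφ hp hℓ
  have hR0 : φ (limitSeries p ℓ) ≠ 0 := fun h0 => by simp [h0] at hR1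
  have hinj := h.injective_wb_pow hs hp hℓ
  have hv := fun j hj => h.valuation_vDet hs hp hℓ hR0 hsmall (i := j) hj
  have hv0 : ∀ j, 1 ≤ j → vDet w wb p j ≠ 0 := fun j hj h0 => by
    have := hv j hj
    simp [h0] at this
  have hV : ∀ j, 1 ≤ j → pairDet p w wb j ≠ 0 := fun j hj =>
    (vDet_ne_zero_iff hinj j).1 (hv0 j hj)
  have hratio : ∀ j, 1 ≤ j → O.valuation (vRatio p w wb j) = 1 := fun j hj => by
    rw [vRatio, map_div₀, map_mul, map_mul, hv _ hj, hv _ (by omega), hv _ (by omega),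
      hv _ (by omega)]
    simp
  set r : ℤ → K := fun t => if t ≤ 0 then 0 else φ (limitSeries p ℓ) * vRatio p w wb t.toNat
    with hrdef
  have hr0 : ∀ t ≤ 0, r t = 0 := fun t ht => if_pos ht
  have hrpos : ∀ n : ℕ, r (n + 1) = φ (limitSeries p ℓ) * vRatio p w wb (n + 1) := fun n => by
    simp only [hrdef]
    rw [if_neg (by omega)]
    rfl
  obtain ⟨e, hwave, hE⟩ := exists_isWave (p := p) (R := φ (limitSeries p ℓ)) (by omega) hY hV r
    fun n => by
      rw [hrpos, vRatio_eq hinj, ← mul_div_assoc, show n + 1 + p + 1 = n + p + 2 by ring,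
        show n + 1 + p = n + p + 1 by ring]
  have hN : orbitCount p ℓ + 1 = (p - 1) * ℓ := orbitCount_add_one hp hℓ
  have hlim : φ (limitSeries p ℓ) * (1 - ∑ k : Fin ℓ, φ (MvPowerSeries.X k)
      * pathSeries p (φ (limitSeries p ℓ)) (p * (k.val + 1) - 1) 1) = 1 := by
    have := congrArg φ (limitSeries_mul (p := p) (ℓ := ℓ) (by omega))
    simpa only [map_mul, map_sub, map_one, map_sum, map_pathSeries] using this
  have hsol := hwave.mul_one_sub_vertexSum hp hN hr0 hlim hX hY hV hE
  have hr1 : ∀ t, O.valuation (r t) ≤ 1 := fun t => by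
    simp only [hrdef]
    split_ifs with ht
    · simp
    · rw [map_mul, hR1, hratio _ (by omega), one_mul]
  have hle := fun n => valuation_sub_le_pow O (p := p)
    (g := fun m : Fin ℓ => φ (MvPowerSeries.X m)) (r := r)
    (r' := fun t => φ (labelSeries p ℓ t)) (c := O.valuation (φ (MvPowerSeries.X ⟨0, hℓ⟩)))
    (fun k => (ho.X_eq k _).le) hr1 (fun t => ho.le_one _) hr0
    (fun t ht => by rw [labelSeries_of_nonpos (by omega) ht, map_zero])
    (fun t ht => by
      obtain ⟨n, rfl⟩ : ∃ n : ℕ, t = n + 1 := ⟨(t - 1).toNat, by omega⟩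
      rw [add_sub_cancel_right]
      exact hsol n)
    (fun t ht => by
      have := congrArg φ (labelSeries_mul (p := p) (ℓ := ℓ) (by omega) ht)
      simpa only [map_mul, map_sub, map_one, map_vertexSum, Function.comp_def] using this) n i
  -- The field K may contain nonzero elements below all powers of |g_m|, so the bounds `hle` alone
  -- do not suffice. The candidate is a rational expression in the w_a, w̄_a and R, all algebraic
  -- over the series.
  obtain ⟨A, hA, hroot, halg⟩ := exists_algebraic_subfield φ hφ
  have hwA := h.root_mem hs hp hℓ hA (hA _) hroot
  have hvA := vDet_mem (p := p) (fun a => (hwA a).1) (fun a => (hwA a).2)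
  have hriA : r i ∈ A := by
    obtain ⟨n, rfl⟩ : ∃ n : ℕ, i = n + 1 := ⟨i - 1, by omega⟩
    push_cast
    rw [hrpos]
    exact mul_mem (hA _) (div_mem (mul_mem (hvA _) (hvA _)) (mul_mem (hvA _) (hvA _)))
  have hzero := ho.eq_zero_of_forall_le hφ ⟨0, hℓ⟩ (halg _ (sub_mem hriA (hA _))) hle
  have h1 := sub_eq_zero.1 hzero
  simp only [hrdef] at h1
  rw [if_neg (by omega), Int.toNat_natCast] at h1
  rw [h1]
  rfl

/-- The formula for the generating functions of mobiles, for any choice of representatives. -/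
theorem IsClassification.map_mobileSeries (hφ : Function.Injective φ) (ho : ExtendsOrder φ O)
    (hp : 2 ≤ p) (hℓ : 1 ≤ ℓ) {Ω : Kˣ} (hΩ : IsPrimitiveRoot Ω p)
    (h : IsClassification p φ (limitSeries p ℓ) Ω w wb) {i : ℕ} (hi : 1 ≤ i) :
    vDet w wb p i ≠ 0 ∧ φ (mobileSeries p ℓ i) = φ (limitSeries p ℓ) * vRatio p w wb i := by
  obtain ⟨hR1, hs⟩ := ho.isSmall hφ hp hℓ
  have hR0 : φ (limitSeries p ℓ) ≠ 0 := fun h0 => by simp [h0] at hR1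
  have hd := h.rootData hp hℓ hR0 hΩ
  have hmem := h.mem_doublePoints (by omega)
  obtain ⟨e, he, hsmall⟩ := hd.exists_small_orientation hs
  have hd' := hd.swap hp hℓ e
  have hmem' : ∀ a, ((fun a => if e a then wb a else w a) a, (fun a => if e a then w a else wb a) a)
      ∈ doublePoints p φ (limitSeries p ℓ) := fun a => by
    by_cases ha : e a
    · simpa [ha] using swap_mem_doublePoints (hmem a)
    · simpa [ha] using hmem a
  have hinj := hd.injective_wb_pow hs hp hℓ
  have hinj' := hd'.injective_wb_pow hs hp hℓ
  constructor
  · rw [vDet_ne_zero_iff hinj]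
    have h1 : O.valuation (vDet _ _ p i) = 1 := hd'.valuation_vDet hs hp hℓ hR0 hsmall hi
    have h2 := (vDet_ne_zero_iff hinj' i).1 fun h0 =>
      one_ne_zero (h1.symm.trans ((congrArg _ h0).trans (map_zero _)))
    rw [pairDet_swap] at h2
    exact right_ne_zero_of_mul h2
  · rw [map_mobileSeries_of_small hφ ho hp hℓ hd' (curveX_mem_glued hmem')
      (curveY_mem_glued hmem') hsmall hi, vRatio_eq hinj, vRatio_eq hinj', pairDet_ratio_swap]

end Solution

-- From windows of p consecutive factors to single factors

section Telescoping

variable {K : Type*} [Field K]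

/-- Sliding a window of p consecutive factors by one multiplies its product by f(n+p+1)/f(n+1). The
claim is the quotient of two successive slides. -/
theorem prod_Icc_mul_div (f : ℕ → K) (hf : ∀ j, 1 ≤ j → f j ≠ 0) (p : ℕ) {i : ℕ} (hi : 1 ≤ i) :
    (∏ s ∈ Finset.Icc 1 p, f (i - 1 + s)) * (∏ s ∈ Finset.Icc 1 p, f (i + 1 + s))
      / (∏ s ∈ Finset.Icc 1 p, f (i + s)) ^ 2 = f i * f (i + p + 1) / (f (i + 1) * f (i + p)) := by
  obtain ⟨n, rfl⟩ : ∃ n, i = n + 1 := ⟨i - 1, by omega⟩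
  have hP : ∀ n, ∏ s ∈ Finset.Icc 1 p, f (n + s) ≠ 0 := fun n =>
    Finset.prod_ne_zero_iff.2 fun s hs => hf _ (by have := (Finset.mem_Icc.1 hs).1; omega)
  have hstep : ∀ n, (∏ s ∈ Finset.Icc 1 p, f (n + s)) * f (n + p + 1)
      = f (n + 1) * ∏ s ∈ Finset.Icc 1 p, f (n + 1 + s) := fun n => by
    have h1 := Finset.prod_Icc_succ_top (show 1 ≤ p + 1 by omega) fun s => f (n + s)
    rw [← add_assoc] at h1
    rw [← h1, ← Finset.mul_prod_Ioc_eq_prod_Icc (show 1 ≤ p + 1 by omega)]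
    congr 1
    have h2 := Finset.prod_image (f := fun s => f (n + s)) (s := Finset.Icc 1 p) (g := (· + 1))
      fun a _ b _ hab => by simpa using hab
    have h3 : (Finset.Icc 1 p).image (· + 1) = Finset.Ioc 1 (p + 1) := by
      ext x
      simp only [Finset.mem_image, Finset.mem_Icc, Finset.mem_Ioc]
      exact ⟨fun ⟨a, ha, hx⟩ => by omega, fun hx => ⟨x - 1, by omega, by omega⟩⟩
    rw [← h3, h2]
    exact Finset.prod_congr rfl fun s _ => by congr 1; ring
  have h1 := hstep n
  have h2 := hstep (n + 1)
  rw [add_tsub_cancel_right, div_eq_div_iff (pow_ne_zero 2 (hP _))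
    (mul_ne_zero (hf _ (by omega)) (hf _ (by omega)))]
  rw [show n + 1 + p = n + p + 1 by ring] at h2 ⊢
  linear_combination (∏ s ∈ Finset.Icc 1 p, f (n + 1 + 1 + s)) * f (n + 1 + 1) * h1
    - f (n + 1) * (∏ s ∈ Finset.Icc 1 p, f (n + 1 + s)) * h2

end Telescoping

end

end PConstellation

-- Assembly of the main theorem

theorem mainTheorem2 (p ℓ : ℕ) (hp : 2 ≤ p) (hℓ : 1 ≤ ℓ) :
    ∃ R : PConstellation.Series ℓ,
      -- `R` and the spectral curve are the large-label limits of the generating functions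
      PConstellation.ConvergesTo (fun i => PConstellation.mobileSeries p ℓ i) R ∧
      (∀ k : ℕ, PConstellation.ConvergesTo (fun i => PConstellation.whiteSeries p ℓ i (i - k))
        ((PConstellation.curveX p MvPowerSeries.X R).coeff (-(k : ℤ)))) ∧
      (∀ k : ℕ, PConstellation.ConvergesTo (fun i => PConstellation.blackSeries p ℓ i (i + k))
        ((PConstellation.curveY p R).coeff (k : ℤ))) ∧
      -- the equation that determines `R`
      R * (1 - ∑ m : Fin ℓ,
        MvPowerSeries.X m * PConstellation.pathSeries p R (p * (m.val + 1) - 1) 1) = 1 ∧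
      ∀ (K : Type*) [Field K] [IsAlgClosed K] (φ : PConstellation.Series ℓ →+* K),
        Function.Injective φ → ∀ Ω : Kˣ, IsPrimitiveRoot Ω p →
        -- the double points come in `N_0` orbits of `p` pairs
        (∃ w wb, PConstellation.IsClassification p φ R Ω w wb) ∧
        ∀ w wb, PConstellation.IsClassification p φ R Ω w wb →
          -- the `2 p N_0` elements of the double points are pairwise distinct
          (Function.Injective fun t => (PConstellation.orbitPoint (p := p) Ω w wb t).1) ∧
          -- `w_a` and `w̄_a` in terms of `X_a`
          (∀ a, φ R = (wb a : K) ^ p * PConstellation.xi p (PConstellation.root w wb a) ∧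
            φ R = (w a : K) ^ p * PConstellation.chi p (PConstellation.root w wb a)) ∧
          -- the `X_a` and `1 / X_a` are the `2 N_0` distinct roots of the characteristic equation
          (PConstellation.charPoly p (fun m => φ (MvPowerSeries.X m)) (φ R)).natDegree
            = 2 * PConstellation.orbitCount p ℓ ∧
          (PConstellation.charPoly p (fun m => φ (MvPowerSeries.X m)) (φ R)).roots
            = Finset.univ.val.map (fun a => PConstellation.root w wb a)
              + Finset.univ.val.map (fun a => (PConstellation.root w wb a)⁻¹) ∧
          (PConstellation.charPoly p (fun m => φ (MvPowerSeries.X m)) (φ R)).roots.Nodup ∧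
          -- factorization of the two expressions of `h̄_i`
          (∀ i : ℕ,
            PConstellation.hBar Ω w wb p i = PConstellation.hBar' Ω w wb p i ∧
            PConstellation.hBar Ω w wb p i
              = ∏ s ∈ Finset.Icc 1 p, PConstellation.uDet w wb p (i + s) ∧
            PConstellation.hBar' Ω w wb p i
              = ∏ s ∈ Finset.Icc 1 p, PConstellation.vDet w wb p (i + s) ∧
            PConstellation.hBar Ω w wb p i ≠ 0) ∧
          -- the formulas for `R_i`
          (∀ i : ℕ, 1 ≤ i →
            PConstellation.uDet w wb p i ≠ 0 ∧ PConstellation.vDet w wb p i ≠ 0 ∧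
            φ (PConstellation.mobileSeries p ℓ i)
              = φ R * (PConstellation.hBar Ω w wb p (i - 1) * PConstellation.hBar Ω w wb p (i + 1))
                / PConstellation.hBar Ω w wb p i ^ 2 ∧
            φ (PConstellation.mobileSeries p ℓ i)
              = φ R * (PConstellation.uDet w wb p i * PConstellation.uDet w wb p (i + p + 1))
                / (PConstellation.uDet w wb p (i + 1) * PConstellation.uDet w wb p (i + p)) ∧
            φ (PConstellation.mobileSeries p ℓ i)
              = φ R * (PConstellation.vDet w wb p i * PConstellation.vDet w wb p (i + p + 1))
                / (PConstellation.vDet w wb p (i + 1) * PConstellation.vDet w wb p (i + p))) ∧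
          -- `u_i` and `v_i` in terms of the `X_a` only
          (∀ (i : ℕ) (x ξ χ : Fin (PConstellation.orbitCount p ℓ) → K),
            x = PConstellation.root w wb →
            ξ = (fun a => PConstellation.xi p (x a)) →
            χ = (fun a => PConstellation.chi p (x a)) →
            PConstellation.uDet w wb p i = PConstellation.ratioDet ξ χ (fun a => x a ^ i) ∧
            PConstellation.uDet w wb p i = PConstellation.cauchyDet ξ χ (fun a => x a ^ i) ∧
            PConstellation.uDet w wb p i = PConstellation.subsetSum ξ χ (fun a => x a ^ i) ∧
            PConstellation.vDet w wb p i = PConstellation.ratioDet χ ξ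
              (fun a => x a ^ (i + p * (PConstellation.orbitCount p ℓ - 1))) ∧
            PConstellation.vDet w wb p i = PConstellation.cauchyDet χ ξ
              (fun a => x a ^ (i + p * (PConstellation.orbitCount p ℓ - 1))) ∧
            PConstellation.vDet w wb p i = PConstellation.subsetSum χ ξ
              (fun a => x a ^ (i + p * (PConstellation.orbitCount p ℓ - 1)))) := by
  refine ⟨PConstellation.limitSeries p ℓ,
    PConstellation.convergesTo_mobileSeries (by omega),
    PConstellation.convergesTo_whiteSeries (by omega),
    PConstellation.convergesTo_blackSeries (by omega) _,
    PConstellation.limitSeries_mul (by omega), ?_⟩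
  intro K _ _ φ hφ Ω hΩ
  obtain ⟨O, ho⟩ := PConstellation.exists_extendsOrder φ hφ
  obtain ⟨hR1, hs⟩ := ho.isSmall hφ hp hℓ
  have hR0 : φ (PConstellation.limitSeries p ℓ) ≠ 0 := fun h0 => by simp [h0] at hR1
  obtain ⟨w₀, wb₀, h₀, -⟩ := PConstellation.exists_isClassification hp hℓ hR0 hs hΩ
  refine ⟨⟨w₀, wb₀, h₀⟩, fun w wb h => ?_⟩
  have hd := h.rootData hp hℓ hR0 hΩ
  have hinj := h.injective_fst hp hℓ hR0 hs
  have huv := hd.uDet_eq_vDet hs hp hℓ hR0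
  have hv := fun i hi => (h.map_mobileSeries hφ ho hp hℓ hΩ (i := i) hi).1
  have hm := fun i hi => (h.map_mobileSeries hφ ho hp hℓ hΩ (i := i) hi).2
  have hu : ∀ i, PConstellation.hBar Ω w wb p i
      = ∏ s ∈ Finset.Icc 1 p, PConstellation.vDet w wb p (i + s) := fun i => by
    rw [PConstellation.RootData.hBar_eq_prod hp hΩ hinj]
    exact Finset.prod_congr rfl fun s _ => huv _
  refine ⟨hinj, fun a => ⟨hd.eq_xi a, hd.eq_chi a⟩,
    PConstellation.natDegree_charPoly hp hℓ _ _ (hs.eval_zero_ne hp hℓ),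
    hd.roots_eq hp hℓ hs, hs.nodup_roots hp hℓ, fun i => ⟨?_, ?_, ?_, ?_⟩,
    fun i hi => ⟨?_, hv i hi, ?_, ?_, ?_⟩, ?_⟩
  · rw [hu, PConstellation.RootData.hBar'_eq_prod hp hΩ hinj]
  · exact PConstellation.RootData.hBar_eq_prod hp hΩ hinj i
  · exact PConstellation.RootData.hBar'_eq_prod hp hΩ hinj i
  · rw [hu]
    exact Finset.prod_ne_zero_iff.2 fun s hs => hv _
      (le_add_left (Finset.mem_Icc.1 hs).1)
  · rw [huv]
    exact hv i hi
  · rw [hu, hu, hu, mul_div_assoc, PConstellation.prod_Icc_mul_div _ hv p hi]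
    exact hm i hi
  · rw [huv, huv, huv, huv, mul_div_assoc]
    exact hm i hi
  · rw [mul_div_assoc]
    exact hm i hi
  · rintro i x ξ χ rfl rfl rfl
    have hne := hd.xi_ne_chi hs hp hℓ
    have hne' := fun a b => (hne b a).symm
    have h1 := hd.uDet_eq hs hp hℓ hR0 i
    have h2 := hd.vDet_eq hs hp hℓ hR0 i
    exact ⟨h1, h1.trans (PConstellation.ratioDet_eq_cauchyDet hne),
      h1.trans (PConstellation.ratioDet_eq_subsetSum (hd.injective_chi hs hp hℓ) hne),
      h2, h2.trans (PConstellation.ratioDet_eq_cauchyDet hne'),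
      h2.trans (PConstellation.ratioDet_eq_subsetSum (hd.injective_xi hs hp hℓ) hne')⟩
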